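/- Let $g\in C^2(\mathbb{R})$ be bounded and strictly increasing, with $g(0)=0$, strictly concave on $(0,+\infty)$ and strictly convex on $(-\infty,0)$. Let $g_\pm=\lim_{s\to\pm\infty}g(s)$ and $G(s)=\int_0^s g$. Let $p:\mathbb{R}\to\mathbb{R}$ be continuous and bounded with an asymptotic average $A(p)$, i.e. $\frac1T\int_t^{t+T}p(s)\,ds\to A(p)$ as $T\to+\infty$, uniformly in $t\in\mathbb{R}$, and suppose $g_-<A(p)<g_+$. For $a<b$ put $$J_{(a,b)}(u)=\int_a^b\Big[\tfrac12\dot u^2(t)-G(u(t))+p(t)u(t)\Big]dt,\qquad \varphi^\pm(a,b)=\inf\{J_{(a,b)}(u):u\in H^1_0(a,b),\ \pm u\ge 0\}.$$ Then there is $L_0>0$ (depending on $g$ and $p$) such that the following holds. (i) Whenever $b-a\ge L_0$, each of $\varphi^+(a,b)$ and $\varphi^-(a,b)$ is attained by a unique function $u_+(\cdot\,;a,b)$, respectively $u_-(\cdot\,;a,b)$, and $u_+>0$, $u_-<0$ in $(a,b)$. (ii) For every $L\ge L_0$ there is $H$, depending only on $L$ and $p$ (with $g$ fixed), such that for all real $A,B$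 and all integers $k\ge 0$ with $B-A\ge H(k+1)$ the following is true. Let $\sigma(i)=+$ for even $i$ and $\sigma(i)=-$ for odd $i$, and let $A=\bar t_0\le\bar t_1\le\dots\le\bar t_k\le\bar t_{k+1}=B$ be a partition that maximizes $$\sum_{i=0}^k\varphi^{\sigma(i)}(t_i,t_{i+1})$$ among all partitions $A=t_0\le t_1\le\dots\le t_k\le t_{k+1}=B$ with $t_{i+1}-t_i\ge L$ for $i=0,\dots,k$. Then the function on $[A,B]$ equal to $u_{\sigma(i)}(\cdot\,;\bar t_i,\bar t_{i+1})$ on $[\bar t_i,\bar t_{i+1}]$ for $i=0,\dots,k$ is of class $C^2$ in $(A,B)$, solves $\ddot u+g(u)=p(t)$ there, and has exactly $k$ zeros in $(A,B)$. -/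

import Mathlib

open MeasureTheory Set Filter Topology

noncomputable section

/-- The assumptions on the reaction term: `g(0) = 0`, `g` is of class `C²`, bounded, strictly
increasing, strictly concave on `(0, ∞)` and strictly convex on `(-∞, 0)`. -/
structure IsReaction (g : ℝ → ℝ) : Prop where
  zero : g 0 = 0
  contDiff : ContDiff ℝ 2 g
  bounded : ∃ M : ℝ, ∀ s, |g s| ≤ M
  strictMono : StrictMono g
  strictConcave : StrictConcaveOn ℝ (Ioi 0) g
  strictConvex : StrictConvexOn ℝ (Iio 0) g

/-- `p` has asymptotic average `m`: the means of `p` over `[t, t + T]` tend to `m` as `T → ∞`,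
uniformly in `t`. -/
def HasAsymptoticAverage (p : ℝ → ℝ) (m : ℝ) : Prop :=
  ∀ ε > 0, ∃ T₀ > 0, ∀ T > T₀, ∀ t : ℝ, |1 / T * (∫ s in t..(t + T), p s) - m| < ε

/-- The primitive of `g` vanishing at `0`. -/
def primitive (g : ℝ → ℝ) (s : ℝ) : ℝ := ∫ r in (0 : ℝ)..s, g r

/-- The Sobolev space `H¹₀(a, b)` (continuous representatives): absolutely continuous functions
on `[a, b]` with square integrable derivative, vanishing at `a` and `b`. -/
def H10 (a b : ℝ) : Set (ℝ → ℝ) :=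
  {u | AbsolutelyContinuousOnInterval u a b ∧ MemLp (deriv u) 2 (volume.restrict (Ioo a b)) ∧
    u a = 0 ∧ u b = 0}

/-- The functions of `H¹₀(a, b)` that are nonnegative (for `σ = 1`), respectively nonpositive
(for `σ = -1`), on `[a, b]`. -/
def signedH10 (σ a b : ℝ) : Set (ℝ → ℝ) := {u ∈ H10 a b | ∀ t ∈ Icc a b, 0 ≤ σ * u t}

/-- The action functional `J_{(a,b)}(u) = ∫ₐᵇ (u̇² / 2 - G(u) + p u) dt`. -/
def action (g p : ℝ → ℝ) (a b : ℝ) (u : ℝ → ℝ) : ℝ :=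
  ∫ t in a..b, (1 / 2 * deriv u t ^ 2 - primitive g (u t) + p t * u t)

/-- The minimal energy `φ^σ(a, b)`: the infimum of the action over `signedH10 σ a b`. -/
def minEnergy (g p : ℝ → ℝ) (σ a b : ℝ) : ℝ := sInf (action g p a b '' signedH10 σ a b)

/-- `u` minimizes the action over `signedH10 σ a b`. -/
def IsMinimizer (g p : ℝ → ℝ) (σ a b : ℝ) (u : ℝ → ℝ) : Prop :=
  u ∈ signedH10 σ a b ∧ IsMinOn (action g p a b) (signedH10 σ a b) u

/-- Admissible partitions `A = t₀ ≤ t₁ ≤ ⋯ ≤ tₖ ≤ tₖ₊₁ = B` of `[A, B]` in `k + 1` intervals of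
length at least `L`. -/
def partitions (L A B : ℝ) (k : ℕ) : Set (Fin (k + 2) → ℝ) :=
  {t | t 0 = A ∧ t (Fin.last (k + 1)) = B ∧
    ∀ i : Fin (k + 1), t i.castSucc ≤ t i.succ ∧ L ≤ t i.succ - t i.castSucc}

/-- The sign attached to the `i`-th interval: `+` for even `i`, `-` for odd `i`. -/
def altSign {k : ℕ} (i : Fin (k + 1)) : ℝ := if Even (i : ℕ) then 1 else -1

/-- The sum over the intervals of a partition of the minimal energies with alternating signs. -/
def totalEnergy (g p : ℝ → ℝ) {k : ℕ} (t : Fin (k + 2) → ℝ) : ℝ :=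
  ∑ i : Fin (k + 1), minEnergy g p (altSign i) (t i.castSucc) (t i.succ)

/-- `t` maximizes `totalEnergy` among all admissible partitions of `[A, B]`. -/
def IsMaximizingPartition (g p : ℝ → ℝ) (L A B : ℝ) {k : ℕ} (t : Fin (k + 2) → ℝ) : Prop :=
  t ∈ partitions L A B k ∧ IsMaxOn (totalEnergy g p) (partitions L A B k) t

/-- `u` is obtained by juxtaposing minimizers of alternating sign on the intervals of `t`. -/
def IsGluing (g p : ℝ → ℝ) {k : ℕ} (t : Fin (k + 2) → ℝ) (u : ℝ → ℝ) : Prop :=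
  ∀ i : Fin (k + 1), ∃ w : ℝ → ℝ,
    IsMinimizer g p (altSign i) (t i.castSucc) (t i.succ) w ∧
      EqOn u w (Icc (t i.castSucc) (t i.succ))

/-- `u` is a classical (`C²`) solution of `ü + g(u) = p(t)` in `(A, B)`. -/
def IsSolutionOn (g p : ℝ → ℝ) (A B : ℝ) (u : ℝ → ℝ) : Prop :=
  ContDiffOn ℝ 2 u (Ioo A B) ∧ ∀ t ∈ Ioo A B, deriv (deriv u) t + g (u t) = p t

end

/-! ### Absolutely continuous functions with square integrable derivative -/

/-! This is a Nehari-type max-min argument. When an end point moves, the minimal energy φ changes at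
the rate -½ u̇(b)² in b and ½ u̇(a)² in a, where u is the minimizer on [a, b]. At a maximizing
partition whose nodes can move both ways, the squared slopes therefore agree on the two sides of
every interior node. The signs alternate, so the slopes themselves agree; the juxtaposition is C¹,
the equation makes it C², and its zeros are exactly the interior nodes. Two things remain: to know
the minimizers well enough to differentiate φ, and to show that the constraint "length ≥ L" is never
active.

Minimizers, case u ≥ 0. Since A(p) < g₊, adding a small tent to u lowers the action unless g(u) is
large in the mean. Minimality thus forces u̇ to decrease at a linear rate, up to a constant
(`exists_deriv_decay`), hence u ≥ κ(t-a)(b-t) with end slopes at least κ(b-a) in size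
(`exists_growth`); the equation bounds them above by 2M(b-a). Positivity follows because a long
positivity component has steep ends, which an interior zero forbids, while short components alone
cannot reach the very negative action of a large tent (`exists_pos_of_isMinimizer`). For uniqueness,
the difference w of two minimizers u, v satisfies ∫ẇ² = ∫(g(v)-g(u))w. The functions are large on
most of the interval, where the concave bounded g is almost flat, so the right-hand side is at most
½∫ẇ² (`exists_contraction`). The same estimate, for intervals with nearby right ends, gives the
expansion of φ with an error of order 3/2 (`exists_energy_expansion`).

Nodes. Suppose that some interval has length exactly L although B - A is large compared with k + 1.
Slopes are comparable with lengths, and maximality compares slopes across a node, so the intervals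
at most two steps away have length bounded by a constant R. Some other interval is very long.
Merging three consecutive bounded intervals into one and splitting the long one into three keeps the
number of intervals and all signs. The merger costs a bounded amount, while the splitting gains an
amount quadratic in the long length (`exists_split_gain`), against maximality (`long_step_lt`,
`exists_lt_length`).

The case u ≤ 0 follows by replacing g, p with -g(-s), -p, and the derivative in the left end point
by reversing time. -/

theorem AbsolutelyContinuousOnInterval.congr {f g : ℝ → ℝ} {a b : ℝ}
    (hf : AbsolutelyContinuousOnInterval f a b) (h : EqOn f g (uIcc a b)) :
    AbsolutelyContinuousOnInterval g a b := by
  rw [absolutelyContinuousOnInterval_iff] at hf ⊢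
  intro ε hε
  obtain ⟨δ, hδ, H⟩ := hf ε hε
  refine ⟨δ, hδ, fun E hE hs => ?_⟩
  have := H E hE hs
  rwa [Finset.sum_congr rfl fun i hi => by
    rw [← h (hE.1 i hi).1, ← h (hE.1 i hi).2]]

theorem AbsolutelyContinuousOnInterval.eq_add_integral {f : ℝ → ℝ} {a b x : ℝ}
    (hf : AbsolutelyContinuousOnInterval f a b) (hx : x ∈ uIcc a b) :
    f x = f a + ∫ t in a..x, deriv f t := by
  rw [(hf.mono (uIcc_subset_uIcc left_mem_uIcc hx)).integral_deriv_eq_sub]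
  ring

/-- On both pieces `f` is `f a` plus the primitive of `deriv f`, which is integrable across `c`;
primitives of integrable functions are absolutely continuous. -/
theorem AbsolutelyContinuousOnInterval.glue {f : ℝ → ℝ} {a b c : ℝ} (hac : a ≤ c) (hcb : c ≤ b)
    (h₁ : AbsolutelyContinuousOnInterval f a c) (h₂ : AbsolutelyContinuousOnInterval f c b) :
    AbsolutelyContinuousOnInterval f a b := by
  have hi := h₁.intervalIntegrable_deriv.trans h₂.intervalIntegrable_deriv
  have hF := hi.absolutelyContinuousOnInterval_intervalIntegral (c := a) left_mem_uIcc
  have hc : AbsolutelyContinuousOnInterval (fun _ : ℝ => f a) a b :=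
    (LipschitzWith.const (f a)).lipschitzOnWith.absolutelyContinuousOnInterval
  refine (hc.add hF).congr fun x hx => ?_
  rw [uIcc_of_le (hac.trans hcb)] at hx
  simp only [Pi.add_apply]
  rcases le_total x c with hxc | hxc
  · rw [h₁.eq_add_integral (x := x) (by rw [uIcc_of_le hac]; exact ⟨hx.1, hxc⟩)]
  · have hx' : x ∈ uIcc c b := by rw [uIcc_of_le hcb]; exact ⟨hxc, hx.2⟩
    rw [h₂.eq_add_integral hx', h₁.eq_add_integral (x := c) right_mem_uIcc,
      ← intervalIntegral.integral_add_adjacent_intervals h₁.intervalIntegrable_deriv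
        (h₂.intervalIntegrable_deriv.mono_set (uIcc_subset_uIcc left_mem_uIcc hx'))]
    ring

theorem IntervalIntegrable.deriv_integral_ae {f : ℝ → ℝ} {a b : ℝ}
    (hf : IntervalIntegrable f volume a b) :
    ∀ᵐ x, x ∈ uIoc a b → deriv (fun x => ∫ t in a..x, f t) x = f x := by
  filter_upwards [hf.ae_hasDerivAt_integral] with x hx hxm
  exact (hx (uIoc_subset_uIcc hxm) a left_mem_uIcc).deriv

/-- Absolutely continuous functions on `[a, b]` with square integrable derivative. -/
def SobolevOn (u : ℝ → ℝ) (a b : ℝ) : Prop :=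
  AbsolutelyContinuousOnInterval u a b ∧ IntervalIntegrable (fun t => deriv u t ^ 2) volume a b

theorem memLp_two_iff_intervalIntegrable_sq {f : ℝ → ℝ} {a b : ℝ} (hab : a ≤ b)
    (hf : AEStronglyMeasurable f (volume.restrict (Ioo a b))) :
    MemLp f 2 (volume.restrict (Ioo a b)) ↔ IntervalIntegrable (fun t => f t ^ 2) volume a b := by
  rw [memLp_two_iff_integrable_sq hf, intervalIntegrable_iff_integrableOn_Ioo_of_le hab,
    IntegrableOn]

theorem mem_H10_iff {u : ℝ → ℝ} {a b : ℝ} (hab : a ≤ b) :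
    u ∈ H10 a b ↔ SobolevOn u a b ∧ u a = 0 ∧ u b = 0 := by
  simp only [H10, SobolevOn, mem_ofPred_eq,
    memLp_two_iff_intervalIntegrable_sq hab (measurable_deriv u).aestronglyMeasurable, and_assoc]

namespace SobolevOn

variable {u v w : ℝ → ℝ} {a b c d : ℝ}

theorem deriv_memLp (hu : SobolevOn u a b) (hab : a ≤ b) :
    MemLp (deriv u) 2 (volume.restrict (Ioo a b)) :=
  (memLp_two_iff_intervalIntegrable_sq hab (measurable_deriv u).aestronglyMeasurable).2 hu.2

theorem intervalIntegrable_deriv (hu : SobolevOn u a b) :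
    IntervalIntegrable (deriv u) volume a b := hu.1.intervalIntegrable_deriv

theorem continuousOn (hu : SobolevOn u a b) (hab : a ≤ b) : ContinuousOn u (Icc a b) := by
  simpa [uIcc_of_le hab] using hu.1.continuousOn

theorem mul_deriv_integrable (hu : SobolevOn u a b) (hw : SobolevOn w a b) :
    IntervalIntegrable (fun t => deriv u t * deriv w t) volume a b := by
  wlog hab : a ≤ b generalizing a b
  · exact (this (a := b) (b := a) ⟨hu.1.symm, hu.2.symm⟩ ⟨hw.1.symm, hw.2.symm⟩
      (le_of_not_ge hab)).symm
  rw [intervalIntegrable_iff_integrableOn_Ioo_of_le hab]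
  exact (hu.deriv_memLp hab).integrable_mul (hw.deriv_memLp hab)

theorem mono (hu : SobolevOn u a b) (h : uIcc c d ⊆ uIcc a b) : SobolevOn u c d :=
  ⟨hu.1.mono h, hu.2.mono_set h⟩

theorem mono_Icc (hu : SobolevOn u a b) (hac : a ≤ c) (hcd : c ≤ d) (hdb : d ≤ b) :
    SobolevOn u c d :=
  hu.mono (by
    rw [uIcc_of_le hcd, uIcc_of_le (hac.trans (hcd.trans hdb))]; exact Icc_subset_Icc hac hdb)

theorem congr (hab : a ≤ b) (hu : SobolevOn u a b) (h : EqOn u v (Icc a b)) : SobolevOn v a b := by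
  refine ⟨hu.1.congr (by rwa [uIcc_of_le hab]), ?_⟩
  have hd := (h.mono Ioo_subset_Icc_self).deriv isOpen_Ioo
  have h2 := hu.2
  rw [intervalIntegrable_iff_integrableOn_Ioo_of_le hab] at h2 ⊢
  exact h2.congr_fun (fun t ht => by simp only [hd ht]) measurableSet_Ioo

theorem glue (hac : a ≤ c) (hcb : c ≤ b) (h₁ : SobolevOn u a c) (h₂ : SobolevOn u c b) :
    SobolevOn u a b := ⟨h₁.1.glue hac hcb h₂.1, h₁.2.trans h₂.2⟩

theorem ae_differentiableAt (hu : SobolevOn u a b) :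
    ∀ᵐ x, x ∈ uIoc a b → DifferentiableAt ℝ u x := by
  filter_upwards [hu.1.ae_differentiableAt] with x hx hm using hx (uIoc_subset_uIcc hm)

theorem deriv_add_ae (hu : SobolevOn u a b) (hw : SobolevOn w a b) :
    ∀ᵐ x, x ∈ uIoc a b → deriv (fun t => u t + w t) x = deriv u x + deriv w x := by
  filter_upwards [hu.ae_differentiableAt, hw.ae_differentiableAt] with x hx hy hm
  exact deriv_fun_add (hx hm) (hy hm)

theorem deriv_const_mul_ae (hu : SobolevOn u a b) (r : ℝ) :
    ∀ᵐ x, x ∈ uIoc a b → deriv (fun t => r * u t) x = r * deriv u x := by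
  filter_upwards [hu.ae_differentiableAt] with x hx hm
  exact deriv_const_mul r (hx hm)

theorem add (hu : SobolevOn u a b) (hw : SobolevOn w a b) :
    SobolevOn (fun t => u t + w t) a b := by
  refine ⟨hu.1.add hw.1, ?_⟩
  have : IntervalIntegrable (fun t => deriv u t ^ 2 + 2 * (deriv u t * deriv w t) + deriv w t ^ 2)
      volume a b := (hu.2.add ((hu.mul_deriv_integrable hw).const_mul 2)).add hw.2
  refine this.congr_ae ?_
  rw [EventuallyEq, ae_restrict_iff' measurableSet_uIoc]
  filter_upwards [hu.deriv_add_ae hw] with x hx hm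
  rw [hx hm]; ring

theorem const_mul (hu : SobolevOn u a b) (r : ℝ) : SobolevOn (fun t => r * u t) a b := by
  refine ⟨hu.1.const_mul r, ?_⟩
  have : IntervalIntegrable (fun t => r ^ 2 * deriv u t ^ 2) volume a b := hu.2.const_mul _
  refine this.congr_ae ?_
  rw [EventuallyEq, ae_restrict_iff' measurableSet_uIoc]
  filter_upwards [hu.deriv_const_mul_ae r] with x hx hm
  rw [hx hm]; ring

theorem sub (hu : SobolevOn u a b) (hw : SobolevOn w a b) :
    SobolevOn (fun t => u t - w t) a b := by
  have := hu.add (hw.const_mul (-1))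
  simpa [sub_eq_add_neg] using this

theorem deriv_sub_ae (hu : SobolevOn u a b) (hw : SobolevOn w a b) :
    ∀ᵐ x, x ∈ uIoc a b → deriv (fun t => u t - w t) x = deriv u x - deriv w x := by
  filter_upwards [hu.ae_differentiableAt, hw.ae_differentiableAt] with x hx hy hm
  exact deriv_fun_sub (hx hm) (hy hm)

theorem of_hasDerivAt {u' : ℝ → ℝ} (hu : ∀ t, HasDerivAt u (u' t) t) (hc : Continuous u')
    (a b : ℝ) : SobolevOn u a b := by
  have hd : deriv u = u' := funext fun t => (hu t).deriv
  have h1 : ContDiff ℝ 1 u := contDiff_one_iff_deriv.2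
    ⟨fun t => (hu t).differentiableAt, by rwa [hd]⟩
  refine ⟨h1.contDiffOn.absolutelyContinuousOnInterval, ?_⟩
  rw [hd]
  exact (hc.pow 2).intervalIntegrable _ _

theorem of_lipschitz {K : NNReal} (hu : LipschitzWith K u) (a b : ℝ) : SobolevOn u a b := by
  refine ⟨hu.lipschitzOnWith.absolutelyContinuousOnInterval, ?_⟩
  have : IntervalIntegrable (fun _ : ℝ => (K : ℝ) ^ 2) volume a b := intervalIntegrable_const
  refine this.mono_fun ((measurable_deriv u).pow_const 2).aestronglyMeasurable ?_
  refine Eventually.of_forall fun t => ?_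
  have : ‖deriv u t‖ ≤ K := norm_deriv_le_of_lipschitz hu
  simp only [norm_pow]
  rw [Real.norm_of_nonneg (r := (K : ℝ)) K.2]
  gcongr

theorem primitive {f : ℝ → ℝ} (hab : a ≤ b) (hf : MemLp f 2 (volume.restrict (Ioo a b))) :
    SobolevOn (fun x => ∫ t in a..x, f t) a b := by
  have hi : IntervalIntegrable f volume a b := by
    rw [intervalIntegrable_iff_integrableOn_Ioo_of_le hab]
    exact hf.integrable (by norm_num)
  refine ⟨hi.absolutelyContinuousOnInterval_intervalIntegral left_mem_uIcc, ?_⟩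
  have h2 := (memLp_two_iff_intervalIntegrable_sq hab hf.1).1 hf
  refine h2.congr_ae ?_
  rw [EventuallyEq, ae_restrict_iff' measurableSet_uIoc]
  filter_upwards [hi.deriv_integral_ae] with x hx hm
  rw [hx hm]

theorem sq_sub_le (hu : SobolevOn u a b) (hab : a ≤ b) :
    (u b - u a) ^ 2 ≤ (b - a) * ∫ t in a..b, deriv u t ^ 2 := by
  rcases hab.eq_or_lt with rfl | hlt
  · simp
  -- Cauchy-Schwarz, obtained by integrating the square of `deriv u` minus its mean `r`.
  set r := (u b - u a) / (b - a) with hr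
  have h0 : 0 ≤ ∫ t in a..b, (deriv u t - r) ^ 2 :=
    intervalIntegral.integral_nonneg hab fun _ _ => sq_nonneg _
  have h1 : ∫ t in a..b, (deriv u t - r) ^ 2
      = (∫ t in a..b, deriv u t ^ 2) - 2 * r * (u b - u a) + r ^ 2 * (b - a) := by
    have : ∀ t, (deriv u t - r) ^ 2 = deriv u t ^ 2 - 2 * r * deriv u t + r ^ 2 := by
      intro t; ring
    simp_rw [this]
    rw [intervalIntegral.integral_add (hu.2.sub (hu.intervalIntegrable_deriv.const_mul _))
      intervalIntegrable_const, intervalIntegral.integral_sub hu.2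
      (hu.intervalIntegrable_deriv.const_mul _), intervalIntegral.integral_const_mul,
      hu.1.integral_deriv_eq_sub]
    simp; ring
  have hpos : 0 < b - a := sub_pos.2 hlt
  have h2 : u b - u a = r * (b - a) := by rw [hr]; field_simp
  rw [h1] at h0
  rw [h2] at h0 ⊢
  nlinarith

theorem sq_sub_le_of_mem (hu : SobolevOn u a b) {s t : ℝ} (has : a ≤ s) (hst : s ≤ t)
    (htb : t ≤ b) : (u t - u s) ^ 2 ≤ (t - s) * ∫ x in a..b, deriv u x ^ 2 := by
  refine ((hu.mono_Icc has hst htb).sq_sub_le hst).trans ?_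
  refine mul_le_mul_of_nonneg_left ?_ (sub_nonneg.2 hst)
  exact intervalIntegral.integral_mono_interval has hst htb
    (Eventually.of_forall fun _ => sq_nonneg _) hu.2

theorem integral_deriv_sq_nonneg (hab : a ≤ b) : 0 ≤ ∫ x in a..b, deriv u x ^ 2 :=
  intervalIntegral.integral_nonneg hab fun _ _ => sq_nonneg _

/-- Integration by parts against a function with continuous second derivative. -/
theorem integral_deriv_mul_deriv {V' F : ℝ → ℝ} (hw : SobolevOn w a b)
    (hV' : ∀ t, HasDerivAt V' (F t) t) (hF : Continuous F) :
    ∫ t in a..b, V' t * deriv w t = V' b * w b - V' a * w a - ∫ t in a..b, F t * w t := by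
  have hd : deriv V' = F := funext fun t => (hV' t).deriv
  have := (of_hasDerivAt hV' hF a b).1.integral_mul_deriv_eq_deriv_mul hw.1
  rwa [hd] at this

end SobolevOn

/-- The second primitive of a continuous function with prescribed initial data. -/
theorem exists_second_primitive {F : ℝ → ℝ} (hF : Continuous F) (a y s : ℝ) :
    ∃ V V' : ℝ → ℝ, (∀ t, HasDerivAt V (V' t) t) ∧ (∀ t, HasDerivAt V' (F t) t) ∧
      V a = y ∧ V' a = s := by
  have h1 : ∀ t, HasDerivAt (fun t => s + ∫ r in a..t, F r) (F t) t := fun t =>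
    (hF.integral_hasStrictDerivAt a t).hasDerivAt.const_add s
  have hc : Continuous fun t => s + ∫ r in a..t, F r :=
    continuous_iff_continuousAt.2 fun t => (h1 t).continuousAt
  refine ⟨fun t => y + ∫ r in a..t, (s + ∫ x in a..r, F x), _, fun t => ?_, h1, by simp, by simp⟩
  exact (hc.integral_hasStrictDerivAt a t).hasDerivAt.const_add y

theorem exists_second_primitive_boundary {F : ℝ → ℝ} (hF : Continuous F) {a b : ℝ} (hab : a < b)
    (y z : ℝ) : ∃ V V' : ℝ → ℝ, (∀ t, HasDerivAt V (V' t) t) ∧ (∀ t, HasDerivAt V' (F t) t) ∧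
      V a = y ∧ V b = z := by
  obtain ⟨V, V', h1, h2, h3, -⟩ := exists_second_primitive hF a y 0
  set r := (z - V b) / (b - a)
  refine ⟨fun t => V t + r * (t - a), fun t => V' t + r, fun t => ?_, fun t => ?_, ?_, ?_⟩
  · simpa using (h1 t).fun_add (((hasDerivAt_id t).sub_const a).const_mul r)
  · simpa using (h2 t).add_const r
  · simp [h3]
  · have : b - a ≠ 0 := (sub_pos.2 hab).ne'
    simp only [r]; field_simp; ring

/-! ### The reaction term and the forcing -/

namespace IsReaction

variable {g : ℝ → ℝ}

theorem continuous (hg : IsReaction g) : Continuous g := hg.contDiff.continuous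

theorem differentiable (hg : IsReaction g) : Differentiable ℝ g :=
  hg.contDiff.differentiable (by norm_num)

theorem neg_comp_neg (hg : IsReaction g) : IsReaction fun s => -g (-s) where
  zero := by simp [hg.zero]
  contDiff := (hg.contDiff.comp contDiff_neg).neg
  bounded := by
    obtain ⟨M, hM⟩ := hg.bounded
    exact ⟨M, fun s => by simpa using hM (-s)⟩
  strictMono := fun x y hxy => neg_lt_neg (hg.strictMono (neg_lt_neg hxy))
  strictConcave := by
    refine ⟨convex_Ioi 0, fun x hx y hy hxy a b ha hb hab => ?_⟩
    have := hg.strictConvex.2 (x := -x) (y := -y) (by simpa using hx) (by simpa using hy)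
      (by simpa using hxy) ha hb hab
    simp only [smul_eq_mul] at this ⊢
    have e : -(a * x + b * y) = a * -x + b * -y := by ring
    rw [e]; linarith
  strictConvex := by
    refine ⟨convex_Iio 0, fun x hx y hy hxy a b ha hb hab => ?_⟩
    have := hg.strictConcave.2 (x := -x) (y := -y) (by simpa using hx) (by simpa using hy)
      (by simpa using hxy) ha hb hab
    simp only [smul_eq_mul] at this ⊢
    have e : -(a * x + b * y) = a * -x + b * -y := by ring
    rw [e]; linarith

theorem deriv_le_of_pos (hg : IsReaction g) {x : ℝ} (hx : 0 < x) : deriv g x ≤ deriv g 0 := by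
  have hc : Continuous (deriv g) := hg.contDiff.continuous_deriv (by norm_num)
  have ht : Tendsto (deriv g) (𝓝[>] 0) (𝓝 (deriv g 0)) := hc.continuousAt.mono_left inf_le_left
  refine ge_of_tendsto ht ?_
  filter_upwards [Ioo_mem_nhdsGT hx] with y hy
  exact hg.strictConcave.concaveOn.antitoneOn_deriv (fun x _ => hg.differentiable x) hy.1 hx hy.2.le

/-- Concavity on the right and convexity on the left make `deriv g` largest at `0`, so `deriv g 0`
serves as `K`. -/
theorem exists_lipschitz (hg : IsReaction g) : ∃ K : ℝ, ∀ x y, |g x - g y| ≤ K * |x - y| := by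
  have hd : ∀ x, ‖deriv g x‖ ≤ deriv g 0 := by
    intro x
    rw [Real.norm_of_nonneg (hg.strictMono.monotone.deriv_nonneg)]
    rcases lt_trichotomy x 0 with hx | rfl | hx
    · have h1 := hg.neg_comp_neg.deriv_le_of_pos (x := -x) (by linarith)
      have h2 : ∀ y, deriv (fun s => -g (-s)) y = deriv g (-y) := by
        intro y
        rw [deriv.fun_neg, deriv_comp_neg]; simp
      rw [h2, h2] at h1
      simpa using h1
    · exact le_rfl
    · exact hg.deriv_le_of_pos hx
  refine ⟨deriv g 0, fun x y => ?_⟩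
  exact convex_univ.norm_image_sub_le_of_norm_deriv_le
    (fun z _ => hg.differentiable z) (fun z _ => hd z) (mem_univ y) (mem_univ x)

theorem hasDerivAt_primitive (hg : IsReaction g) (s : ℝ) : HasDerivAt (primitive g) (g s) s :=
  (hg.continuous.integral_hasStrictDerivAt 0 s).hasDerivAt

theorem continuous_primitive (hg : IsReaction g) : Continuous (primitive g) :=
  continuous_iff_continuousAt.2 fun s => (hg.hasDerivAt_primitive s).continuousAt

theorem primitive_zero (g : ℝ → ℝ) : primitive g 0 = 0 := by simp [primitive]

theorem primitive_mvt (hg : IsReaction g) (u v : ℝ) :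
    ∃ c ∈ uIcc u v, primitive g v - primitive g u = g c * (v - u) := by
  rcases lt_trichotomy u v with h | rfl | h
  · obtain ⟨c, hc, he⟩ := exists_hasDerivAt_eq_slope (primitive g) g h
      hg.continuous_primitive.continuousOn fun x _ => hg.hasDerivAt_primitive x
    refine ⟨c, by rw [uIcc_of_le h.le]; exact Ioo_subset_Icc_self hc, ?_⟩
    have : v - u ≠ 0 := (sub_pos.2 h).ne'
    rw [he]; field_simp
  · exact ⟨u, left_mem_uIcc, by simp⟩
  · obtain ⟨c, hc, he⟩ := exists_hasDerivAt_eq_slope (primitive g) g h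
      hg.continuous_primitive.continuousOn fun x _ => hg.hasDerivAt_primitive x
    refine ⟨c, by rw [uIcc_of_ge h.le]; exact Ioo_subset_Icc_self hc, ?_⟩
    have : u - v ≠ 0 := (sub_pos.2 h).ne'
    rw [he]; field_simp; ring

theorem primitive_remainder_nonneg (hg : IsReaction g) (u v : ℝ) :
    0 ≤ primitive g v - primitive g u - g u * (v - u) := by
  obtain ⟨c, hc, he⟩ := hg.primitive_mvt u v
  rw [he, ← sub_mul]
  rcases le_total u v with h | h
  · rw [uIcc_of_le h] at hc
    exact mul_nonneg (sub_nonneg.2 (hg.strictMono.monotone hc.1)) (sub_nonneg.2 h)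
  · rw [uIcc_of_ge h] at hc
    exact mul_nonneg_of_nonpos_of_nonpos (sub_nonpos.2 (hg.strictMono.monotone hc.2))
      (sub_nonpos.2 h)

theorem primitive_remainder_le (hg : IsReaction g) {K : ℝ}
    (hK : ∀ x y, |g x - g y| ≤ K * |x - y|) (u v : ℝ) :
    primitive g v - primitive g u - g u * (v - u) ≤ K * (v - u) ^ 2 := by
  obtain ⟨c, hc, he⟩ := hg.primitive_mvt u v
  have hK0 : 0 ≤ K := by simpa using (abs_nonneg _).trans (hK 1 0)
  rw [he, ← sub_mul, ← sq_abs (v - u), pow_two, ← mul_assoc]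
  refine (le_abs_self _).trans ?_
  rw [abs_mul]
  refine mul_le_mul_of_nonneg_right ((hK c u).trans ?_) (abs_nonneg _)
  exact mul_le_mul_of_nonneg_left (abs_sub_left_of_mem_uIcc hc) hK0

theorem abs_primitive_sub_le (hg : IsReaction g) {M : ℝ} (hM : ∀ s, |g s| ≤ M) (u v : ℝ) :
    |primitive g v - primitive g u| ≤ M * |v - u| := by
  obtain ⟨c, -, he⟩ := hg.primitive_mvt u v
  rw [he, abs_mul]
  exact mul_le_mul_of_nonneg_right (hM c) (abs_nonneg _)

theorem primitive_nonneg (hg : IsReaction g) (s : ℝ) : 0 ≤ primitive g s := by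
  simpa [primitive_zero, hg.zero] using hg.primitive_remainder_nonneg 0 s

theorem nonneg (hg : IsReaction g) {s : ℝ} (hs : 0 ≤ s) : 0 ≤ g s := by
  simpa [hg.zero] using hg.strictMono.monotone hs

/-- Since `g` increases, G(u + s) - G(s) increases in s. This is what makes adding a tent to a
nonnegative function at least as profitable, in the potential term, as starting from zero. -/
theorem primitive_superadditive (hg : IsReaction g) {u w : ℝ} (hu : 0 ≤ u) (hw : 0 ≤ w) :
    primitive g u + primitive g w ≤ primitive g (u + w) := by
  have hd : ∀ s, HasDerivAt (fun s => primitive g (u + s) - primitive g s) (g (u + s) - g s) s :=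
    fun s => by
      simpa using ((hg.hasDerivAt_primitive (u + s)).comp_const_add u s).fun_sub
        (hg.hasDerivAt_primitive s)
  have hm : Monotone fun s => primitive g (u + s) - primitive g s := by
    refine monotone_of_deriv_nonneg (fun s => (hd s).differentiableAt) fun s => ?_
    rw [(hd s).deriv]
    exact sub_nonneg.2 (hg.strictMono.monotone (by linarith))
  have := hm hw
  simp only [add_zero, primitive_zero, sub_zero] at this
  linarith

theorem primitive_lower (hg : IsReaction g) {r : ℝ} (w : ℝ) :
    g r * (w - r) ≤ primitive g w := by
  linarith [hg.primitive_remainder_nonneg r w, hg.primitive_nonneg r]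

/-- The left side is the integral of g(u + x) - g(u) over x in [0, w], seen from below: on [r, w],
of length at least r, the integrand is at least g(u + r) - g(u) ≥ g(r) - g(u). A small remainder
thus forces g(u) to be close to g(r) or above it. -/
theorem remainder_lower (hg : IsReaction g) {r u w : ℝ} (hr : 0 ≤ r) (hu : 0 ≤ u)
    (hw : 2 * r ≤ w) :
    r * (g r - g u) ≤ primitive g (u + w) - primitive g u - g u * w := by
  have h1 := hg.primitive_remainder_nonneg (u + r) (u + w)
  have h2 := hg.primitive_remainder_nonneg u (u + r)
  have h3 : g u ≤ g (u + r) := hg.strictMono.monotone (by linarith)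
  have h4 : g r ≤ g (u + r) := hg.strictMono.monotone (by linarith)
  have h5 : (g (u + r) - g u) * r ≤ (g (u + r) - g u) * (w - r) :=
    mul_le_mul_of_nonneg_left (by linarith) (by linarith)
  have h6 : (g r - g u) * r ≤ (g (u + r) - g u) * r := by gcongr
  nlinarith

/-- An upper bound for the slopes of chords of `g` on `[q, ∞)`. -/
noncomputable def chordBound (g : ℝ → ℝ) (q : ℝ) : ℝ := 2 * (g q - g (q / 2)) / q

theorem chordBound_nonneg (hg : IsReaction g) {q : ℝ} (hq : 0 ≤ q) : 0 ≤ chordBound g q :=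
  div_nonneg (mul_nonneg (by norm_num)
    (sub_nonneg.2 (hg.strictMono.monotone (by linarith)))) hq

/-- By concavity, chords to the right of q are no steeper than the chord over [q/2, q]. The node
q/2, rather than 0, is what makes `chordBound g q * q` tend to 0. -/
theorem sub_le_chordBound (hg : IsReaction g) {q x y : ℝ} (hq : 0 < q) (hx : q ≤ x)
    (hxy : x < y) : g y - g x ≤ chordBound g q * (y - x) := by
  have hc := hg.strictConcave.concaveOn
  have e : chordBound g q = (g q - g (q / 2)) / (q - q / 2) := by
    unfold chordBound; field_simp; ring
  have h1 : (g y - g x) / (y - x) ≤ chordBound g q := by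
    rw [e]
    rcases hx.eq_or_lt with rfl | hlt
    · exact hc.slope_anti_adjacent (x := q / 2) (y := q) (z := y)
        (mem_Ioi.2 (by linarith)) (mem_Ioi.2 (by linarith)) (by linarith) hxy
    · exact (hc.slope_anti_adjacent (x := q) (y := x) (z := y) (mem_Ioi.2 (by linarith))
        (mem_Ioi.2 (by linarith)) hlt hxy).trans
        (hc.slope_anti_adjacent (x := q / 2) (y := q) (z := x)
        (mem_Ioi.2 (by linarith)) (mem_Ioi.2 (by linarith)) (by linarith) hlt)
  rwa [div_le_iff₀ (sub_pos.2 hxy)] at h1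

theorem mul_le_chordBound (hg : IsReaction g) {q x y : ℝ} (hq : 0 < q) (hx : q ≤ x)
    (hy : q ≤ y) : (g y - g x) * (y - x) ≤ chordBound g q * (y - x) ^ 2 := by
  rcases lt_trichotomy x y with h | rfl | h
  · have := mul_le_mul_of_nonneg_right (hg.sub_le_chordBound hq hx h) (sub_pos.2 h).le
    linarith
  · simp
  · have := mul_le_mul_of_nonneg_right (hg.sub_le_chordBound hq hy h) (sub_pos.2 h).le
    linarith

theorem chordBound_mul_le {M : ℝ} (hM : ∀ s, |g s| ≤ M) {q : ℝ} (hq : 0 < q) :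
    chordBound g q * q ≤ 4 * M := by
  have : chordBound g q * q = 2 * (g q - g (q / 2)) := by unfold chordBound; field_simp
  rw [this]
  have h1 := abs_le.1 (hM q)
  have h2 := abs_le.1 (hM (q / 2))
  linarith [h1.2, h2.1]

/-- The product equals 2(g(q) - g(q/2)), and the bounded monotone `g` has a finite limit at
infinity. -/
theorem exists_chordBound_mul_le (hg : IsReaction g) {ε : ℝ} (hε : 0 < ε) :
    ∃ Q > 0, ∀ q, Q ≤ q → chordBound g q * q ≤ ε := by
  obtain ⟨M, hM⟩ := hg.bounded
  have hbd : BddAbove (range g) := ⟨M, by rintro _ ⟨s, rfl⟩; exact (abs_le.1 (hM s)).2⟩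
  have ht := tendsto_atTop_ciSup hg.strictMono.monotone hbd
  have ht2 : Tendsto (fun q : ℝ => 2 * (g q - g (q / 2))) atTop (𝓝 (2 * (iSup g - iSup g))) :=
    (ht.sub (ht.comp (tendsto_id.atTop_div_const (by norm_num)))).const_mul 2
  rw [sub_self, mul_zero] at ht2
  obtain ⟨Q, hQ⟩ := eventually_atTop.1 (ht2.eventually (gt_mem_nhds hε))
  refine ⟨max Q 1, by positivity, fun q hq => ?_⟩
  have hq0 : 0 < q := lt_of_lt_of_le one_pos ((le_max_right _ _).trans hq)
  have : chordBound g q * q = 2 * (g q - g (q / 2)) := by unfold chordBound; field_simp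
  rw [this]
  exact (hQ q ((le_max_left _ _).trans hq)).le

end IsReaction

/-- A form of the average valid on intervals of any length: those shorter than the threshold T are
absorbed by the constant, through the boundedness of p. -/
theorem HasAsymptoticAverage.exists_bound {p : ℝ → ℝ} {m M : ℝ} (h : HasAsymptoticAverage p m)
    (hM : ∀ t, |p t| ≤ M) {ε : ℝ} (hε : 0 < ε) :
    ∃ C, 0 ≤ C ∧ ∀ s t, s ≤ t → |(∫ x in s..t, p x) - m * (t - s)| ≤ ε * (t - s) + C := by
  obtain ⟨T, hT, H⟩ := h ε hε
  have hM0 : 0 ≤ M := (abs_nonneg _).trans (hM 0)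
  refine ⟨(M + |m|) * T, by positivity, fun s t hst => ?_⟩
  have h0 : 0 ≤ t - s := sub_nonneg.2 hst
  rcases le_or_gt (t - s) T with hle | hgt
  · have h1 : |∫ x in s..t, p x| ≤ M * (t - s) := by
      have := intervalIntegral.norm_integral_le_of_norm_le_const (a := s) (b := t) (f := p)
        (C := M) fun x _ => hM x
      rwa [Real.norm_eq_abs, abs_of_nonneg h0] at this
    calc |(∫ x in s..t, p x) - m * (t - s)| ≤ |∫ x in s..t, p x| + |m * (t - s)| := abs_sub _ _
      _ ≤ M * (t - s) + |m| * (t - s) := by rw [abs_mul, abs_of_nonneg h0]; gcongr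
      _ = (M + |m|) * (t - s) := by ring
      _ ≤ (M + |m|) * T := by gcongr
      _ ≤ _ := le_add_of_nonneg_left (by positivity)
  · have hpos : 0 < t - s := hT.trans hgt
    have h1 := (H (t - s) hgt s).le
    rw [add_sub_cancel] at h1
    have h2 : (∫ x in s..t, p x) - m * (t - s)
        = (1 / (t - s) * (∫ x in s..t, p x) - m) * (t - s) := by field_simp
    rw [h2, abs_mul, abs_of_pos hpos]
    have : 0 ≤ (M + |m|) * T := by positivity
    nlinarith

/-- A reaction `g` and a continuous forcing `p` of average `m` in the interior of the range of `g`,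
together with a common bound `M` and a Lipschitz constant `K` of `g`. -/
structure ForcedReaction (g p : ℝ → ℝ) (m M K : ℝ) : Prop where
  reaction : IsReaction g
  continuous : Continuous p
  one_le_bound : 1 ≤ M
  reaction_le : ∀ s, |g s| ≤ M
  forcing_le : ∀ t, |p t| ≤ M
  one_le_lipschitz : 1 ≤ K
  lipschitz : ∀ x y, |g x - g y| ≤ K * |x - y|
  average : HasAsymptoticAverage p m
  above : ∃ r, 0 < r ∧ m < g r
  below : ∃ r, r < 0 ∧ g r < m

namespace ForcedReaction

variable {g p : ℝ → ℝ} {m M K : ℝ}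

theorem neg_comp_neg (h : ForcedReaction g p m M K) :
    ForcedReaction (fun s => -g (-s)) (fun t => -p t) (-m) M K where
  reaction := h.reaction.neg_comp_neg
  continuous := h.continuous.neg
  one_le_bound := h.one_le_bound
  reaction_le := fun s => by simpa using h.reaction_le (-s)
  forcing_le := fun t => by simpa using h.forcing_le t
  one_le_lipschitz := h.one_le_lipschitz
  lipschitz := fun x y => by
    have := h.lipschitz (-y) (-x)
    rwa [show -g (-x) - -g (-y) = g (-y) - g (-x) by ring, show x - y = -y - -x by ring]
  average := fun ε hε => by
    obtain ⟨T, hT, H⟩ := h.average ε hε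
    refine ⟨T, hT, fun S hS t => ?_⟩
    have := H S hS t
    rwa [intervalIntegral.integral_neg, ← abs_neg, show
      -(1 / S * -(∫ s in t..(t + S), p s) - -m) = 1 / S * (∫ s in t..(t + S), p s) - m by ring]
  above := by
    obtain ⟨r, hr, hm⟩ := h.below
    exact ⟨-r, by linarith, by simpa using hm⟩
  below := by
    obtain ⟨r, hr, hm⟩ := h.above
    exact ⟨-r, by linarith, by simpa using hm⟩

theorem comp_neg (h : ForcedReaction g p m M K) : ForcedReaction g (fun t => p (-t)) m M K where
  reaction := h.reaction
  continuous := h.continuous.comp continuous_neg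
  one_le_bound := h.one_le_bound
  reaction_le := h.reaction_le
  forcing_le := fun t => h.forcing_le (-t)
  one_le_lipschitz := h.one_le_lipschitz
  lipschitz := h.lipschitz
  average := fun ε hε => by
    obtain ⟨T, hT, H⟩ := h.average ε hε
    refine ⟨T, hT, fun S hS t => ?_⟩
    have := H S hS (-(t + S))
    rw [intervalIntegral.integral_comp_neg (f := p)]
    rwa [show -(t + S) + S = -t by ring] at this
  above := h.above
  below := h.below

theorem bound_pos (h : ForcedReaction g p m M K) : 0 < M := one_pos.trans_le h.one_le_bound

theorem lipschitz_pos (h : ForcedReaction g p m M K) : 0 < K := one_pos.trans_le h.one_le_lipschitz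

end ForcedReaction

/-! ### The action functional -/

/-- The tent function supported in `[a, b]`, with slopes `±1`. -/
def tent (a b t : ℝ) : ℝ := max 0 (min (t - a) (b - t))

section Tent

theorem tent_nonneg (a b t : ℝ) : 0 ≤ tent a b t := le_max_left _ _

theorem tent_eq_zero {a b t : ℝ} (ht : t ≤ a ∨ b ≤ t) : tent a b t = 0 :=
  max_eq_left (by rcases ht with h | h <;> simp [h])

theorem tent_left (a b : ℝ) : tent a b a = 0 := tent_eq_zero (Or.inl le_rfl)

theorem tent_right (a b : ℝ) : tent a b b = 0 := tent_eq_zero (Or.inr le_rfl)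

theorem le_tent {a b t x : ℝ} (h₁ : x ≤ t - a) (h₂ : x ≤ b - t) : x ≤ tent a b t :=
  (le_min h₁ h₂).trans (le_max_right _ _)

theorem tent_lipschitz (a b : ℝ) : LipschitzWith 1 (tent a b) := by
  have h1 : LipschitzWith 1 fun t : ℝ => t - a :=
    LipschitzWith.of_dist_le_mul fun x y => by simp [Real.dist_eq]
  have h2 : LipschitzWith 1 fun t : ℝ => b - t :=
    LipschitzWith.of_dist_le_mul fun x y => by
      simp only [Real.dist_eq, NNReal.coe_one, one_mul]
      rw [abs_sub_comm x y, sub_sub_sub_cancel_left]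
  have h3 := (LipschitzWith.const (α := ℝ) (0 : ℝ)).max (h1.min h2)
  rw [max_self, max_eq_right zero_le_one] at h3
  exact h3

theorem tent_sobolevOn (a b c d : ℝ) : SobolevOn (tent a b) c d := .of_lipschitz (tent_lipschitz a b) c d

theorem tent_continuous (a b : ℝ) : Continuous (tent a b) := (tent_lipschitz a b).continuous

theorem deriv_tent_sq_le (a b t : ℝ) : deriv (tent a b) t ^ 2 ≤ 1 := by
  have := norm_deriv_le_of_lipschitz (tent_lipschitz a b) (x₀ := t)
  rw [Real.norm_eq_abs] at this
  rw [← sq_abs]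
  exact pow_le_one₀ (abs_nonneg _) (by simpa using this)

theorem integral_deriv_tent_sq_le {a b c d : ℝ} (hcd : c ≤ d) :
    ∫ t in c..d, deriv (tent a b) t ^ 2 ≤ d - c := by
  have := intervalIntegral.integral_mono_on hcd (tent_sobolevOn a b c d).2
    (intervalIntegrable_const (c := (1 : ℝ))) fun t _ => deriv_tent_sq_le a b t
  simpa using this

theorem integral_mul_sub (a b : ℝ) : ∫ t in a..b, (t - a) * (b - t) = (b - a) ^ 3 / 6 := by
  have hd : ∀ t, HasDerivAt (fun t : ℝ => (t - a) ^ 2 * (b - a) / 2 - (t - a) ^ 3 / 3)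
      ((t - a) * (b - t)) t := by
    intro t
    have h1 := (hasDerivAt_id t).sub_const a
    have := (((h1.fun_pow 2).mul_const (b - a)).div_const 2).fun_sub ((h1.fun_pow 3).div_const 3)
    convert! this using 1
    simp; ring
  rw [intervalIntegral.integral_eq_sub_of_hasDerivAt (fun t _ => hd t)
    (Continuous.intervalIntegrable (by fun_prop) _ _)]
  ring

theorem le_integral_tent {a b : ℝ} (hab : a < b) : (b - a) ^ 2 / 6 ≤ ∫ t in a..b, tent a b t := by
  have hpos : 0 < b - a := sub_pos.2 hab
  -- The tent lies above the parabola (t - a)(b - t)/(b - a), whose integral is (b - a)²/6.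
  have h1 : ∫ t in a..b, (b - a)⁻¹ * ((t - a) * (b - t)) ≤ ∫ t in a..b, tent a b t := by
    refine intervalIntegral.integral_mono_on hab.le
      (Continuous.intervalIntegrable (by fun_prop) _ _)
      ((tent_continuous a b).intervalIntegrable _ _) fun t ht => ?_
    have h1 : 0 ≤ t - a := sub_nonneg.2 ht.1
    have h2 : 0 ≤ b - t := sub_nonneg.2 ht.2
    refine le_tent ?_ ?_ <;> rw [inv_mul_le_iff₀ hpos] <;> nlinarith
  rw [intervalIntegral.integral_const_mul, integral_mul_sub] at h1
  convert h1 using 1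
  field_simp

end Tent

section Action

variable {g p u v w : ℝ → ℝ} {a b c : ℝ}

theorem potential_integrable (hg : IsReaction g) (hp : Continuous p)
    (hab : a ≤ b) (hu : ContinuousOn u (Icc a b)) :
    IntervalIntegrable (fun t => -primitive g (u t) + p t * u t) volume a b := by
  apply ContinuousOn.intervalIntegrable
  rw [uIcc_of_le hab]
  exact (hg.continuous_primitive.comp_continuousOn hu).neg.add (hp.continuousOn.mul hu)

theorem action_integrable (hg : IsReaction g) (hp : Continuous p) (hab : a ≤ b)
    (hu : SobolevOn u a b) : IntervalIntegrable
      (fun t => 1 / 2 * deriv u t ^ 2 - primitive g (u t) + p t * u t) volume a b := by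
  have := (hu.2.const_mul (1 / 2)).add (potential_integrable hg hp hab (hu.continuousOn hab))
  refine this.congr fun t _ => ?_
  ring

theorem action_eq (hg : IsReaction g) (hp : Continuous p) (hab : a ≤ b) (hu : SobolevOn u a b) :
    action g p a b u = 1 / 2 * (∫ t in a..b, deriv u t ^ 2)
      + ∫ t in a..b, (-primitive g (u t) + p t * u t) := by
  rw [← intervalIntegral.integral_const_mul, ← intervalIntegral.integral_add (hu.2.const_mul _)
    (potential_integrable hg hp hab (hu.continuousOn hab)), action]
  congr 1; ext t; ring

theorem action_add_adjacent (hg : IsReaction g) (hp : Continuous p) (hac : a ≤ c) (hcb : c ≤ b)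
    (hu : SobolevOn u a b) :
    action g p a c u + action g p c b u = action g p a b u :=
  intervalIntegral.integral_add_adjacent_intervals
    (action_integrable hg hp hac (hu.mono_Icc le_rfl hac hcb))
    (action_integrable hg hp hcb (hu.mono_Icc hac hcb le_rfl))

theorem action_congr (hab : a ≤ b) (h : EqOn u v (Icc a b)) :
    action g p a b u = action g p a b v := by
  refine intervalIntegral.integral_congr_Ioo_of_le hab fun t ht => ?_
  have hd := (h.mono Ioo_subset_Icc_self).deriv isOpen_Ioo ht
  simp only [hd, h (Ioo_subset_Icc_self ht)]

theorem action_zero : action g p a b (fun _ => 0) = 0 := by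
  simp [action, IsReaction.primitive_zero]

/-- Second order expansion of the action. -/
theorem action_add (hg : IsReaction g) (hp : Continuous p) (hab : a ≤ b)
    (hu : SobolevOn u a b) (hw : SobolevOn w a b) :
    action g p a b (fun t => u t + w t) = action g p a b u
      + ((∫ t in a..b, deriv u t * deriv w t) + ∫ t in a..b, (p t - g (u t)) * w t)
      + 1 / 2 * (∫ t in a..b, deriv w t ^ 2)
      - ∫ t in a..b, (primitive g (u t + w t) - primitive g (u t) - g (u t) * w t) := by
  have hcu := hu.continuousOn hab
  have hcw := hw.continuousOn hab
  have hG := hg.continuous_primitive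
  have hgc := hg.continuous
  have i1 := action_integrable hg hp hab hu
  have i2 := hu.mul_deriv_integrable hw
  have i3 : IntervalIntegrable (fun t => (p t - g (u t)) * w t) volume a b := by
    apply ContinuousOn.intervalIntegrable; rw [uIcc_of_le hab]; fun_prop
  have i4 : IntervalIntegrable
      (fun t => primitive g (u t + w t) - primitive g (u t) - g (u t) * w t) volume a b := by
    apply ContinuousOn.intervalIntegrable; rw [uIcc_of_le hab]; fun_prop
  rw [← intervalIntegral.integral_const_mul, ← intervalIntegral.integral_add i2 i3]
  unfold action
  rw [← intervalIntegral.integral_add i1 (i2.add i3),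
    ← intervalIntegral.integral_add (i1.add (i2.add i3)) (hw.2.const_mul _),
    ← intervalIntegral.integral_sub ((i1.add (i2.add i3)).add (hw.2.const_mul _)) i4]
  refine intervalIntegral.integral_congr_ae ?_
  filter_upwards [hu.deriv_add_ae hw] with t ht hm
  simp only [ht hm]
  ring

end Action

namespace ForcedReaction

variable {g p u : ℝ → ℝ} {m M K a b : ℝ}

theorem abs_potential_le (h : ForcedReaction g p m M K) (t s : ℝ) :
    |-primitive g s + p t * s| ≤ 2 * M * |s| := by
  have h1 := h.reaction.abs_primitive_sub_le h.reaction_le 0 s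
  rw [IsReaction.primitive_zero, sub_zero, sub_zero] at h1
  have h2 : |p t * s| ≤ M * |s| := by
    rw [abs_mul]; exact mul_le_mul_of_nonneg_right (h.forcing_le t) (abs_nonneg _)
  calc _ ≤ |-primitive g s| + |p t * s| := abs_add_le _ _
    _ ≤ _ := by rw [abs_neg]; linarith

theorem coercive (h : ForcedReaction g p m M K) (hab : a < b) (hu : SobolevOn u a b)
    (ha : u a = 0) :
    1 / 4 * (∫ t in a..b, deriv u t ^ 2) - 4 * M ^ 2 * (b - a) ^ 3 ≤ action g p a b u := by
  have hpos : 0 < b - a := sub_pos.2 hab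
  set D := ∫ t in a..b, deriv u t ^ 2 with hD
  rw [action_eq h.reaction h.continuous hab.le hu, ← hD]
  -- Young's inequality, weighted so that the potential consumes at most D/4 of the kinetic energy
  -- D/2; u² is controlled by (b - a)D.
  have key : ∫ t in a..b, (-(D / (4 * (b - a)) + 4 * M ^ 2 * (b - a) ^ 2))
      ≤ ∫ t in a..b, (-primitive g (u t) + p t * u t) := by
    refine intervalIntegral.integral_mono_on hab.le intervalIntegrable_const
      (potential_integrable h.reaction h.continuous hab.le (hu.continuousOn hab.le)) fun t ht => ?_
    have h1 := (abs_le.1 (h.abs_potential_le t (u t))).1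
    have h2 := hu.sq_sub_le_of_mem le_rfl ht.1 ht.2
    rw [ha, sub_zero, ← hD] at h2
    have hD0 : 0 ≤ D := SobolevOn.integral_deriv_sq_nonneg hab.le
    have h3 : u t ^ 2 ≤ (b - a) * D := h2.trans (mul_le_mul_of_nonneg_right (by linarith [ht.2]) hD0)
    have h4 : 2 * M * |u t| ≤ |u t| ^ 2 / (4 * (b - a) ^ 2) + 4 * M ^ 2 * (b - a) ^ 2 := by
      have := sq_nonneg (|u t| / (2 * (b - a)) - 2 * M * (b - a))
      have e : (|u t| / (2 * (b - a)) - 2 * M * (b - a)) ^ 2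
        = |u t| ^ 2 / (4 * (b - a) ^ 2) + 4 * M ^ 2 * (b - a) ^ 2 - 2 * M * |u t| := by
        field_simp; ring
      linarith
    have h5 : |u t| ^ 2 / (4 * (b - a) ^ 2) ≤ D / (4 * (b - a)) := by
      rw [sq_abs, div_le_div_iff₀ (by positivity) (by positivity)]
      nlinarith
    linarith
  have e : ∫ t in a..b, (-(D / (4 * (b - a)) + 4 * M ^ 2 * (b - a) ^ 2))
      = -(D / 4 + 4 * M ^ 2 * (b - a) ^ 3) := by
    rw [intervalIntegral.integral_const, smul_eq_mul]; field_simp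
  linarith

/-- The tangent-type bound G(w) ≥ g(r)(w - r), with g(r) > m, makes the potential linear in w with a
negative mean coefficient, and the integral of the tent is quadratic in b - a. The oscillation p - m
is integrated by parts: its primitive is small relative to the length, and the tent has slope at
most 1. -/
theorem exists_action_tent_le (h : ForcedReaction g p m M K) :
    ∃ c C : ℝ, 0 < c ∧ 0 ≤ C ∧ ∀ a b, a < b →
      action g p a b (tent a b) ≤ C * (b - a) - c * (b - a) ^ 2 := by
  obtain ⟨r, hr, hmr⟩ := h.above
  -- The tent integral is at least (b - a)²/6, so the gain is 2ε(b - a)²; the oscillation of p costs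
  -- ε(b - a)², leaving `c` = ε.
  set ε := (g r - m) / 12 with hε
  have hε0 : 0 < ε := by rw [hε]; linarith
  obtain ⟨C, hC, H⟩ := h.average.exists_bound h.forcing_le hε0
  have hgr : 0 ≤ g r := h.reaction.nonneg hr.le
  refine ⟨ε, 1 / 2 + g r * r + C, hε0, by positivity, fun a b hab => ?_⟩
  have hpos : 0 < b - a := sub_pos.2 hab
  set w := tent a b
  have hwc : Continuous w := tent_continuous a b
  have hw := tent_sobolevOn a b a b
  rw [action_eq h.reaction h.continuous hab.le hw]
  have h1 := integral_deriv_tent_sq_le (a := a) (b := b) hab.le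
  have h2 : ∫ t in a..b, (-primitive g (w t) + p t * w t)
      ≤ ∫ t in a..b, ((-(g r - m) * w t + g r * r) + (p t - m) * w t) := by
    refine intervalIntegral.integral_mono_on hab.le
      (potential_integrable h.reaction h.continuous hab.le hwc.continuousOn)
      (Continuous.intervalIntegrable (by have := h.continuous; fun_prop) _ _) fun t ht => ?_
    have := h.reaction.primitive_lower (r := r) (w t)
    linarith
  have h2' : ∫ t in a..b, ((-(g r - m) * w t + g r * r) + (p t - m) * w t)
      = -(g r - m) * (∫ t in a..b, w t) + (b - a) * (g r * r) + ∫ t in a..b, (p t - m) * w t := by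
    rw [intervalIntegral.integral_add (Continuous.intervalIntegrable (by fun_prop) _ _)
      (Continuous.intervalIntegrable (by have := h.continuous; fun_prop) _ _),
      intervalIntegral.integral_add (Continuous.intervalIntegrable (by fun_prop) _ _)
      intervalIntegrable_const, intervalIntegral.integral_const_mul,
      intervalIntegral.integral_const, smul_eq_mul]
  rw [h2'] at h2
  have h3 := le_integral_tent hab
  set P : ℝ → ℝ := fun t => (∫ x in a..t, p x) - m * (t - a) with hP
  have hPd : ∀ t, HasDerivAt P (p t - m) t := fun t => by
    simpa using (h.continuous.integral_hasStrictDerivAt a t).hasDerivAt.fun_sub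
      (((hasDerivAt_id t).sub_const a).const_mul m)
  have hPc : Continuous P := continuous_iff_continuousAt.2 fun t => (hPd t).continuousAt
  have h4 := hw.integral_deriv_mul_deriv hPd (h.continuous.sub continuous_const)
  rw [tent_left, tent_right, mul_zero, mul_zero, sub_zero, zero_sub] at h4
  have h5 : -(∫ t in a..b, P t * deriv w t) ≤ ∫ t in a..b, (ε * (b - a) + C) := by
    rw [← intervalIntegral.integral_neg]
    refine intervalIntegral.integral_mono_on hab.le
      (hw.intervalIntegrable_deriv.continuousOn_mul hPc.continuousOn).neg
      intervalIntegrable_const fun t ht => ?_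
    refine (neg_le_abs _).trans ?_
    rw [abs_mul]
    have e1 : |P t| ≤ ε * (b - a) + C := by
      refine (H a t ht.1).trans ?_
      gcongr; exact ht.2
    have e2 : |deriv w t| ≤ 1 := by
      have := deriv_tent_sq_le a b t
      rwa [sq_le_one_iff_abs_le_one] at this
    calc |P t| * |deriv w t| ≤ |P t| * 1 := mul_le_mul_of_nonneg_left e2 (abs_nonneg _)
      _ ≤ _ := by linarith
  rw [intervalIntegral.integral_const, smul_eq_mul] at h5
  have h6 : (g r - m) * ((b - a) ^ 2 / 6) ≤ (g r - m) * ∫ t in a..b, w t :=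
    mul_le_mul_of_nonneg_left h3 (by linarith)
  have e : g r - m = 12 * ε := by rw [hε]; ring
  rw [e] at h2 h6
  nlinarith

end ForcedReaction

/-! ### Local minimality -/

section Minimizer

variable {g p u v : ℝ → ℝ} {σ a b s t : ℝ}

theorem zero_mem_signedH10 (hab : a ≤ b) : (fun _ => (0 : ℝ)) ∈ signedH10 σ a b := by
  refine ⟨(mem_H10_iff hab).2 ⟨?_, rfl, rfl⟩, by simp⟩
  exact .of_hasDerivAt (fun t => hasDerivAt_const t (0 : ℝ)) continuous_const a b

theorem IsMinimizer.sobolevOn (hab : a ≤ b) (hu : IsMinimizer g p σ a b u) : SobolevOn u a b :=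
  ((mem_H10_iff hab).1 hu.1.1).1

theorem IsMinimizer.left (hu : IsMinimizer g p σ a b u) : u a = 0 := hu.1.1.2.2.1

theorem IsMinimizer.right (hu : IsMinimizer g p σ a b u) : u b = 0 := hu.1.1.2.2.2

theorem IsMinimizer.nonneg (hu : IsMinimizer g p 1 a b u) (ht : t ∈ Icc a b) : 0 ≤ u t := by
  simpa using hu.1.2 t ht

theorem IsMinimizer.action_eq_minEnergy (hu : IsMinimizer g p σ a b u) :
    action g p a b u = minEnergy g p σ a b := by
  have : IsLeast (action g p a b '' signedH10 σ a b) (action g p a b u) :=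
    ⟨mem_image_of_mem _ hu.1, by rintro _ ⟨v, hv, rfl⟩; exact hu.2 hv⟩
  exact this.csInf_eq.symm

theorem IsMinimizer.le_action (hu : IsMinimizer g p σ a b u) (hv : v ∈ signedH10 σ a b) :
    action g p a b u ≤ action g p a b v := hu.2 hv

/-- Replacing `u` by `v` on [s, t] gives an admissible competitor on [a, b], and the actions outside
[s, t] cancel. -/
theorem IsMinimizer.local_le (hg : IsReaction g) (hp : Continuous p)
    (hu : IsMinimizer g p 1 a b u) (has : a ≤ s) (hst : s ≤ t) (htb : t ≤ b)
    (hv : SobolevOn v s t) (hs : v s = u s) (ht : v t = u t) (h0 : ∀ x ∈ Icc s t, 0 ≤ v x) :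
    action g p s t u ≤ action g p s t v := by
  have hab : a ≤ b := has.trans (hst.trans htb)
  have hus := hu.sobolevOn hab
  classical
  set V : ℝ → ℝ := fun x => if x ∈ Icc s t then v x else u x with hV
  have e1 : EqOn u V (Icc a s) := fun x hx => by
    rcases hx.2.eq_or_lt with rfl | hlt
    · simp [hV, hst, hs]
    · simp [hV, hlt.not_ge]
  have e2 : EqOn v V (Icc s t) := fun x hx => by simp [hV, hx.1, hx.2]
  have e3 : EqOn u V (Icc t b) := fun x hx => by
    rcases hx.1.eq_or_lt with rfl | hlt
    · simp [hV, hst, ht]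
    · simp [hV, hlt.not_ge]
  have s1 := hus.mono_Icc le_rfl has (hst.trans htb)
  have s3 := hus.mono_Icc (has.trans hst) htb le_rfl
  have hVs : SobolevOn V s b := .glue hst htb (hv.congr hst e2) (s3.congr htb e3)
  have hVa : SobolevOn V a b := .glue has (hst.trans htb) (s1.congr has e1) hVs
  have hmem : V ∈ signedH10 1 a b := by
    refine ⟨(mem_H10_iff hab).2 ⟨hVa, ?_, ?_⟩, fun x hx => ?_⟩
    · rw [← e1 (left_mem_Icc.2 has), hu.left]
    · rw [← e3 (right_mem_Icc.2 htb), hu.right]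
    · simp only [hV, one_mul]
      split_ifs with hx'
      · exact h0 x hx'
      · exact hu.nonneg hx
  have hle := hu.le_action hmem
  rw [← action_add_adjacent hg hp has (hst.trans htb) hus,
    ← action_add_adjacent hg hp hst htb (hus.mono_Icc has (hst.trans htb) le_rfl),
    ← action_add_adjacent hg hp has (hst.trans htb) hVa,
    ← action_add_adjacent hg hp hst htb hVs, action_congr has e1, action_congr htb e3,
    ← action_congr (u := v) hst e2] at hle
  linarith

end Minimizer

/-! ### Existence of minimizers -/

theorem norm_toLp_sq {μ : Measure ℝ} {f : ℝ → ℝ} (hf : MemLp f 2 μ) :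
    ‖hf.toLp f‖ ^ 2 = ∫ x, f x ^ 2 ∂μ := by
  rw [← real_inner_self_eq_norm_sq, L2.inner_def]
  refine integral_congr_ae ?_
  filter_upwards [hf.coeFn_toLp] with x hx
  rw [hx]
  simp [pow_two]

theorem norm_toLp_sq_Ioo {f : ℝ → ℝ} {a b : ℝ} (hab : a ≤ b)
    (hf : MemLp f 2 (volume.restrict (Ioo a b))) :
    ‖hf.toLp f‖ ^ 2 = ∫ x in a..b, f x ^ 2 := by
  rw [norm_toLp_sq, intervalIntegral.integral_of_le hab, integral_Ioc_eq_integral_Ioo]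

/-- A sequence of functions with uniformly bounded Dirichlet integral that vanish at `a` has a
uniformly Cauchy subsequence. -/
theorem exists_subseq_uniformCauchy {u : ℕ → ℝ → ℝ} {a b B : ℝ} (hab : a ≤ b)
    (hu : ∀ n, SobolevOn (u n) a b) (ha : ∀ n, u n a = 0)
    (hB : ∀ n, ∫ t in a..b, deriv (u n) t ^ 2 ≤ B) :
    ∃ φ : ℕ → ℕ, StrictMono φ ∧ ∀ ε > 0, ∃ N, ∀ i ≥ N, ∀ j ≥ N, ∀ t ∈ Icc a b,
      |u (φ i) t - u (φ j) t| ≤ ε := by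
  have hB0 : 0 ≤ B := (SobolevOn.integral_deriv_sq_nonneg hab).trans (hB 0)
  -- A uniform Hölder modulus of exponent 1/2, which supplies the equicontinuity and, with the zero
  -- at `a`, the bound for Arzelà-Ascoli.
  have hH : ∀ n, ∀ s ∈ Icc a b, ∀ t ∈ Icc a b, (u n t - u n s) ^ 2 ≤ |t - s| * B := by
    intro n s hs t ht
    rcases le_total s t with hst | hst
    · rw [abs_of_nonneg (sub_nonneg.2 hst)]
      exact ((hu n).sq_sub_le_of_mem hs.1 hst ht.2).trans
        (mul_le_mul_of_nonneg_left (hB n) (sub_nonneg.2 hst))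
    · rw [abs_sub_comm, abs_of_nonneg (sub_nonneg.2 hst), ← neg_sub (u n s), neg_sq]
      exact ((hu n).sq_sub_le_of_mem ht.1 hst hs.2).trans
        (mul_le_mul_of_nonneg_left (hB n) (sub_nonneg.2 hst))
  let f : ℕ → BoundedContinuousFunction (Icc a b) ℝ := fun n =>
    BoundedContinuousFunction.mkOfCompact
      ⟨(Icc a b).domRestrict (u n), ((hu n).continuousOn hab).domRestrict⟩
  have hf : ∀ n x, f n x = u n x := fun n x => rfl
  set R := Real.sqrt ((b - a) * B) with hR
  have hcomp : IsCompact (closure (range f)) := by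
    refine BoundedContinuousFunction.arzela_ascoli (Icc (-R) R) isCompact_Icc _ ?_ ?_
    · rintro _ x ⟨n, rfl⟩
      rw [hf, mem_Icc, ← abs_le]
      apply Real.abs_le_sqrt
      have := hH n a (left_mem_Icc.2 hab) x x.2
      rw [ha, sub_zero, abs_of_nonneg (sub_nonneg.2 x.2.1)] at this
      exact this.trans (mul_le_mul_of_nonneg_right (by linarith [x.2.2]) hB0)
    · intro x
      rw [Metric.equicontinuousAt_iff_pair]
      intro ε hε
      refine ⟨Metric.ball x (ε ^ 2 / (4 * (B + 1))), Metric.ball_mem_nhds _ (by positivity), ?_⟩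
      rintro y hy z hz ⟨_, n, rfl⟩
      have hyz : |(z : ℝ) - y| < 2 * (ε ^ 2 / (4 * (B + 1))) := by
        have h1 : dist z x < _ := hz
        have h2 : dist y x < _ := hy
        have h3 := dist_triangle_right z y x
        rw [← Real.dist_eq, ← Subtype.dist_eq]; linarith
      have := hH n y y.2 z z.2
      change dist (u n y) (u n z) < ε
      rw [dist_comm, Real.dist_eq]
      refine abs_lt_of_sq_lt_sq ?_ hε.le
      refine this.trans_lt ?_
      calc |(z : ℝ) - y| * B ≤ 2 * (ε ^ 2 / (4 * (B + 1))) * B := by gcongr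
        _ < ε ^ 2 := by
          rw [← sub_pos]
          have : ε ^ 2 - 2 * (ε ^ 2 / (4 * (B + 1))) * B = ε ^ 2 * (B + 2) / (2 * (B + 1)) := by
            field_simp; ring
          rw [this]; positivity
  obtain ⟨F, -, φ, hφ, hlim⟩ := hcomp.tendsto_subseq fun n => subset_closure (mem_range_self (f := f) n)
  refine ⟨φ, hφ, fun ε hε => ?_⟩
  obtain ⟨N, hN⟩ := Metric.cauchySeq_iff.1 hlim.cauchySeq ε hε
  refine ⟨N, fun i hi j hj t ht => ?_⟩
  have h1 := (BoundedContinuousFunction.dist_coe_le_dist (f := (f ∘ φ) i) (g := (f ∘ φ) j) ⟨t, ht⟩)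
  exact h1.trans (hN i hi j hj).le

namespace ForcedReaction

variable {g p u v w : ℝ → ℝ} {m M K a b : ℝ}

/-- The action is convex up to a term controlled by the sup norm. -/
theorem action_midpoint (h : ForcedReaction g p m M K) (hab : a ≤ b) (hv : SobolevOn v a b)
    (hw : SobolevOn w a b) : (∫ t in a..b, deriv w t ^ 2) - 2 * K * (∫ t in a..b, w t ^ 2)
      ≤ action g p a b (fun t => v t + w t) + action g p a b (fun t => v t - w t)
        - 2 * action g p a b v := by
  have hw' : SobolevOn (fun t => (-1) * w t) a b := hw.const_mul (-1)
  have e1 := action_add h.reaction h.continuous hab hv hw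
  have e2 := action_add h.reaction h.continuous hab hv hw'
  have hcv := hv.continuousOn hab
  have hcw := hw.continuousOn hab
  have hG := h.reaction.continuous_primitive
  have hgc := h.reaction.continuous
  have d1 : ∫ t in a..b, deriv v t * deriv (fun t => (-1) * w t) t
      = -∫ t in a..b, deriv v t * deriv w t := by
    rw [← intervalIntegral.integral_neg]
    refine intervalIntegral.integral_congr_ae ?_
    filter_upwards [hw.deriv_const_mul_ae (-1)] with t ht hm
    rw [ht hm]; ring
  have d2 : ∫ t in a..b, deriv (fun t => (-1) * w t) t ^ 2 = ∫ t in a..b, deriv w t ^ 2 := by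
    refine intervalIntegral.integral_congr_ae ?_
    filter_upwards [hw.deriv_const_mul_ae (-1)] with t ht hm
    rw [ht hm]; ring
  have d3 : ∫ t in a..b, (p t - g (v t)) * ((-1) * w t)
      = -∫ t in a..b, (p t - g (v t)) * w t := by
    rw [← intervalIntegral.integral_neg]
    congr 1; ext t; ring
  have hrem : ∀ z : ℝ → ℝ, ContinuousOn z (Icc a b) →
      ∫ t in a..b, (primitive g (v t + z t) - primitive g (v t) - g (v t) * z t)
        ≤ K * ∫ t in a..b, z t ^ 2 := by
    intro z hz
    rw [← intervalIntegral.integral_const_mul]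
    refine intervalIntegral.integral_mono_on hab ?_ ?_ fun t ht => ?_
    · apply ContinuousOn.intervalIntegrable; rw [uIcc_of_le hab]; fun_prop
    · apply ContinuousOn.intervalIntegrable; rw [uIcc_of_le hab]; fun_prop
    · have := h.reaction.primitive_remainder_le h.lipschitz (v t) (v t + z t)
      simpa using this
  have r1 := hrem w hcw
  have r2 := hrem (fun t => (-1) * w t) (by fun_prop)
  have e3 : ∫ t in a..b, ((-1) * w t) ^ 2 = ∫ t in a..b, w t ^ 2 := by congr 1; ext t; ring
  rw [e3] at r2
  rw [d1, d2, d3] at e2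
  have e4 : (fun t => v t - w t) = fun t => v t + (-1) * w t := by ext t; ring
  rw [e4]
  linarith

theorem abs_action_potential_sub_le (h : ForcedReaction g p m M K) (hab : a ≤ b)
    (hu : ContinuousOn u (Icc a b)) (hv : ContinuousOn v (Icc a b)) {δ : ℝ}
    (hd : ∀ t ∈ Icc a b, |u t - v t| ≤ δ) :
    |(∫ t in a..b, (-primitive g (u t) + p t * u t))
      - ∫ t in a..b, (-primitive g (v t) + p t * v t)| ≤ 2 * M * δ * (b - a) := by
  rw [← intervalIntegral.integral_sub (potential_integrable h.reaction h.continuous hab hu)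
    (potential_integrable h.reaction h.continuous hab hv), ← abs_of_nonneg (sub_nonneg.2 hab),
    ← Real.norm_eq_abs]
  refine intervalIntegral.norm_integral_le_of_norm_le_const fun t ht => ?_
  rw [uIoc_of_le hab] at ht
  have hδ := hd t (Ioc_subset_Icc_self ht)
  have h1 := h.reaction.abs_primitive_sub_le h.reaction_le (u t) (v t)
  have h2 : |p t * (u t - v t)| ≤ M * |u t - v t| := by
    rw [abs_mul]; exact mul_le_mul_of_nonneg_right (h.forcing_le t) (abs_nonneg _)
  have hM := h.bound_pos
  rw [Real.norm_eq_abs, show -primitive g (u t) + p t * u t - (-primitive g (v t) + p t * v t)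
    = (primitive g (v t) - primitive g (u t)) + p t * (u t - v t) by ring]
  refine (abs_add_le _ _).trans ?_
  rw [abs_sub_comm (v t)] at h1
  nlinarith

theorem bddBelow_action (h : ForcedReaction g p m M K) {σ : ℝ} (hab : a < b) :
    -(4 * M ^ 2 * (b - a) ^ 3) ∈ lowerBounds (action g p a b '' signedH10 σ a b) := by
  rintro _ ⟨u, hu, rfl⟩
  obtain ⟨hs, ha, -⟩ := (mem_H10_iff hab.le).1 hu.1
  have h1 := h.coercive hab hs ha
  have h2 : 0 ≤ ∫ t in a..b, deriv u t ^ 2 := SobolevOn.integral_deriv_sq_nonneg hab.le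
  linarith

/-- Direct method with strong instead of weak convergence. A minimizing sequence has a uniformly
Cauchy subsequence; half-sums stay admissible, so `action_midpoint` turns almost minimality and
uniform closeness into the L² Cauchy property of the derivatives. The primitive of the L² limit is
the minimizer. -/
theorem exists_isMinimizer (h : ForcedReaction g p m M K) (hab : a < b) :
    ∃ u, IsMinimizer g p 1 a b u := by
  set S := action g p a b '' signedH10 1 a b with hS
  have hne : S.Nonempty := ⟨_, mem_image_of_mem _ (zero_mem_signedH10 hab.le)⟩
  have hbdd : BddBelow S := ⟨_, h.bddBelow_action hab⟩
  obtain ⟨s, -, hslim, hsmem⟩ := exists_seq_tendsto_sInf hne hbdd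
  choose u hu hus using hsmem
  have hsob : ∀ n, SobolevOn (u n) a b := fun n => ((mem_H10_iff hab.le).1 (hu n).1).1
  have hua : ∀ n, u n a = 0 := fun n => ((mem_H10_iff hab.le).1 (hu n).1).2.1
  have hub : ∀ n, u n b = 0 := fun n => ((mem_H10_iff hab.le).1 (hu n).1).2.2
  have hu0 : ∀ n, ∀ t ∈ Icc a b, 0 ≤ u n t := fun n t ht => by simpa using (hu n).2 t ht
  obtain ⟨T, hT⟩ := hslim.bddAbove_range
  obtain ⟨φ, hφ, hcau⟩ := exists_subseq_uniformCauchy (B := 4 * (T + 4 * M ^ 2 * (b - a) ^ 3))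
    hab.le hsob hua fun n => by
      have h1 := h.coercive hab (hsob n) (hua n)
      have h2 : s n ≤ T := hT (mem_range_self n)
      rw [hus] at h1
      linarith
  set I := sInf S with hI
  have hsφ : Tendsto (s ∘ φ) atTop (𝓝 I) := hslim.comp hφ.tendsto_atTop
  let e : ℕ → Lp ℝ 2 (volume.restrict (Ioo a b)) := fun n =>
    ((hsob (φ n)).deriv_memLp hab.le).toLp _
  have hcomb : ∀ i j, ‖e i - e j‖ ^ 2 = ∫ t in a..b, (deriv (u (φ i)) t - deriv (u (φ j)) t) ^ 2 := by
    intro i j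
    rw [← MemLp.toLp_sub, norm_toLp_sq_Ioo hab.le]
    rfl
  have hpos : 0 < b - a := sub_pos.2 hab
  have hK := h.lipschitz_pos
  have hCauchy : CauchySeq e := by
    rw [Metric.cauchySeq_iff]
    intro ε hε
    -- Budget: the sup-norm term contributes 2Kδ²(b - a) = ε²/8 and the two action defects, each
    -- below ε²/16, another ε²/8. The derivative of the half-difference then has square norm below
    -- ε²/4.
    set δ := Real.sqrt (ε ^ 2 / (8 * (2 * K * (b - a)))) with hδ
    have hδ0 : 0 < δ := Real.sqrt_pos.2 (by positivity)
    have hδ2 : δ ^ 2 = ε ^ 2 / (8 * (2 * K * (b - a))) := Real.sq_sqrt (by positivity)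
    obtain ⟨N₁, hN₁⟩ := hcau δ hδ0
    obtain ⟨N₂, hN₂⟩ := eventually_atTop.1
      (hsφ.eventually (gt_mem_nhds (show I < I + ε ^ 2 / 16 by linarith [pow_pos hε 2])))
    refine ⟨max N₁ N₂, fun i hi j hj => ?_⟩
    rw [dist_eq_norm]
    refine lt_of_pow_lt_pow_left₀ 2 hε.le ?_
    rw [hcomb]
    have hsi := hsob (φ i)
    have hsj := hsob (φ j)
    set v : ℝ → ℝ := fun t => 1 / 2 * (u (φ i) t + u (φ j) t)
    set w : ℝ → ℝ := fun t => 1 / 2 * (u (φ i) t - u (φ j) t)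
    have hv : SobolevOn v a b := (hsi.add hsj).const_mul _
    have hw : SobolevOn w a b := (hsi.sub hsj).const_mul _
    have hmid := h.action_midpoint hab.le hv hw
    have e1 : (fun t => v t + w t) = u (φ i) := by ext t; simp only [v, w]; ring
    have e2 : (fun t => v t - w t) = u (φ j) := by ext t; simp only [v, w]; ring
    rw [e1, e2, hus, hus] at hmid
    have hvI : I ≤ action g p a b v := by
      refine csInf_le hbdd (mem_image_of_mem _ ⟨(mem_H10_iff hab.le).2 ⟨hv, ?_, ?_⟩, fun t ht => ?_⟩)
      · simp [v, hua]
      · simp [v, hub]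
      · have := hu0 (φ i) t ht
        have := hu0 (φ j) t ht
        simp only [v]; linarith
    have hw2 : ∫ t in a..b, w t ^ 2 ≤ δ ^ 2 * (b - a) := by
      have hwi : IntervalIntegrable (fun t => w t ^ 2) volume a b :=
        ContinuousOn.intervalIntegrable (by
          rw [uIcc_of_le hab.le]; exact (hw.continuousOn hab.le).pow 2)
      have := intervalIntegral.integral_mono_on hab.le hwi
        (intervalIntegrable_const (c := δ ^ 2)) fun t ht => by
          have h1 := hN₁ i ((le_max_left _ _).trans hi) j ((le_max_left _ _).trans hj) t ht
          have h2 : |w t| ≤ δ := by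
            simp only [w]; rw [abs_mul]; norm_num; linarith [abs_nonneg (u (φ i) t - u (φ j) t)]
          exact sq_le_sq' (abs_le.1 h2).1 (abs_le.1 h2).2
      simpa [mul_comm] using this
    have hwd : ∫ t in a..b, (deriv (u (φ i)) t - deriv (u (φ j)) t) ^ 2
        = 4 * ∫ t in a..b, deriv w t ^ 2 := by
      rw [← intervalIntegral.integral_const_mul]
      refine intervalIntegral.integral_congr_ae ?_
      filter_upwards [hsi.deriv_sub_ae hsj, (hsi.sub hsj).deriv_const_mul_ae (1 / 2)] with t h1 h2 hm
      rw [h2 hm, h1 hm]; ring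
    rw [hwd]
    have h1 := hN₂ i ((le_max_right _ _).trans hi)
    have h2 := hN₂ j ((le_max_right _ _).trans hj)
    simp only [Function.comp] at h1 h2
    have h3 : 2 * K * (∫ t in a..b, w t ^ 2) ≤ ε ^ 2 / 8 := by
      calc 2 * K * (∫ t in a..b, w t ^ 2) ≤ 2 * K * (δ ^ 2 * (b - a)) := by gcongr
        _ = ε ^ 2 / 8 := by rw [hδ2]; field_simp
    linarith
  obtain ⟨f, hf⟩ := cauchySeq_tendsto_of_complete hCauchy
  have hfm : MemLp f 2 (volume.restrict (Ioo a b)) := Lp.memLp f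
  set U : ℝ → ℝ := fun x => ∫ t in a..x, f t with hU
  have hUs : SobolevOn U a b := .primitive hab.le hfm
  have hUa : U a = 0 := by simp [hU]
  have hfi : IntervalIntegrable f volume a b := by
    rw [intervalIntegrable_iff_integrableOn_Ioo_of_le hab.le]
    exact hfm.integrable (by norm_num)
  have hUd : ∫ t in a..b, deriv U t ^ 2 = ‖f‖ ^ 2 := by
    rw [← Lp.toLp_coeFn f hfm, norm_toLp_sq_Ioo hab.le]
    refine intervalIntegral.integral_congr_ae ?_
    filter_upwards [hfi.deriv_integral_ae] with t ht hm
    rw [ht hm]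
  have hud : ∀ n, ∫ t in a..b, deriv (u (φ n)) t ^ 2 = ‖e n‖ ^ 2 := fun n => by
    rw [norm_toLp_sq_Ioo hab.le]
  have hdiff : ∀ n, ∀ t ∈ Icc a b, |u (φ n) t - U t| ≤ Real.sqrt (b - a) * ‖e n - f‖ := by
    intro n t ht
    have hw := (hsob (φ n)).sub hUs
    have h1 := hw.sq_sub_le_of_mem le_rfl ht.1 ht.2
    have h2 : ∫ t in a..b, deriv (fun t => u (φ n) t - U t) t ^ 2 = ‖e n - f‖ ^ 2 := by
      rw [← Lp.toLp_coeFn f hfm, ← MemLp.toLp_sub, norm_toLp_sq_Ioo hab.le]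
      refine intervalIntegral.integral_congr_ae ?_
      filter_upwards [(hsob (φ n)).deriv_sub_ae hUs, hfi.deriv_integral_ae] with t h1 h2 hm
      rw [h1 hm, h2 hm]; rfl
    simp only [hua, hUa, sub_zero] at h1
    rw [h2] at h1
    refine abs_le_of_sq_le_sq ?_ (by positivity)
    rw [mul_pow, Real.sq_sqrt hpos.le]
    exact h1.trans (mul_le_mul_of_nonneg_right (by linarith [ht.2]) (by positivity))
  have hnorm : Tendsto (fun n => Real.sqrt (b - a) * ‖e n - f‖) atTop (𝓝 0) := by
    have := (tendsto_iff_norm_sub_tendsto_zero.1 hf).const_mul (Real.sqrt (b - a))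
    rwa [mul_zero] at this
  have hptw : ∀ t ∈ Icc a b, Tendsto (fun n => u (φ n) t) atTop (𝓝 (U t)) := fun t ht => by
    rw [tendsto_iff_norm_sub_tendsto_zero]
    exact squeeze_zero (fun n => norm_nonneg _) (fun n => hdiff n t ht) hnorm
  have hUmem : U ∈ signedH10 1 a b := by
    refine ⟨(mem_H10_iff hab.le).2 ⟨hUs, hUa, ?_⟩, fun t ht => ?_⟩
    · refine tendsto_nhds_unique (hptw b (right_mem_Icc.2 hab.le)) ?_
      simp [hub]
    · rw [one_mul]
      exact ge_of_tendsto' (hptw t ht) fun n => hu0 _ t ht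
  have hact : Tendsto (fun n => action g p a b (u (φ n))) atTop (𝓝 (action g p a b U)) := by
    have e1 : ∀ n, action g p a b (u (φ n)) = 1 / 2 * ‖e n‖ ^ 2
        + ∫ t in a..b, (-primitive g (u (φ n) t) + p t * u (φ n) t) := fun n => by
      rw [action_eq h.reaction h.continuous hab.le (hsob _), hud]
    simp_rw [e1]
    rw [action_eq h.reaction h.continuous hab.le hUs, hUd]
    refine ((hf.norm.pow 2).const_mul _).add ?_
    rw [tendsto_iff_norm_sub_tendsto_zero]
    refine squeeze_zero (fun n => norm_nonneg _) (fun n =>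
      h.abs_action_potential_sub_le hab.le ((hsob _).continuousOn hab.le)
        (hUs.continuousOn hab.le) (hdiff n)) ?_
    have := (hnorm.const_mul (2 * M)).mul_const (b - a)
    simpa using this
  have hUI : action g p a b U = I := by
    refine tendsto_nhds_unique hact ?_
    simpa only [hus, Function.comp_def] using hsφ
  refine ⟨U, hUmem, fun v hv => ?_⟩
  change action g p a b U ≤ action g p a b v
  rw [hUI]
  exact csInf_le hbdd (mem_image_of_mem _ hv)

theorem minEnergy_nonpos (h : ForcedReaction g p m M K) {σ : ℝ} (hab : a < b) :
    minEnergy g p σ a b ≤ 0 := by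
  refine csInf_le ⟨_, h.bddBelow_action hab⟩ ⟨_, zero_mem_signedH10 hab.le, action_zero⟩

theorem le_minEnergy (h : ForcedReaction g p m M K) {σ : ℝ} (hab : a < b) :
    -(4 * M ^ 2 * (b - a) ^ 3) ≤ minEnergy g p σ a b :=
  le_csInf ⟨_, mem_image_of_mem _ (zero_mem_signedH10 hab.le)⟩ (h.bddBelow_action hab)

end ForcedReaction

/-! ### The Euler-Lagrange equation -/

/-- `U` is a `C²` extension of `u` from `[a, b]`, with derivative `U'`, and it solves
`ü + g(u) = p` on `[a, b]`. -/
structure IsClassicalExtension (g p u : ℝ → ℝ) (a b : ℝ) (U U' F : ℝ → ℝ) : Prop where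
  eqOn : EqOn u U (Icc a b)
  hasDerivAt : ∀ t, HasDerivAt U (U' t) t
  hasDerivAt_deriv : ∀ t, HasDerivAt U' (F t) t
  continuous : Continuous F
  equation : ∀ t ∈ Icc a b, F t = p t - g (U t)

theorem continuousOn_exists_continuous_eqOn {u : ℝ → ℝ} {a b : ℝ} (hab : a ≤ b)
    (hu : ContinuousOn u (Icc a b)) : ∃ v : ℝ → ℝ, Continuous v ∧ EqOn u v (Icc a b) :=
  ⟨IccExtend hab ((Icc a b).domRestrict u), hu.domRestrict.Icc_extend',
    fun t ht => by rw [IccExtend_of_mem hab _ ht]; rfl⟩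

section Variation

variable {g p u w : ℝ → ℝ} {a b s t : ℝ}

theorem IsMinimizer.variation_nonneg (hg : IsReaction g) (hp : Continuous p)
    (hu : IsMinimizer g p 1 a b u) (has : a ≤ s) (hst : s ≤ t) (htb : t ≤ b)
    (hw : SobolevOn w s t) (hs : w s = 0) (ht : w t = 0) (h0 : ∀ x ∈ Icc s t, 0 ≤ u x + w x) :
    ∫ x in s..t, (primitive g (u x + w x) - primitive g (u x) - g (u x) * w x)
      ≤ ((∫ x in s..t, deriv u x * deriv w x) + ∫ x in s..t, (p x - g (u x)) * w x)
        + 1 / 2 * ∫ x in s..t, deriv w x ^ 2 := by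
  have hus := (hu.sobolevOn (has.trans (hst.trans htb))).mono_Icc has hst htb
  have h1 := hu.local_le hg hp has hst htb (hus.add hw) (by simp [hs]) (by simp [ht]) h0
  rw [action_add hg hp hst hus hw] at h1
  linarith

/-- Along εw the action changes by εA + ε²D/2 minus a nonnegative remainder of the convex G. Only
one-sided variations are admissible where `u` may vanish, hence an inequality. -/
theorem IsMinimizer.first_variation_nonneg (hg : IsReaction g) (hp : Continuous p)
    (hu : IsMinimizer g p 1 a b u) (has : a ≤ s) (hst : s ≤ t) (htb : t ≤ b)
    (hw : SobolevOn w s t) (hs : w s = 0) (ht : w t = 0) {δ : ℝ} (hδ : 0 < δ)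
    (h0 : ∀ ε, 0 < ε → ε ≤ δ → ∀ x ∈ Icc s t, 0 ≤ u x + ε * w x) :
    0 ≤ (∫ x in s..t, deriv u x * deriv w x) + ∫ x in s..t, (p x - g (u x)) * w x := by
  set A := (∫ x in s..t, deriv u x * deriv w x) + ∫ x in s..t, (p x - g (u x)) * w x with hA
  set D := ∫ x in s..t, deriv w x ^ 2 with hD
  have hD0 : 0 ≤ D := SobolevOn.integral_deriv_sq_nonneg hst
  have key : ∀ ε, 0 < ε → ε ≤ δ → 0 ≤ A + 1 / 2 * (ε * D) := by
    intro ε hε hεδ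
    have h1 := hu.variation_nonneg hg hp has hst htb (hw.const_mul ε) (by simp [hs]) (by simp [ht])
      (h0 ε hε hεδ)
    have h2 : 0 ≤ ∫ x in s..t,
        (primitive g (u x + ε * w x) - primitive g (u x) - g (u x) * (ε * w x)) :=
      intervalIntegral.integral_nonneg hst fun x _ => by
        simpa using hg.primitive_remainder_nonneg (u x) (u x + ε * w x)
    have e1 : ∫ x in s..t, deriv u x * deriv (fun x => ε * w x) x
        = ε * ∫ x in s..t, deriv u x * deriv w x := by
      rw [← intervalIntegral.integral_const_mul]
      refine intervalIntegral.integral_congr_ae ?_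
      filter_upwards [hw.deriv_const_mul_ae ε] with x hx hm
      rw [hx hm]; ring
    have e2 : ∫ x in s..t, (p x - g (u x)) * (ε * w x)
        = ε * ∫ x in s..t, (p x - g (u x)) * w x := by
      rw [← intervalIntegral.integral_const_mul]
      congr 1; ext x; ring
    have e3 : ∫ x in s..t, deriv (fun x => ε * w x) x ^ 2 = ε ^ 2 * D := by
      rw [hD, ← intervalIntegral.integral_const_mul]
      refine intervalIntegral.integral_congr_ae ?_
      filter_upwards [hw.deriv_const_mul_ae ε] with x hx hm
      rw [hx hm]; ring
    rw [e1, e2, e3, ← mul_add, ← hA] at h1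
    have h3 : 0 ≤ ε * (A + 1 / 2 * (ε * D)) := by nlinarith
    exact nonneg_of_mul_nonneg_right h3 hε
  by_contra hneg
  push Not at hneg
  have hε : 0 < min δ (-A / (D + 1)) := lt_min hδ (div_pos (by linarith) (by linarith))
  have h1 := key _ hε (min_le_left _ _)
  have h2 : min δ (-A / (D + 1)) * D ≤ -A / (D + 1) * D :=
    mul_le_mul_of_nonneg_right (min_le_right _ _) hD0
  have h3 : -A / (D + 1) * D ≤ -A := by
    rw [div_mul_eq_mul_div, div_le_iff₀ (by linarith)]
    nlinarith
  linarith

/-- If a minimizer is positive on `[s, t]`, its first variation vanishes there. -/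
theorem IsMinimizer.first_variation_eq_zero (hg : IsReaction g) (hp : Continuous p)
    (hu : IsMinimizer g p 1 a b u) (has : a ≤ s) (hst : s ≤ t) (htb : t ≤ b)
    (hw : SobolevOn w s t) (hs : w s = 0) (ht : w t = 0) (h0 : ∀ x ∈ Icc s t, 0 < u x) :
    (∫ x in s..t, deriv u x * deriv w x) + ∫ x in s..t, (p x - g (u x)) * w x = 0 := by
  have hus := (hu.sobolevOn (has.trans (hst.trans htb))).mono_Icc has hst htb
  obtain ⟨x₀, hx₀, hmin⟩ := isCompact_Icc.exists_isMinOn (nonempty_Icc.2 hst) (hus.continuousOn hst)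
  obtain ⟨Z, hZ⟩ := isCompact_Icc.exists_bound_of_continuousOn (hw.continuousOn hst)
  have hZ0 : 0 ≤ Z := (norm_nonneg _).trans (hZ s (left_mem_Icc.2 hst))
  have hδ : 0 < u x₀ / (Z + 1) := div_pos (h0 x₀ hx₀) (by linarith)
  have hadm : ∀ ε, 0 < ε → ε ≤ u x₀ / (Z + 1) → ∀ x ∈ Icc s t, |ε * w x| ≤ u x := by
    intro ε hε hεδ x hx
    have h1 := hZ x hx
    rw [Real.norm_eq_abs] at h1
    rw [abs_mul, abs_of_pos hε]
    calc ε * |w x| ≤ u x₀ / (Z + 1) * (Z + 1) := by gcongr; linarith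
      _ = u x₀ := by field_simp
      _ ≤ u x := hmin hx
  have h1 := hu.first_variation_nonneg hg hp has hst htb hw hs ht hδ
    fun ε hε hεδ x hx => by linarith [(abs_le.1 (hadm ε hε hεδ x hx)).1]
  have h2 := hu.first_variation_nonneg hg hp has hst htb (hw.const_mul (-1)) (by simp [hs])
    (by simp [ht]) hδ fun ε hε hεδ x hx => by linarith [(abs_le.1 (hadm ε hε hεδ x hx)).2]
  have e1 : ∫ x in s..t, deriv u x * deriv (fun x => -1 * w x) x
      = -∫ x in s..t, deriv u x * deriv w x := by
    rw [← intervalIntegral.integral_neg]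
    refine intervalIntegral.integral_congr_ae ?_
    filter_upwards [hw.deriv_const_mul_ae (-1)] with x hx hm
    rw [hx hm]; ring
  have e2 : ∫ x in s..t, (p x - g (u x)) * (-1 * w x)
      = -∫ x in s..t, (p x - g (u x)) * w x := by
    rw [← intervalIntegral.integral_neg]
    congr 1; ext x; ring
  rw [e1, e2] at h2
  linarith

/-- On an interval where it is positive, a minimizer is a classical solution. -/
theorem IsMinimizer.exists_classicalExtension (hg : IsReaction g) (hp : Continuous p)
    (hu : IsMinimizer g p 1 a b u) (has : a ≤ s) (hst : s < t) (htb : t ≤ b)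
    (h0 : ∀ x ∈ Ioo s t, 0 < u x) :
    ∃ U U' F, IsClassicalExtension g p u s t U U' F := by
  have hus := (hu.sobolevOn (has.trans (hst.le.trans htb))).mono_Icc has hst.le htb
  obtain ⟨v, hv, huv⟩ := continuousOn_exists_continuous_eqOn hst.le (hus.continuousOn hst.le)
  have hF : Continuous fun x => p x - g (v x) := hp.sub (hg.continuous.comp hv)
  -- V solves V̈ = p - g(u) with the boundary values of u, so the claim becomes u = V; this is the
  -- du Bois-Reymond argument.
  obtain ⟨V, V', hV, hV', hVs, hVt⟩ := exists_second_primitive_boundary hF hst (u s) (u t)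
  have hV'c : Continuous V' := continuous_iff_continuousAt.2 fun x => (hV' x).continuousAt
  have hVc : Continuous V := continuous_iff_continuousAt.2 fun x => (hV x).continuousAt
  set z : ℝ → ℝ := fun x => u x - V x with hz
  have hzc : ContinuousOn z (Icc s t) := (hus.continuousOn hst.le).sub hVc.continuousOn
  -- z = u - V is affine inside (s, t): subtracting from z its chord over [c, d] gives a test
  -- function ζ, and testing the vanishing first variation with ζ itself gives ∫ζ̇² = 0. The
  -- interval [c, d] stays away from s and t, where u may vanish and two-sided variations are not
  -- allowed.
  have haff : ∀ c d x, s < c → c ≤ x → x ≤ d → d < t → c < d →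
      (d - c) * z x = (d - c) * z c + (z d - z c) * (x - c) := by
    intro c d x hsc hcx hxd hdt hcd
    set r := (z d - z c) / (d - c) with hr
    have hdc : d - c ≠ 0 := (sub_pos.2 hcd).ne'
    set L : ℝ → ℝ := fun x => V x + (z c + r * (x - c)) with hL
    have hLd : ∀ x, HasDerivAt L (V' x + r) x := fun x => by
      simpa using (hV x).fun_add ((((hasDerivAt_id x).sub_const c).const_mul r).const_add (z c))
    have hLd' : ∀ x, HasDerivAt (fun x => V' x + r) (p x - g (v x)) x := fun x =>
      (hV' x).add_const r
    have hLs : SobolevOn L c d := .of_hasDerivAt hLd (hV'c.add continuous_const) c d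
    have huc := hus.mono_Icc hsc.le hcd.le hdt.le
    have hζ := huc.sub hLs
    set ζ : ℝ → ℝ := fun x => u x - L x with hζdef
    have hζc : ζ c = 0 := by simp [hζdef, hL, hz]
    have hζd : ζ d = 0 := by
      simp only [hζdef, hL, hr, hz]; field_simp; ring
    have h1 := hu.first_variation_eq_zero hg hp (has.trans hsc.le) hcd.le (hdt.le.trans htb) hζ
      hζc hζd fun x hx => h0 x ⟨hsc.trans_le hx.1, hx.2.trans_lt hdt⟩
    have h2 := hζ.integral_deriv_mul_deriv hLd' hF
    rw [hζc, hζd, mul_zero, mul_zero, sub_zero, zero_sub] at h2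
    have h3 : ∫ x in c..d, (p x - g (u x)) * ζ x = ∫ x in c..d, (p x - g (v x)) * ζ x := by
      refine intervalIntegral.integral_congr fun x hx => ?_
      rw [uIcc_of_le hcd.le] at hx
      simp only [huv ⟨hsc.le.trans hx.1, hx.2.trans hdt.le⟩]
    have h4 : ∫ x in c..d, deriv ζ x ^ 2 = (∫ x in c..d, deriv u x * deriv ζ x)
        - ∫ x in c..d, (V' x + r) * deriv ζ x := by
      have i2 : IntervalIntegrable (fun x => (V' x + r) * deriv ζ x) volume c d :=
        hζ.intervalIntegrable_deriv.continuousOn_mul (hV'c.add continuous_const).continuousOn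
      rw [← intervalIntegral.integral_sub (huc.mul_deriv_integrable hζ) i2]
      refine intervalIntegral.integral_congr_ae ?_
      filter_upwards [huc.deriv_sub_ae hLs] with x hx hm
      rw [hx hm, (hLd x).deriv]; ring
    have h5 : ∫ x in c..d, deriv ζ x ^ 2 = 0 := by rw [h4]; linarith
    have h6 := hζ.sq_sub_le_of_mem le_rfl hcx hxd
    rw [h5, mul_zero, hζc, sub_zero] at h6
    have h7 : ζ x = 0 := pow_eq_zero_iff (two_ne_zero) |>.1 (le_antisymm h6 (sq_nonneg _))
    have h8 : z x = z c + r * (x - c) := by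
      simp only [hζdef, hL] at h7
      simp only [hz] at h7 ⊢
      linarith
    rw [h8, hr]; field_simp
  have hzs : z s = 0 := by simp [hz, hVs]
  have hzt : z t = 0 := by simp [hz, hVt]
  have hz0 : ∀ x ∈ Icc s t, z x = 0 := by
    intro x hx
    rcases hx.1.eq_or_lt with rfl | hsx
    · exact hzs
    rcases hx.2.eq_or_lt with rfl | hxt
    · exact hzt
    have hpos : 0 < min (x - s) (t - x) := lt_min (by linarith) (by linarith)
    -- Letting c → s and d → t extends affinity up to the ends by continuity; since z vanishes at
    -- both ends it is zero.
    have t1 : Tendsto (fun ε : ℝ => s + ε) (𝓝[>] 0) (𝓝[Icc s t] s) := by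
      refine tendsto_nhdsWithin_iff.2 ⟨?_, ?_⟩
      · have : Tendsto (fun ε : ℝ => s + ε) (𝓝 0) (𝓝 (s + 0)) :=
          (continuous_const.add continuous_id).tendsto 0
        rw [add_zero] at this
        exact this.mono_left inf_le_left
      · filter_upwards [Ioo_mem_nhdsGT hpos] with ε hε
        have := hε.2.trans_le (min_le_left _ _)
        exact ⟨by linarith [hε.1], by linarith⟩
    have t2 : Tendsto (fun ε : ℝ => t - ε) (𝓝[>] 0) (𝓝[Icc s t] t) := by
      refine tendsto_nhdsWithin_iff.2 ⟨?_, ?_⟩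
      · have : Tendsto (fun ε : ℝ => t - ε) (𝓝 0) (𝓝 (t - 0)) :=
          (continuous_const.sub continuous_id).tendsto 0
        rw [sub_zero] at this
        exact this.mono_left inf_le_left
      · filter_upwards [Ioo_mem_nhdsGT hpos] with ε hε
        have := hε.2.trans_le (min_le_right _ _)
        exact ⟨by linarith, by linarith [hε.1]⟩
    have z1 : Tendsto (fun ε : ℝ => z (s + ε)) (𝓝[>] 0) (𝓝 0) := by
      have := (hzc s (left_mem_Icc.2 hst.le)).tendsto.comp t1
      rwa [hzs] at this
    have z2 : Tendsto (fun ε : ℝ => z (t - ε)) (𝓝[>] 0) (𝓝 0) := by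
      have := (hzc t (right_mem_Icc.2 hst.le)).tendsto.comp t2
      rwa [hzt] at this
    have t1' : Tendsto (fun ε : ℝ => s + ε) (𝓝[>] 0) (𝓝 s) := t1.mono_right inf_le_left
    have t2' : Tendsto (fun ε : ℝ => t - ε) (𝓝[>] 0) (𝓝 t) := t2.mono_right inf_le_left
    have l1 := (t2'.sub t1').mul_const (z x)
    have l2 := ((t2'.sub t1').mul z1).add ((z2.sub z1).mul (t1'.const_sub x))
    have := tendsto_nhds_unique (l1.congr' ?_) l2
    · have hne : t - s ≠ 0 := (sub_pos.2 hst).ne'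
      simpa [hne] using this
    · filter_upwards [Ioo_mem_nhdsGT hpos] with ε hε
      have h1 := hε.2.trans_le (min_le_left _ _)
      have h2 := hε.2.trans_le (min_le_right _ _)
      exact haff (s + ε) (t - ε) x (by linarith [hε.1]) (by linarith) (by linarith)
        (by linarith [hε.1]) (by linarith)
  have heq : EqOn u V (Icc s t) := fun x hx => by
    have := hz0 x hx
    simp only [hz] at this
    linarith
  refine ⟨V, V', _, heq, hV, hV', hF, fun x hx => ?_⟩
  simp only [← huv hx, heq hx]

end Variation

namespace IsClassicalExtension

variable {g p u U U' F : ℝ → ℝ} {a b : ℝ}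

theorem continuous_fun (hU : IsClassicalExtension g p u a b U U' F) : Continuous U :=
  continuous_iff_continuousAt.2 fun x => (hU.hasDerivAt x).continuousAt

theorem continuous_deriv (hU : IsClassicalExtension g p u a b U U' F) : Continuous U' :=
  continuous_iff_continuousAt.2 fun x => (hU.hasDerivAt_deriv x).continuousAt

theorem sub_eq_integral (hU : IsClassicalExtension g p u a b U U' F) (s t : ℝ) :
    U t - U s = ∫ x in s..t, U' x :=
  (intervalIntegral.integral_eq_sub_of_hasDerivAt (fun x _ => hU.hasDerivAt x)
    (hU.continuous_deriv.intervalIntegrable _ _)).symm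

theorem deriv_sub_eq_integral (hU : IsClassicalExtension g p u a b U U' F) (s t : ℝ) :
    U' t - U' s = ∫ x in s..t, F x :=
  (intervalIntegral.integral_eq_sub_of_hasDerivAt (fun x _ => hU.hasDerivAt_deriv x)
    (hU.continuous.intervalIntegrable _ _)).symm

theorem sobolevOn (hU : IsClassicalExtension g p u a b U U' F) (s t : ℝ) : SobolevOn U s t :=
  .of_hasDerivAt hU.hasDerivAt hU.continuous_deriv s t

theorem deriv_eq (hU : IsClassicalExtension g p u a b U U' F) : deriv U = U' :=
  funext fun t => (hU.hasDerivAt t).deriv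

theorem mono (hU : IsClassicalExtension g p u a b U U' F) {c d : ℝ} (hac : a ≤ c) (hdb : d ≤ b) :
    IsClassicalExtension g p u c d U U' F :=
  ⟨hU.eqOn.mono (Icc_subset_Icc hac hdb), hU.hasDerivAt, hU.hasDerivAt_deriv, hU.continuous,
    fun t ht => hU.equation t (Icc_subset_Icc hac hdb ht)⟩

end IsClassicalExtension

namespace ForcedReaction

variable {g p u U U' F : ℝ → ℝ} {m M K a b : ℝ}

theorem abs_deriv_sub_le (h : ForcedReaction g p m M K)
    (hU : IsClassicalExtension g p u a b U U' F) {s t : ℝ} (hs : s ∈ Icc a b) (ht : t ∈ Icc a b) :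
    |U' t - U' s| ≤ 2 * M * |t - s| := by
  rw [hU.deriv_sub_eq_integral, ← Real.norm_eq_abs]
  refine intervalIntegral.norm_integral_le_of_norm_le_const fun x hx => ?_
  have hx' : x ∈ Icc a b := by
    have := uIcc_subset_Icc hs ht
    exact this (uIoc_subset_uIcc hx)
  rw [hU.equation x hx', Real.norm_eq_abs]
  refine (abs_sub _ _).trans ?_
  linarith [h.forcing_le x, h.reaction_le (U x)]

theorem abs_deriv_le (h : ForcedReaction g p m M K) (hab : a < b)
    (hU : IsClassicalExtension g p u a b U U' F) (ha : U a = 0) (hb : U b = 0) {t : ℝ}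
    (ht : t ∈ Icc a b) : |U' t| ≤ 2 * M * (b - a) := by
  obtain ⟨x, hx, hx0⟩ := exists_hasDerivAt_eq_zero hab hU.continuous_fun.continuousOn
    (ha.trans hb.symm) fun x _ => hU.hasDerivAt x
  have h1 := h.abs_deriv_sub_le hU (Ioo_subset_Icc_self hx) ht
  rw [hx0, sub_zero] at h1
  refine h1.trans (mul_le_mul_of_nonneg_left ?_ (by linarith [h.bound_pos]))
  rw [abs_le]
  exact ⟨by linarith [hx.2, ht.1], by linarith [hx.1, ht.2]⟩

theorem abs_le_of_classical (h : ForcedReaction g p m M K) (hab : a < b)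
    (hU : IsClassicalExtension g p u a b U U' F) (ha : U a = 0) (hb : U b = 0) {t : ℝ}
    (ht : t ∈ Icc a b) : |U t| ≤ 2 * M * (b - a) ^ 2 := by
  have h1 : |U t - U a| ≤ 2 * M * (b - a) * |t - a| := by
    rw [hU.sub_eq_integral, ← Real.norm_eq_abs]
    refine intervalIntegral.norm_integral_le_of_norm_le_const fun x hx => ?_
    rw [uIoc_of_le ht.1] at hx
    exact h.abs_deriv_le hab hU ha hb ⟨hx.1.le, hx.2.trans ht.2⟩
  rw [ha, sub_zero, abs_of_nonneg (sub_nonneg.2 ht.1)] at h1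
  have : 0 ≤ 2 * M * (b - a) := by have := h.bound_pos; have := sub_pos.2 hab; positivity
  nlinarith [ht.2]

/-- The lower bound on the mean of `g ∘ u` implied by minimality, in terms of the slope. -/
theorem exists_deriv_decay (h : ForcedReaction g p m M K) :
    ∃ c C : ℝ, 0 < c ∧ 0 ≤ C ∧ ∀ {a b : ℝ} {u U U' F : ℝ → ℝ} {s t : ℝ}, a ≤ s → s ≤ t → t ≤ b →
      IsMinimizer g p 1 a b u → IsClassicalExtension g p u s t U U' F →
      U' t - U' s ≤ C - c * (t - s) := by
  obtain ⟨r, hr, hmr⟩ := h.above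
  set D := g r - m with hD
  have hD0 : 0 < D := sub_pos.2 hmr
  obtain ⟨C, hC, H⟩ := h.average.exists_bound h.forcing_le (show 0 < D / 4 by positivity)
  -- The test function is a tent of slope η. Its kinetic cost ½η²(t - s) equals r · (D/4)(t - s),
  -- and δ below is the distance from the ends at which it reaches the height 2r required by
  -- `remainder_lower`.
  set η := Real.sqrt (r * D / 2) with hη
  have hη0 : 0 < η := Real.sqrt_pos.2 (by positivity)
  have hη2 : η ^ 2 = r * D / 2 := Real.sq_sqrt (by positivity)
  set δ := 2 * r / η with hδ
  have hδ0 : 0 < δ := by positivity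
  have hgr : 0 ≤ g r := h.reaction.nonneg hr.le
  refine ⟨D / 2, C + 2 * δ * g r, by positivity, by positivity, ?_⟩
  intro a b u U U' F s t has hst htb hu hU
  have hgU0 : ∀ x ∈ Icc s t, 0 ≤ U x := fun x hx => by
    rw [← hU.eqOn hx]
    exact hu.nonneg ⟨has.trans hx.1, hx.2.trans htb⟩
  have hgc := h.reaction.continuous
  have hGc := h.reaction.continuous_primitive
  have hUc := hU.continuous_fun
  have main : g r * (t - s) - 2 * δ * g r - D / 4 * (t - s) ≤ ∫ x in s..t, g (U x) := by
    rcases lt_or_ge (t - s) (2 * δ) with hlt | hge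
    · have h1 : 0 ≤ ∫ x in s..t, g (U x) :=
        intervalIntegral.integral_nonneg hst fun x hx => h.reaction.nonneg (hgU0 x hx)
      have h2 : g r * (t - s) ≤ g r * (2 * δ) := mul_le_mul_of_nonneg_left hlt.le hgr
      have h3 : 0 ≤ D / 4 * (t - s) := mul_nonneg (by positivity) (sub_nonneg.2 hst)
      linarith
    · set w : ℝ → ℝ := fun x => η * tent s t x with hw
      have hws : SobolevOn w s t := (tent_sobolevOn s t s t).const_mul η
      have hwc : Continuous w := continuous_const.mul (tent_continuous s t)
      have hw0 : ∀ x, 0 ≤ w x := fun x => mul_nonneg hη0.le (tent_nonneg _ _ _)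
      have hwS : w s = 0 := by simp [hw, tent_left]
      have hwT : w t = 0 := by simp [hw, tent_right]
      have h1 := hu.variation_nonneg h.reaction h.continuous has hst htb hws hwS hwT
        fun x hx => add_nonneg (hu.nonneg ⟨has.trans hx.1, hx.2.trans htb⟩) (hw0 x)
      have e1 : ∫ x in s..t, deriv u x * deriv w x = -∫ x in s..t, F x * w x := by
        have := hws.integral_deriv_mul_deriv hU.hasDerivAt_deriv hU.continuous
        rw [hwS, hwT, mul_zero, mul_zero, sub_zero, zero_sub] at this
        rw [← this]
        refine intervalIntegral.integral_congr_Ioo_of_le hst fun x hx => ?_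
        simp only [(hU.eqOn.mono Ioo_subset_Icc_self).deriv isOpen_Ioo hx, hU.deriv_eq]
      have e2 : ∫ x in s..t, (p x - g (u x)) * w x = ∫ x in s..t, F x * w x := by
        refine intervalIntegral.integral_congr_Ioo_of_le hst fun x hx => ?_
        simp only [hU.equation x (Ioo_subset_Icc_self hx), hU.eqOn (Ioo_subset_Icc_self hx)]
      have e3 : ∫ x in s..t, deriv w x ^ 2 ≤ η ^ 2 * (t - s) := by
        have e : ∫ x in s..t, deriv w x ^ 2 = η ^ 2 * ∫ x in s..t, deriv (tent s t) x ^ 2 := by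
          rw [← intervalIntegral.integral_const_mul]
          refine intervalIntegral.integral_congr_ae ?_
          filter_upwards [(tent_sobolevOn s t s t).deriv_const_mul_ae η] with x hx hm
          rw [hx hm]; ring
        rw [e]
        exact mul_le_mul_of_nonneg_left (integral_deriv_tent_sq_le hst) (by positivity)
      have e4 : ∫ x in s..t, (primitive g (u x + w x) - primitive g (u x) - g (u x) * w x)
          = ∫ x in s..t, (primitive g (U x + w x) - primitive g (U x) - g (U x) * w x) := by
        refine intervalIntegral.integral_congr_Ioo_of_le hst fun x hx => ?_
        simp only [hU.eqOn (Ioo_subset_Icc_self hx)]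
      -- By the equation the first variation cancels, so the remainder of G is bounded by the
      -- kinetic cost of the tent alone.
      rw [e1, e2, e4] at h1
      have hRc : Continuous fun x => primitive g (U x + w x) - primitive g (U x) - g (U x) * w x := by
        fun_prop
      have h2 : ∫ x in (s + δ)..(t - δ),
          (primitive g (U x + w x) - primitive g (U x) - g (U x) * w x)
          ≤ ∫ x in s..t, (primitive g (U x + w x) - primitive g (U x) - g (U x) * w x) :=
        intervalIntegral.integral_mono_interval (by linarith) (by linarith) (by linarith)
          (Eventually.of_forall fun x => by
            simpa using h.reaction.primitive_remainder_nonneg (U x) (U x + w x))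
          (hRc.intervalIntegrable _ _)
      have h3 : ∫ x in (s + δ)..(t - δ), r * (g r - g (U x))
          ≤ ∫ x in (s + δ)..(t - δ),
            (primitive g (U x + w x) - primitive g (U x) - g (U x) * w x) := by
        refine intervalIntegral.integral_mono_on (by linarith)
          (Continuous.intervalIntegrable (by fun_prop) _ _) (hRc.intervalIntegrable _ _)
          fun x hx => ?_
        have hx' : x ∈ Icc s t := ⟨by linarith [hx.1], by linarith [hx.2]⟩
        refine h.reaction.remainder_lower hr.le (hgU0 x hx') ?_
        have : δ ≤ tent s t x := le_tent (by linarith [hx.1]) (by linarith [hx.2])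
        calc 2 * r = η * δ := by rw [hδ]; field_simp
          _ ≤ w x := mul_le_mul_of_nonneg_left this hη0.le
      have h4 : ∫ x in (s + δ)..(t - δ), r * (g r - g (U x))
          = r * (g r * (t - s - 2 * δ) - ∫ x in (s + δ)..(t - δ), g (U x)) := by
        rw [intervalIntegral.integral_const_mul, intervalIntegral.integral_sub
          intervalIntegrable_const (Continuous.intervalIntegrable (by fun_prop) _ _),
          intervalIntegral.integral_const, smul_eq_mul]
        ring
      have h5 : ∫ x in (s + δ)..(t - δ), g (U x) ≤ ∫ x in s..t, g (U x) := by
        refine intervalIntegral.integral_mono_interval (by linarith) (by linarith) (by linarith) ?_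
          (Continuous.intervalIntegrable (by fun_prop) _ _)
        rw [EventuallyLE, ae_restrict_iff' measurableSet_Ioc]
        exact Eventually.of_forall fun x hx => h.reaction.nonneg (hgU0 x (Ioc_subset_Icc_self hx))
      have h6 : r * (g r * (t - s - 2 * δ) - ∫ x in (s + δ)..(t - δ), g (U x))
          ≤ r * (D / 4 * (t - s)) := by
        rw [← h4]
        calc _ ≤ 1 / 2 * (η ^ 2 * (t - s)) := by linarith
          _ = r * (D / 4 * (t - s)) := by rw [hη2]; ring
      have h7 := le_of_mul_le_mul_left h6 hr
      linarith
  have e5 : U' t - U' s = (∫ x in s..t, p x) - ∫ x in s..t, g (U x) := by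
    rw [hU.deriv_sub_eq_integral, ← intervalIntegral.integral_sub
      (h.continuous.intervalIntegrable _ _) (Continuous.intervalIntegrable (by fun_prop) _ _)]
    refine intervalIntegral.integral_congr fun x hx => ?_
    rw [uIcc_of_le hst] at hx
    exact hU.equation x hx
  have h8 := (abs_le.1 (H s t hst)).2
  rw [e5]
  have : m = g r - D := by rw [hD]; ring
  rw [this] at h8
  linarith

end ForcedReaction

/-! ### Growth and positivity of minimizers -/

theorem integral_affine (A c x y z : ℝ) :
    ∫ t in x..y, (A + c * (t - z)) = A * (y - x) + c * ((y - z) ^ 2 - (x - z) ^ 2) / 2 := by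
  have hd : ∀ t, HasDerivAt (fun t : ℝ => A * t + c * (t - z) ^ 2 / 2) (A + c * (t - z)) t := by
    intro t
    have h1 := (((hasDerivAt_id t).sub_const z).fun_pow 2).const_mul c |>.div_const 2
    have := ((hasDerivAt_id t).const_mul A).fun_add h1
    convert! this using 1
    simp; ring
  rw [intervalIntegral.integral_eq_sub_of_hasDerivAt (fun t _ => hd t)
    (Continuous.intervalIntegrable (by fun_prop) _ _)]
  ring

/-- Integrating the slope decay from t to each end gives two inequalities involving U(t) and U'(t).
Combining them with weights b - t and t - a eliminates U'(t), and the length condition absorbs C.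
For the end slopes the decay is integrated over the whole interval. -/
theorem IsClassicalExtension.growth {g p u U U' F : ℝ → ℝ} {a b c C : ℝ}
    (hU : IsClassicalExtension g p u a b U U' F) (hab : a < b) (hc : 0 < c)
    (hdecay : ∀ s t, a ≤ s → s ≤ t → t ≤ b → U' t - U' s ≤ C - c * (t - s))
    (ha : U a = 0) (hb : U b = 0) (hl : 8 * C ≤ c * (b - a)) :
    (∀ t ∈ Icc a b, c / 4 * ((t - a) * (b - t)) ≤ U t) ∧ c / 4 * (b - a) ≤ U' a ∧
      U' b ≤ -(c / 4 * (b - a)) := by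
  have hpos : 0 < b - a := sub_pos.2 hab
  have hcpos := mul_pos hc hpos
  have up : ∀ x y, a ≤ x → x ≤ y → y ≤ b →
      U y - U x ≤ (U' x + C) * (y - x) - c * (y - x) ^ 2 / 2 := by
    intro x y hax hxy hyb
    rw [hU.sub_eq_integral]
    have hi : IntervalIntegrable (fun t => (U' x + C) + (-c) * (t - x)) volume x y :=
      Continuous.intervalIntegrable (by fun_prop) _ _
    have := intervalIntegral.integral_mono_on hxy (hU.continuous_deriv.intervalIntegrable _ _) hi
      fun t ht => by linarith [hdecay x t hax ht.1 (ht.2.trans hyb)]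
    rw [integral_affine] at this
    refine this.trans (le_of_eq ?_); ring
  have dn : ∀ x y, a ≤ x → x ≤ y → y ≤ b →
      (U' y - C) * (y - x) + c * (y - x) ^ 2 / 2 ≤ U y - U x := by
    intro x y hax hxy hyb
    rw [hU.sub_eq_integral]
    have hi : IntervalIntegrable (fun t => (U' y - C) + (-c) * (t - y)) volume x y :=
      Continuous.intervalIntegrable (by fun_prop) _ _
    have := intervalIntegral.integral_mono_on hxy hi
      (hU.continuous_deriv.intervalIntegrable _ _)
      fun t ht => by linarith [hdecay t y (hax.trans ht.1) ht.2 hyb]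
    rw [integral_affine] at this
    refine le_trans (le_of_eq ?_) this; ring
  refine ⟨fun t ht => ?_, ?_, ?_⟩
  · have h1 := dn a t le_rfl ht.1 ht.2
    have h2 := up t b ht.1 ht.2 le_rfl
    rw [ha, sub_zero] at h1
    rw [hb, zero_sub] at h2
    have hx : 0 ≤ t - a := sub_nonneg.2 ht.1
    have hy : 0 ≤ b - t := sub_nonneg.2 ht.2
    have h3 := mul_le_mul_of_nonneg_right h1 hy
    have h4 := mul_le_mul_of_nonneg_right h2 hx
    have h5 : (t - a) * (b - t) * (8 * C) ≤ (t - a) * (b - t) * (c * (b - a)) :=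
      mul_le_mul_of_nonneg_left hl (mul_nonneg hx hy)
    have h6 : c / 4 * ((t - a) * (b - t)) * (b - a) ≤ U t * (b - a) := by
      nlinarith
    exact le_of_mul_le_mul_right h6 hpos
  · have h2 := up a b le_rfl hab.le le_rfl
    rw [ha, hb, sub_zero] at h2
    have : 0 ≤ (U' a + C - c * (b - a) / 2) * (b - a) := by nlinarith
    have := nonneg_of_mul_nonneg_left this hpos
    linarith
  · have h2 := dn a b le_rfl hab.le le_rfl
    rw [ha, hb, sub_zero] at h2
    have : (U' b - C + c * (b - a) / 2) * (b - a) ≤ 0 := by nlinarith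
    have := nonpos_of_mul_nonpos_left this hpos
    linarith

/-- The tent has slope 1 and then -1, so the pairing is a second difference; `u` may have a corner
at the midpoint. -/
theorem SobolevOn.integral_deriv_mul_deriv_tent {u : ℝ → ℝ} {a b : ℝ} (hu : SobolevOn u a b)
    (hab : a ≤ b) : ∫ x in a..b, deriv u x * deriv (tent a b) x = 2 * u ((a + b) / 2) - u a - u b := by
  set z := (a + b) / 2 with hz
  have haz : a ≤ z := by linarith
  have hzb : z ≤ b := by linarith
  have hu1 := hu.mono_Icc le_rfl haz hzb
  have hu2 := hu.mono_Icc haz hzb le_rfl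
  have e1 : ∫ x in a..z, deriv u x * deriv (tent a b) x = u z - u a := by
    rw [← hu1.1.integral_deriv_eq_sub]
    refine intervalIntegral.integral_congr_Ioo_of_le haz fun x hx => ?_
    have heq : EqOn (tent a b) (fun x => x - a) (Ioo a z) := fun y hy => by
      simp only [tent]
      rw [min_eq_left (by linarith [hy.1, hy.2]), max_eq_right (by linarith [hy.1])]
    have := heq.deriv isOpen_Ioo hx
    simp only [this, deriv_sub_const, deriv_id'', mul_one]
  have e2 : ∫ x in z..b, deriv u x * deriv (tent a b) x = -(u b - u z) := by
    rw [← hu2.1.integral_deriv_eq_sub, ← intervalIntegral.integral_neg]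
    refine intervalIntegral.integral_congr_Ioo_of_le hzb fun x hx => ?_
    have heq : EqOn (tent a b) (fun x => b - x) (Ioo z b) := fun y hy => by
      simp only [tent]
      rw [min_eq_right (by linarith [hy.1, hy.2]), max_eq_right (by linarith [hy.2])]
    have := heq.deriv isOpen_Ioo hx
    have hd : HasDerivAt (fun x => b - x) (-1) x := (hasDerivAt_id' x).const_sub b
    simp only [this, hd.deriv, mul_neg, mul_one]
  rw [← intervalIntegral.integral_add_adjacent_intervals
    (hu1.mul_deriv_integrable (tent_sobolevOn a b a z))
    (hu2.mul_deriv_integrable (tent_sobolevOn a b z b)), e1, e2]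
  ring

/-- A zero of a nonnegative continuous function to the left of a positive value. -/
theorem exists_last_zero {u : ℝ → ℝ} {a t : ℝ} (hat : a ≤ t) (hu : ContinuousOn u (Icc a t))
    (h0 : ∀ x ∈ Icc a t, 0 ≤ u x) (ha : u a = 0) (ht : 0 < u t) :
    ∃ s, a ≤ s ∧ s < t ∧ u s = 0 ∧ ∀ x, s < x → x ≤ t → 0 < u x := by
  have hcl : IsClosed (Icc a t ∩ u ⁻¹' {0}) := hu.preimage_isClosed_of_isClosed isClosed_Icc isClosed_singleton
  have hcomp : IsCompact (Icc a t ∩ u ⁻¹' {0}) :=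
    isCompact_Icc.of_isClosed_subset hcl inter_subset_left
  obtain ⟨s, ⟨hs, hs0⟩, hmax⟩ := hcomp.exists_isGreatest ⟨a, left_mem_Icc.2 hat, ha⟩
  refine ⟨s, hs.1, lt_of_le_of_ne hs.2 fun he => ?_, hs0, fun x hsx hxt => ?_⟩
  · rw [he] at hs0
    exact ht.ne' hs0
  · have hx : x ∈ Icc a t := ⟨hs.1.trans hsx.le, hxt⟩
    refine lt_of_le_of_ne (h0 x hx) fun he => ?_
    exact (hmax ⟨hx, he.symm⟩).not_gt hsx

theorem exists_first_zero {u : ℝ → ℝ} {t b : ℝ} (htb : t ≤ b) (hu : ContinuousOn u (Icc t b))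
    (h0 : ∀ x ∈ Icc t b, 0 ≤ u x) (hb : u b = 0) (ht : 0 < u t) :
    ∃ s, t < s ∧ s ≤ b ∧ u s = 0 ∧ ∀ x, t ≤ x → x < s → 0 < u x := by
  have hcl : IsClosed (Icc t b ∩ u ⁻¹' {0}) := hu.preimage_isClosed_of_isClosed isClosed_Icc isClosed_singleton
  have hcomp : IsCompact (Icc t b ∩ u ⁻¹' {0}) :=
    isCompact_Icc.of_isClosed_subset hcl inter_subset_left
  obtain ⟨s, ⟨hs, hs0⟩, hmin⟩ := hcomp.exists_isLeast ⟨b, right_mem_Icc.2 htb, hb⟩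
  refine ⟨s, lt_of_le_of_ne hs.1 fun he => ?_, hs.2, hs0, fun x htx hxs => ?_⟩
  · rw [← he] at hs0
    exact ht.ne' hs0
  · have hx : x ∈ Icc t b := ⟨htx, hxs.le.trans hs.2⟩
    refine lt_of_le_of_ne (h0 x hx) fun he => ?_
    exact (hmin ⟨hx, he.symm⟩).not_gt hxs

namespace ForcedReaction

variable {g p u U U' F : ℝ → ℝ} {m M K a b : ℝ}

theorem exists_growth (h : ForcedReaction g p m M K) :
    ∃ κ l : ℝ, 0 < κ ∧ 0 < l ∧ ∀ {a b s t : ℝ} {u U U' F : ℝ → ℝ}, a ≤ s → t ≤ b → l ≤ t - s →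
      IsMinimizer g p 1 a b u → IsClassicalExtension g p u s t U U' F → U s = 0 → U t = 0 →
      (∀ x ∈ Icc s t, κ * ((x - s) * (t - x)) ≤ U x) ∧ κ * (t - s) ≤ U' s ∧
        U' t ≤ -(κ * (t - s)) := by
  obtain ⟨c, C, hc, hC, H⟩ := h.exists_deriv_decay
  refine ⟨c / 4, 8 * C / c + 1, by positivity, by positivity, ?_⟩
  intro a b s t u U U' F has htb hl hu hU hs ht
  have hl' : 8 * C / c ≤ t - s := by linarith
  have hst : s < t := by
    have : 0 ≤ 8 * C / c := by positivity
    linarith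
  refine hU.growth (C := C) hst hc (fun x y hx hxy hy => ?_) hs ht ?_
  · exact H (has.trans hx) hxy (hy.trans htb) hu (hU.mono hx hy)
  · rw [div_le_iff₀ hc] at hl'
    linarith

/-- Near an interior zero a minimizer grows at most quadratically. -/
theorem add_le_of_interior_zero (h : ForcedReaction g p m M K) (hu : IsMinimizer g p 1 a b u)
    {z r : ℝ} (hz : u z = 0) (hr : 0 ≤ r) (ha : a ≤ z - r) (hb : z + r ≤ b) :
    u (z - r) + u (z + r) ≤ 4 * M * r ^ 2 := by
  have hle : z - r ≤ z + r := by linarith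
  set w := tent (z - r) (z + r) with hw
  have hwc : Continuous w := tent_continuous _ _
  have hws : SobolevOn w (z - r) (z + r) := tent_sobolevOn _ _ _ _
  have hus : SobolevOn u (z - r) (z + r) := (hu.sobolevOn (by linarith)).mono_Icc ha hle hb
  have h1 := hu.first_variation_nonneg h.reaction h.continuous ha hle hb hws (tent_left _ _)
    (tent_right _ _) one_pos fun ε hε _ x hx => add_nonneg
      (hu.nonneg ⟨ha.trans hx.1, hx.2.trans hb⟩) (mul_nonneg hε.le (tent_nonneg _ _ _))
  have e1 := hus.integral_deriv_mul_deriv_tent hle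
  rw [show (z - r + (z + r)) / 2 = z by ring] at e1
  have h2 : ∫ x in (z - r)..(z + r), (p x - g (u x)) * w x ≤ 2 * M * r * (2 * r) := by
    refine (le_abs_self _).trans ?_
    have := intervalIntegral.norm_integral_le_of_norm_le_const (a := z - r) (b := z + r)
      (f := fun x => (p x - g (u x)) * w x) (C := 2 * M * r) fun x _ => by
        rw [Real.norm_eq_abs, abs_mul, abs_of_nonneg (tent_nonneg _ _ _ : 0 ≤ w x)]
        have h3 : |p x - g (u x)| ≤ 2 * M :=
          (abs_sub _ _).trans (by linarith [h.forcing_le x, h.reaction_le (u x)])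
        have h4 : w x ≤ r := by
          refine max_le hr ?_
          rcases le_total x z with hxz | hxz
          · exact (min_le_left _ _).trans (by linarith)
          · exact (min_le_right _ _).trans (by linarith)
        exact mul_le_mul h3 h4 (tent_nonneg _ _ _) (by linarith [h.bound_pos])
    rwa [Real.norm_eq_abs, show z + r - (z - r) = 2 * r by ring,
      abs_of_nonneg (by linarith : 0 ≤ 2 * r)] at this
  rw [e1, hz] at h1
  linarith

/-- A component of {u > 0} of length at least l has linear growth at its ends, while near an
interior zero growth is at most quadratic; such a component is therefore the whole interval. If
there is an interior zero, all components are short, u is bounded independently of b - a, and its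
action is at least linear in -(b - a), which a large tent beats. -/
theorem exists_pos_of_isMinimizer (h : ForcedReaction g p m M K) :
    ∃ l : ℝ, 0 < l ∧ ∀ {a b : ℝ} {u : ℝ → ℝ}, l ≤ b - a → IsMinimizer g p 1 a b u →
      ∀ t ∈ Ioo a b, 0 < u t := by
  obtain ⟨κ, l, hκ, hl, H⟩ := h.exists_growth
  obtain ⟨c, C, hc, hC, HT⟩ := h.exists_action_tent_le
  have hM := h.bound_pos
  set N := 2 * M * l ^ 2 with hN
  refine ⟨(C + 2 * M * N) / c + 1, by positivity, ?_⟩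
  intro a b u hlen hu
  have hab : a < b := by
    have : 0 ≤ (C + 2 * M * N) / c := by positivity
    linarith
  have hus := hu.sobolevOn hab.le
  have huc := hus.continuousOn hab.le
  have component : ∀ t ∈ Ioo a b, 0 < u t → ∃ α β, a ≤ α ∧ α < t ∧ t < β ∧ β ≤ b ∧ u α = 0 ∧
      u β = 0 ∧ ∀ x ∈ Ioo α β, 0 < u x := by
    intro t ht h0
    obtain ⟨α, h1, h2, h3, h4⟩ := exists_last_zero ht.1.le (huc.mono (Icc_subset_Icc_right ht.2.le))
      (fun x hx => hu.nonneg ⟨hx.1, hx.2.trans ht.2.le⟩) hu.left h0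
    obtain ⟨β, h5, h6, h7, h8⟩ := exists_first_zero ht.2.le (huc.mono (Icc_subset_Icc_left ht.1.le))
      (fun x hx => hu.nonneg ⟨ht.1.le.trans hx.1, hx.2⟩) hu.right h0
    refine ⟨α, β, h1, h2, h5, h6, h3, h7, fun x hx => ?_⟩
    rcases le_total x t with hxt | hxt
    · exact h4 x hx.1 hxt
    · exact h8 x hxt hx.2
  have long : ∀ α β, a ≤ α → α < β → β ≤ b → u α = 0 → u β = 0 → (∀ x ∈ Ioo α β, 0 < u x) →
      l ≤ β - α → α = a ∧ β = b := by
    intro α β haα hαβ hβb hα hβ hpos hle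
    obtain ⟨U, U', F, hU⟩ := hu.exists_classicalExtension h.reaction h.continuous haα hαβ hβb hpos
    have hUα : U α = 0 := by rw [← hU.eqOn (left_mem_Icc.2 hαβ.le), hα]
    have hUβ : U β = 0 := by rw [← hU.eqOn (right_mem_Icc.2 hαβ.le), hβ]
    have hgr := (H haα hβb hle hu hU hUα hUβ).1
    -- The threshold on r is where the linear lower bound κ(β - α)r/2 overtakes the upper bound 4Mr²
    -- at an interior zero.
    have no_zero : ∀ z r, 0 < r → r ≤ (β - α) / 2 → r < κ * (β - α) / (8 * M) →
        a ≤ z - r → z + r ≤ b → u z = 0 →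
        ¬ (κ * ((β - α) / 2 * r) ≤ u (z - r) + u (z + r)) := by
      intro z r hr hr1 hr2 h1 h2 h3 h4
      have h5 := h.add_le_of_interior_zero hu h3 hr.le h1 h2
      rw [lt_div_iff₀ (by positivity)] at hr2
      nlinarith
    have hp0 : 0 < κ * (β - α) / (8 * M) := by
      have := sub_pos.2 hαβ
      positivity
    constructor
    · by_contra hne
      have hlt : a < α := lt_of_le_of_ne haα (Ne.symm hne)
      obtain ⟨r, hr0, hr⟩ := exists_between (show 0 < min (min (α - a) ((β - α) / 2))
        (κ * (β - α) / (8 * M)) from lt_min (lt_min (by linarith) (by linarith)) hp0)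
      simp only [lt_min_iff] at hr
      refine no_zero α r hr0 hr.1.2.le hr.2 (by linarith) (by linarith) hα ?_
      have h1 := hgr (α + r) ⟨by linarith, by linarith⟩
      rw [← hU.eqOn ⟨by linarith, by linarith⟩] at h1
      have h2 : 0 ≤ u (α - r) := hu.nonneg ⟨by linarith, by linarith⟩
      have h3 : κ * ((β - α) / 2 * r) ≤ κ * ((α + r - α) * (β - (α + r))) := by
        refine mul_le_mul_of_nonneg_left ?_ hκ.le
        nlinarith
      linarith
    · by_contra hne
      have hlt : β < b := lt_of_le_of_ne hβb hne
      obtain ⟨r, hr0, hr⟩ := exists_between (show 0 < min (min (b - β) ((β - α) / 2))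
        (κ * (β - α) / (8 * M)) from lt_min (lt_min (by linarith) (by linarith)) hp0)
      simp only [lt_min_iff] at hr
      refine no_zero β r hr0 hr.1.2.le hr.2 (by linarith) (by linarith) hβ ?_
      have h1 := hgr (β - r) ⟨by linarith, by linarith⟩
      rw [← hU.eqOn ⟨by linarith, by linarith⟩] at h1
      have h2 : 0 ≤ u (β + r) := hu.nonneg ⟨by linarith, by linarith⟩
      have h3 : κ * ((β - α) / 2 * r) ≤ κ * ((β - r - α) * (β - (β - r))) := by
        refine mul_le_mul_of_nonneg_left ?_ hκ.le
        nlinarith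
      linarith
  by_contra hneg
  push Not at hneg
  obtain ⟨t₀, ht₀, hle₀⟩ := hneg
  -- The zero t₀ excludes a component filling (a, b), so every component is shorter than l and N =
  -- 2Ml² bounds u on it.
  have hsmall : ∀ t ∈ Icc a b, |u t| ≤ N := by
    intro t ht
    have hN0 : 0 ≤ N := by positivity
    rcases (hu.nonneg ht).eq_or_lt with h0 | h0
    · rwa [← h0, abs_zero]
    have hta : t ≠ a := fun he => h0.ne' (he ▸ hu.left)
    have htb : t ≠ b := fun he => h0.ne' (he ▸ hu.right)
    obtain ⟨α, β, h1, h2, h3, h4, h5, h6, h7⟩ :=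
      component t ⟨lt_of_le_of_ne ht.1 hta.symm, lt_of_le_of_ne ht.2 htb⟩ h0
    rcases le_or_gt l (β - α) with hlong | hshort
    · obtain ⟨rfl, rfl⟩ := long α β h1 (h2.trans h3) h4 h5 h6 h7 hlong
      exact absurd (h7 t₀ ht₀) hle₀.not_gt
    · obtain ⟨U, U', F, hU⟩ := hu.exists_classicalExtension h.reaction h.continuous h1
        (h2.trans h3) h4 h7
      have hm : t ∈ Icc α β := ⟨h2.le, h3.le⟩
      rw [hU.eqOn hm]
      refine (h.abs_le_of_classical (h2.trans h3) hU ?_ ?_ hm).trans ?_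
      · rw [← hU.eqOn (left_mem_Icc.2 (h2.trans h3).le), h5]
      · rw [← hU.eqOn (right_mem_Icc.2 (h2.trans h3).le), h6]
      · rw [hN]
        have : 0 ≤ β - α := by linarith
        gcongr
  have h1 : action g p a b u ≤ C * (b - a) - c * (b - a) ^ 2 := by
    refine (hu.le_action ⟨(mem_H10_iff hab.le).2 ⟨tent_sobolevOn _ _ _ _, tent_left _ _,
      tent_right _ _⟩, fun t _ => ?_⟩).trans (HT a b hab)
    rw [one_mul]; exact tent_nonneg _ _ _
  have h2 : -(2 * M * N * (b - a)) ≤ action g p a b u := by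
    rw [action_eq h.reaction h.continuous hab.le hus]
    have h3 : 0 ≤ ∫ t in a..b, deriv u t ^ 2 := SobolevOn.integral_deriv_sq_nonneg hab.le
    have h4 := intervalIntegral.norm_integral_le_of_norm_le_const (a := a) (b := b)
      (f := fun t => -primitive g (u t) + p t * u t) (C := 2 * M * N) fun t ht => by
        rw [uIoc_of_le hab.le] at ht
        rw [Real.norm_eq_abs]
        refine (h.abs_potential_le t (u t)).trans ?_
        exact mul_le_mul_of_nonneg_left (hsmall t (Ioc_subset_Icc_self ht)) (by linarith)
    rw [Real.norm_eq_abs, abs_of_pos (sub_pos.2 hab)] at h4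
    linarith [(abs_le.1 h4).1]
  have hpos : 0 < b - a := sub_pos.2 hab
  have h3 : (c * (b - a)) * (b - a) ≤ (C + 2 * M * N) * (b - a) := by linarith
  have h4 := le_of_mul_le_mul_right h3 hpos
  have h5 : (C + 2 * M * N) / c < b - a := by linarith
  rw [div_lt_iff₀ hc] at h5
  linarith

end ForcedReaction

/-! ### Uniqueness of minimizers and differentiability of the minimal energy -/

theorem integral_le_of_le_of_le_interior {f : ℝ → ℝ} {a b d A B : ℝ} (hf : ContinuousOn f (Icc a b))
    (hd : 0 ≤ d) (hdb : 2 * d ≤ b - a) (hA : ∀ t ∈ Icc a b, f t ≤ A) (hB0 : 0 ≤ B)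
    (hB : ∀ t ∈ Icc (a + d) (b - d), f t ≤ B) :
    ∫ t in a..b, f t ≤ 2 * d * A + B * (b - a) := by
  have hi : ∀ c e, a ≤ c → c ≤ e → e ≤ b → IntervalIntegrable f volume c e := fun c e h1 h2 h3 => by
    apply ContinuousOn.intervalIntegrable
    rw [uIcc_of_le h2]
    exact hf.mono (Icc_subset_Icc h1 h3)
  have i1 := hi a (a + d) le_rfl (by linarith) (by linarith)
  have i2 := hi (a + d) (b - d) (by linarith) (by linarith) (by linarith)
  have i3 := hi (b - d) b (by linarith) (by linarith) le_rfl
  rw [← intervalIntegral.integral_add_adjacent_intervals (i1.trans i2) i3,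
    ← intervalIntegral.integral_add_adjacent_intervals i1 i2]
  have b1 := intervalIntegral.integral_mono_on (by linarith) i1 (intervalIntegrable_const (c := A))
    fun t ht => hA t ⟨ht.1, by linarith [ht.2]⟩
  have b2 := intervalIntegral.integral_mono_on (by linarith) i2 (intervalIntegrable_const (c := B)) hB
  have b3 := intervalIntegral.integral_mono_on (by linarith) i3 (intervalIntegrable_const (c := A))
    fun t ht => hA t ⟨by linarith [ht.1], ht.2⟩
  rw [intervalIntegral.integral_const, smul_eq_mul] at b1 b2 b3
  nlinarith [mul_nonneg hd hB0]

/-- Cauchy-Schwarz from the nearer end; the distance to it is at most 2(t - a)(b - t)/(b - a). The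
value of w at b is allowed to be nonzero because the estimate is also applied to solutions whose
right ends differ. -/
theorem SobolevOn.sq_le_of_left_zero {w : ℝ → ℝ} {a b t : ℝ} (hw : SobolevOn w a b) (hab : a < b)
    (ha : w a = 0) (ht : t ∈ Icc a b) :
    w t ^ 2 ≤ 2 * w b ^ 2
      + 4 * ((t - a) * (b - t)) * (∫ x in a..b, deriv w x ^ 2) / (b - a) := by
  set D := ∫ x in a..b, deriv w x ^ 2 with hD
  have hD0 : 0 ≤ D := SobolevOn.integral_deriv_sq_nonneg hab.le
  have hpos : 0 < b - a := sub_pos.2 hab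
  have h1 := hw.sq_sub_le_of_mem le_rfl ht.1 ht.2
  have h2 := hw.sq_sub_le_of_mem ht.1 ht.2 le_rfl
  rw [ha, sub_zero, ← hD] at h1
  rw [← hD] at h2
  have hx : 0 ≤ t - a := sub_nonneg.2 ht.1
  have hy : 0 ≤ b - t := sub_nonneg.2 ht.2
  have h3 : w t ^ 2 ≤ 2 * w b ^ 2 + 2 * ((b - t) * D) := by nlinarith [sq_nonneg (2 * w b - w t)]
  rw [← sub_le_iff_le_add', le_div_iff₀ hpos]
  have hw2 := sq_nonneg (w b)
  rcases le_total (t - a) (b - t) with hle | hle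
  · have h4 : (w t ^ 2 - 2 * w b ^ 2) * (b - a) ≤ ((t - a) * D) * (2 * (b - t)) := by
      have : w t ^ 2 - 2 * w b ^ 2 ≤ (t - a) * D := by linarith
      calc _ ≤ ((t - a) * D) * (b - a) := mul_le_mul_of_nonneg_right this hpos.le
        _ ≤ _ := mul_le_mul_of_nonneg_left (by linarith) (mul_nonneg hx hD0)
    nlinarith [mul_nonneg (mul_nonneg hx hy) hD0]
  · have h4 : (w t ^ 2 - 2 * w b ^ 2) * (b - a) ≤ (2 * ((b - t) * D)) * (2 * (t - a)) := by
      have : w t ^ 2 - 2 * w b ^ 2 ≤ 2 * ((b - t) * D) := by linarith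
      calc _ ≤ (2 * ((b - t) * D)) * (b - a) := mul_le_mul_of_nonneg_right this hpos.le
        _ ≤ _ := mul_le_mul_of_nonneg_left (by linarith) (by have := mul_nonneg hy hD0; linarith)
    nlinarith

theorem hasDerivWithinAt_of_rpow_bound {f : ℝ → ℝ} {s : Set ℝ} {b d C : ℝ}
    (h : ∀ x ∈ s, |x - b| ≤ 1 → |f x - f b - (x - b) * d| ≤ C * (|x - b| * √|x - b|)) :
    HasDerivWithinAt f d s b := by
  rw [hasDerivWithinAt_iff_isLittleO, Asymptotics.isLittleO_iff]
  intro ε hε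
  have ht : Tendsto (fun x => C * √|x - b|) (𝓝[s] b) (𝓝 0) := by
    have : Continuous fun x => C * √|x - b| := by fun_prop
    have := this.tendsto b
    simp only [sub_self, abs_zero, Real.sqrt_zero, mul_zero] at this
    exact this.mono_left inf_le_left
  have h1 : ∀ᶠ x in 𝓝[s] b, |x - b| < 1 := by
    have : Continuous fun x => |x - b| := by fun_prop
    have := this.tendsto b
    rw [sub_self, abs_zero] at this
    exact (this.mono_left inf_le_left).eventually (gt_mem_nhds one_pos)
  filter_upwards [ht.eventually (gt_mem_nhds hε), h1, self_mem_nhdsWithin] with x hx1 hx2 hx3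
  rw [Real.norm_eq_abs, Real.norm_eq_abs, smul_eq_mul]
  refine (h x hx3 hx2.le).trans ?_
  have := mul_le_mul_of_nonneg_right hx1.le (abs_nonneg (x - b))
  linarith

namespace ForcedReaction

variable {g p : ℝ → ℝ} {m M K : ℝ}

theorem chordBound_le (h : ForcedReaction g p m M K) {q : ℝ} (hq : 0 < q) :
    IsReaction.chordBound g q ≤ K := by
  have h1 := h.lipschitz q (q / 2)
  rw [show q - q / 2 = q / 2 by ring, abs_of_pos (by linarith : 0 < q / 2)] at h1
  have h2 := (le_abs_self _).trans h1
  unfold IsReaction.chordBound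
  rw [div_le_iff₀ hq]
  linarith

/-- For functions that are large on long intervals, `g` is almost constant in the mean. -/
theorem exists_contraction (h : ForcedReaction g p m M K) {κ : ℝ} (hκ : 0 < κ) :
    ∃ l : ℝ, 0 < l ∧ ∀ {a b : ℝ} {U V : ℝ → ℝ}, l ≤ b - a → SobolevOn U a b → SobolevOn V a b →
      (∀ t ∈ Icc a b, κ * ((t - a) * (b - t)) ≤ U t) →
      (∀ t ∈ Icc a b, κ * ((t - a) * (b - t)) ≤ V t) → U a = V a →
      ∫ t in a..b, (g (V t) - g (U t)) * (V t - U t)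
        ≤ 1 / 2 * (∫ t in a..b, deriv (fun x => V x - U x) t ^ 2)
          + 2 * K * (V b - U b) ^ 2 * (b - a) := by
  obtain ⟨Q, hQ, HQ⟩ := h.reaction.exists_chordBound_mul_le (show 0 < κ / 16 by positivity)
  have hM := h.bound_pos
  refine ⟨256 * M * Q / κ ^ 2 + 4 * Q / κ + 1, by positivity, ?_⟩
  intro a b U V hl hU hV hUκ hVκ hUV
  have hl1 : 1 ≤ b - a := le_trans (le_add_of_nonneg_left (by positivity)) hl
  have hl2 : 4 * Q / κ ≤ b - a := by
    have : 0 ≤ 256 * M * Q / κ ^ 2 := by positivity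
    linarith
  have hl3 : 256 * M * Q / κ ^ 2 ≤ b - a := by
    have : 0 ≤ 4 * Q / κ := by positivity
    linarith
  have hpos : 0 < b - a := by linarith
  have hab : a < b := sub_pos.1 hpos
  have hw := hV.sub hU
  set w : ℝ → ℝ := fun t => V t - U t with hwdef
  set D := ∫ t in a..b, deriv w t ^ 2 with hD
  have hD0 : 0 ≤ D := SobolevOn.integral_deriv_sq_nonneg hab.le
  -- At distance at least d from both ends, κ(t - a)(b - t) ≥ Q, so the chord estimate with κ/16
  -- applies; on the two layers of width d only the crude bound 4M is available.
  set d := 2 * Q / (κ * (b - a)) with hd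
  have hd0 : 0 < d := by positivity
  have hd2 : 2 * d ≤ b - a := by
    rw [hd]
    have e : 2 * (2 * Q / (κ * (b - a))) = 4 * Q / κ / (b - a) := by field_simp; ring
    rw [e, div_le_iff₀ hpos]
    nlinarith
  have hK := h.lipschitz_pos
  set E := 4 * D / (κ * (b - a)) with hE
  have hE0 : 0 ≤ E := by positivity
  set N := 2 * K * w b ^ 2 with hN
  have hN0 : 0 ≤ N := by positivity
  -- With q = κ(t - a)(b - t), both functions are at least q and w² is at most qE plus a boundary
  -- term. Thus chord slope times w² involves only the product `chordBound g q * q`, the quantity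
  -- that is small for large q.
  have hpt : ∀ t ∈ Ioo a b, ∀ B, 0 ≤ B →
      IsReaction.chordBound g (κ * ((t - a) * (b - t))) * (κ * ((t - a) * (b - t))) ≤ B →
      (g (V t) - g (U t)) * w t ≤ N + E * B := by
    intro t ht B hB0 hB
    have hx : 0 < t - a := sub_pos.2 ht.1
    have hy : 0 < b - t := sub_pos.2 ht.2
    set q := κ * ((t - a) * (b - t)) with hq
    have hq0 : 0 < q := by positivity
    have h1 := h.reaction.mul_le_chordBound hq0 (hUκ t (Ioo_subset_Icc_self ht))
      (hVκ t (Ioo_subset_Icc_self ht))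
    have h2 := hw.sq_le_of_left_zero hab (by simp [hwdef, hUV]) (Ioo_subset_Icc_self ht)
    have h3 := h.chordBound_le hq0
    have h4 := h.reaction.chordBound_nonneg hq0.le
    rw [← hD] at h2
    have e : 4 * ((t - a) * (b - t)) * D / (b - a) = q * E := by
      rw [hq, hE]; field_simp
    rw [e] at h2
    calc (g (V t) - g (U t)) * w t ≤ IsReaction.chordBound g q * w t ^ 2 := h1
      _ ≤ IsReaction.chordBound g q * (2 * w b ^ 2 + q * E) := mul_le_mul_of_nonneg_left h2 h4
      _ = IsReaction.chordBound g q * (2 * w b ^ 2) + E * (IsReaction.chordBound g q * q) := by ring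
      _ ≤ K * (2 * w b ^ 2) + E * B := by gcongr
      _ = N + E * B := by rw [hN]; ring
  have hcont : ContinuousOn (fun t => (g (V t) - g (U t)) * w t - N) (Icc a b) := by
    have := hU.continuousOn hab.le
    have := hV.continuousOn hab.le
    have := h.reaction.continuous
    fun_prop
  have hint := integral_le_of_le_of_le_interior (A := E * (4 * M)) (B := E * (κ / 16)) hcont
    hd0.le hd2 (fun t ht => ?_) (by positivity) fun t ht => ?_
  · have e1 : ∫ t in a..b, ((g (V t) - g (U t)) * w t - N)
        = (∫ t in a..b, (g (V t) - g (U t)) * w t) - N * (b - a) := by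
      rw [intervalIntegral.integral_sub _ intervalIntegrable_const,
        intervalIntegral.integral_const, smul_eq_mul, mul_comm N]
      apply ContinuousOn.intervalIntegrable
      rw [uIcc_of_le hab.le]
      have := hcont.add (continuousOn_const (c := N))
      refine this.congr fun t _ => ?_
      simp
    rw [e1] at hint
    have e2 : E * (κ / 16) * (b - a) = D / 4 := by rw [hE]; field_simp; ring
    have e3 : 2 * d * (E * (4 * M)) ≤ D / 4 := by
      have : 2 * d * (E * (4 * M)) = (256 * M * Q / κ ^ 2) * (D / 4) / (b - a) ^ 2 := by
        rw [hd, hE]; field_simp; ring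
      rw [this, div_le_iff₀ (by positivity)]
      have h5 : 256 * M * Q / κ ^ 2 ≤ (b - a) ^ 2 := by nlinarith
      nlinarith
    change ∫ t in a..b, (g (V t) - g (U t)) * w t ≤ 1 / 2 * D + 2 * K * w b ^ 2 * (b - a)
    linarith
  · rcases ht.1.eq_or_lt with rfl | h1
    · have : w a = 0 := by simp [hwdef, hUV]
      rw [this, mul_zero]
      have : 0 ≤ E * (4 * M) := by positivity
      linarith
    rcases ht.2.eq_or_lt with rfl | h2
    · have h5 : (g (V t) - g (U t)) * (V t - U t) ≤ K * w t ^ 2 := by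
        refine (le_abs_self _).trans ?_
        rw [abs_mul, ← sq_abs (w t), pow_two, ← mul_assoc]
        exact mul_le_mul_of_nonneg_right (h.lipschitz _ _) (abs_nonneg _)
      have h6 : 0 ≤ E * (4 * M) := by positivity
      have h7 : 0 ≤ K * w t ^ 2 := by positivity
      rw [hN]
      linarith
    · have hx : 0 < t - a := sub_pos.2 h1
      have hy : 0 < b - t := sub_pos.2 h2
      have := hpt t ⟨h1, h2⟩ (4 * M) (by positivity)
        (IsReaction.chordBound_mul_le h.reaction_le (by positivity))
      linarith
  · have h1 : d ≤ t - a := by linarith [ht.1]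
    have h2 : d ≤ b - t := by linarith [ht.2]
    have := hpt t ⟨by linarith, by linarith⟩ (κ / 16) (by positivity) (HQ _ ?_)
    · linarith
    · have h3 : d * (b - a) / 2 ≤ (t - a) * (b - t) := by
        rcases le_total (t - a) (b - t) with hle | hle
        · nlinarith
        · nlinarith
      have h4 : κ * (d * (b - a) / 2) = Q := by rw [hd]; field_simp
      rw [← h4]
      exact mul_le_mul_of_nonneg_left h3 hκ.le

/-- A threshold length beyond which minimizers are classical, large and rigid. -/
structure IsThreshold (g p : ℝ → ℝ) (K κ l : ℝ) : Prop where
  kappa_pos : 0 < κ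
  one_le : 1 ≤ l
  pos : ∀ {a b : ℝ} {u : ℝ → ℝ}, l ≤ b - a → IsMinimizer g p 1 a b u → ∀ t ∈ Ioo a b, 0 < u t
  growth : ∀ {a b : ℝ} {u U U' F : ℝ → ℝ}, l ≤ b - a → IsMinimizer g p 1 a b u →
    IsClassicalExtension g p u a b U U' F →
      (∀ x ∈ Icc a b, κ * ((x - a) * (b - x)) ≤ U x) ∧ κ * (b - a) ≤ U' a ∧ U' b ≤ -(κ * (b - a))
  contraction : ∀ {a b : ℝ} {U V : ℝ → ℝ}, l ≤ b - a → SobolevOn U a b → SobolevOn V a b →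
      (∀ t ∈ Icc a b, κ * ((t - a) * (b - t)) ≤ U t) →
      (∀ t ∈ Icc a b, κ * ((t - a) * (b - t)) ≤ V t) → U a = V a →
      ∫ t in a..b, (g (V t) - g (U t)) * (V t - U t)
        ≤ 1 / 2 * (∫ t in a..b, deriv (fun x => V x - U x) t ^ 2)
          + 2 * K * (V b - U b) ^ 2 * (b - a)

theorem IsThreshold.mono {κ l l' : ℝ} (ht : IsThreshold g p K κ l) (hl : l ≤ l') :
    IsThreshold g p K κ l' where
  kappa_pos := ht.kappa_pos
  one_le := ht.one_le.trans hl
  pos h := ht.pos (hl.trans h)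
  growth h := ht.growth (hl.trans h)
  contraction h := ht.contraction (hl.trans h)

theorem _root_.IsClassicalExtension.left_eq_zero {u U U' F : ℝ → ℝ} {a b : ℝ} (hab : a ≤ b)
    (hU : IsClassicalExtension g p u a b U U' F) (hu : IsMinimizer g p 1 a b u) : U a = 0 := by
  rw [← hU.eqOn (left_mem_Icc.2 hab), hu.left]

theorem _root_.IsClassicalExtension.right_eq_zero {u U U' F : ℝ → ℝ} {a b : ℝ} (hab : a ≤ b)
    (hU : IsClassicalExtension g p u a b U U' F) (hu : IsMinimizer g p 1 a b u) : U b = 0 := by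
  rw [← hU.eqOn (right_mem_Icc.2 hab), hu.right]

theorem exists_isThreshold (h : ForcedReaction g p m M K) : ∃ κ l, IsThreshold g p K κ l := by
  obtain ⟨κ, l₁, hκ, hl₁, H₁⟩ := h.exists_growth
  obtain ⟨l₂, hl₂, H₂⟩ := h.exists_pos_of_isMinimizer
  obtain ⟨l₃, hl₃, H₃⟩ := h.exists_contraction hκ
  refine ⟨κ, l₁ + l₂ + l₃ + 1, hκ, by linarith, fun hl => H₂ (by linarith), ?_,
    fun hl => H₃ (by linarith)⟩
  intro a b u U U' F hl hu hU
  have hab : a ≤ b := by linarith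
  exact H₁ le_rfl le_rfl (by linarith) hu hU (hU.left_eq_zero hab hu) (hU.right_eq_zero hab hu)

theorem _root_.IsMinimizer.exists_extension {κ l a b : ℝ} {u : ℝ → ℝ}
    (h : ForcedReaction g p m M K) (ht : IsThreshold g p K κ l) (hl : l ≤ b - a)
    (hu : IsMinimizer g p 1 a b u) : ∃ U U' F, IsClassicalExtension g p u a b U U' F :=
  hu.exists_classicalExtension h.reaction h.continuous le_rfl (by linarith [ht.one_le]) le_rfl
    (ht.pos hl hu)

/-- Energy estimate for the difference of two solutions that vanish at `a`. -/
theorem IsThreshold.integral_deriv_sq_le {κ l a b c d : ℝ} {u v U U' F V V' F' : ℝ → ℝ}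
    (ht : IsThreshold g p K κ l) (hl : l ≤ b - a) (hbc : b ≤ c) (hbd : b ≤ d)
    (hu : IsMinimizer g p 1 a c u) (hU : IsClassicalExtension g p u a c U U' F)
    (hv : IsMinimizer g p 1 a d v) (hV : IsClassicalExtension g p v a d V V' F') :
    ∫ t in a..b, (V' t - U' t) ^ 2
      ≤ 2 * ((V b - U b) * (V' b - U' b)) + 4 * K * (V b - U b) ^ 2 * (b - a) := by
  have hab : a ≤ b := by linarith [ht.one_le]
  have key : ∀ {c : ℝ} {u U U' F : ℝ → ℝ}, b ≤ c → IsMinimizer g p 1 a c u →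
      IsClassicalExtension g p u a c U U' F → ∀ t ∈ Icc a b, κ * ((t - a) * (b - t)) ≤ U t := by
    intro c u U U' F hbc hu hU t htm
    refine le_trans ?_ ((ht.growth (hl.trans (by linarith)) hu hU).1 t ⟨htm.1, htm.2.trans hbc⟩)
    have := sub_nonneg.2 htm.1
    have := ht.kappa_pos
    gcongr
  have hUa := hU.left_eq_zero (hab.trans hbc) hu
  have hVa := hV.left_eq_zero (hab.trans hbd) hv
  have h1 := ht.contraction hl (hU.sobolevOn a b) (hV.sobolevOn a b) (key hbc hu hU)
    (key hbd hv hV) (hUa.trans hVa.symm)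
  have hd : ∀ t, HasDerivAt (fun x => V x - U x) (V' t - U' t) t :=
    fun t => (hV.hasDerivAt t).fun_sub (hU.hasDerivAt t)
  have hd' : ∀ t, HasDerivAt (fun x => V' x - U' x) (F' t - F t) t :=
    fun t => (hV.hasDerivAt_deriv t).fun_sub (hU.hasDerivAt_deriv t)
  have hderiv : deriv (fun x => V x - U x) = fun t => V' t - U' t := funext fun t => (hd t).deriv
  have h2 := ((hV.sobolevOn a b).sub (hU.sobolevOn a b)).integral_deriv_mul_deriv hd'
    (hV.continuous.sub hU.continuous)
  have h3 : ∫ t in a..b, (F' t - F t) * (V t - U t)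
      = -∫ t in a..b, (g (V t) - g (U t)) * (V t - U t) := by
    rw [← intervalIntegral.integral_neg]
    refine intervalIntegral.integral_congr fun t htm => ?_
    rw [uIcc_of_le hab] at htm
    simp only [hV.equation t ⟨htm.1, htm.2.trans hbd⟩, hU.equation t ⟨htm.1, htm.2.trans hbc⟩]
    ring
  rw [hderiv] at h1 h2
  have h4 : ∫ t in a..b, (V' t - U' t) * (V' t - U' t) = ∫ t in a..b, (V' t - U' t) ^ 2 := by
    congr 1; ext t; ring
  rw [h3, h4, hUa, hVa, sub_zero, mul_zero, sub_zero] at h2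
  simp only at h1 h2
  linarith

/-- The two solutions agree also at b, so the right-hand side of the energy estimate vanishes. -/
theorem IsThreshold.unique {κ l a b : ℝ} {u v : ℝ → ℝ} (h : ForcedReaction g p m M K)
    (ht : IsThreshold g p K κ l) (hl : l ≤ b - a)
    (hu : IsMinimizer g p 1 a b u) (hv : IsMinimizer g p 1 a b v) : EqOn v u (Icc a b) := by
  have hab : a ≤ b := by linarith [ht.one_le]
  obtain ⟨U, U', F, hU⟩ := hu.exists_extension h ht hl
  obtain ⟨V, V', F', hV⟩ := hv.exists_extension h ht hl
  have h1 := ht.integral_deriv_sq_le hl le_rfl le_rfl hu hU hv hV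
  have hUa := hU.left_eq_zero hab hu
  have hVa := hV.left_eq_zero hab hv
  rw [hU.right_eq_zero hab hu, hV.right_eq_zero hab hv] at h1
  have hd : deriv (fun x => V x - U x) = fun t => V' t - U' t :=
    funext fun t => ((hV.hasDerivAt t).fun_sub (hU.hasDerivAt t)).deriv
  intro t htm
  have h2 := ((hV.sobolevOn a b).sub (hU.sobolevOn a b)).sq_sub_le_of_mem le_rfl htm.1 htm.2
  rw [hd, hUa, hVa, sub_zero, sub_zero] at h2
  have h3 : (V t - U t) ^ 2 ≤ 0 :=
    h2.trans (mul_nonpos_of_nonneg_of_nonpos (sub_nonneg.2 htm.1) (by linarith))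
  have h4 : V t - U t = 0 := pow_eq_zero_iff two_ne_zero |>.1 (le_antisymm h3 (sq_nonneg _))
  rw [hU.eqOn htm, hV.eqOn htm]
  linarith

end ForcedReaction

/-! ### Dependence of the minimal energy on the right end point. -/

namespace ForcedReaction

variable {g p : ℝ → ℝ} {m M K : ℝ}

/-- First order expansion of the minimal energy with respect to the right end point. -/
theorem exists_energy_expansion (h : ForcedReaction g p m M K) {κ l : ℝ}
    (ht : IsThreshold g p K κ l) {R : ℝ} (hR : 1 ≤ R) :
    ∃ C, 0 ≤ C ∧ ∀ {a b b' : ℝ} {u v U U' F V V' F' : ℝ → ℝ}, l ≤ b - a → b ≤ b' → b' ≤ b + 1 →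
      b' - a ≤ R → IsMinimizer g p 1 a b u → IsClassicalExtension g p u a b U U' F →
      IsMinimizer g p 1 a b' v → IsClassicalExtension g p v a b' V V' F' →
      |action g p a b' v - action g p a b u + 1 / 2 * U' b ^ 2 * (b' - b)|
        ≤ C * ((b' - b) * √(b' - b)) ∧ |V' b' - U' b| ≤ C * √(b' - b) := by
  have hM := h.bound_pos
  have hK := h.lipschitz_pos
  have hR0 : 0 < R := by linarith
  set A := 2 * M * R with hA
  have hA0 : 0 < A := by positivity
  set C₁ := 4 * A ^ 2 + 4 * K * A ^ 2 * R with hC₁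
  have hC₁0 : 0 < C₁ := by positivity
  set S := √(R * C₁) with hS
  have hS0 : 0 ≤ S := Real.sqrt_nonneg _
  have hS2 : S ^ 2 = R * C₁ := Real.sq_sqrt (by positivity)
  set C₂ := A + K * S * R with hC₂
  have hC₂0 : 0 < C₂ := by positivity
  set C₃ := 2 * A * C₂ + 4 * K * A ^ 2 * R with hC₃
  have hC₃0 : 0 < C₃ := by positivity
  refine ⟨A * (2 * M) + 1 / 2 * C₂ ^ 2 + 2 * M * A + 2 * M * A + (1 / 2 + K * R ^ 2) * C₃
    + (2 * M + C₂), by positivity, ?_⟩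
  intro a b b' u v U U' F V V' F' hl hbb' hb1 hbR hu hU hv hV
  -- All errors are measured in powers of X and must be O(X³). The bootstrap is: w(b) = O(X²) gives
  -- D = O(X²), hence w = O(X) and W'(b) = O(X), which improves D to O(X³).
  set X := √(b' - b) with hX
  have hX0 : 0 ≤ X := Real.sqrt_nonneg _
  have hX2 : b' - b = X ^ 2 := (Real.sq_sqrt (sub_nonneg.2 hbb')).symm
  have hX1 : X ≤ 1 := Real.sqrt_le_one.2 (by linarith)
  have hX21 : X ^ 2 ≤ X := by nlinarith
  have hX32 : X ^ 3 ≤ X ^ 2 := pow_le_pow_of_le_one hX0 hX1 (by norm_num)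
  have hX42 : X ^ 4 ≤ X ^ 2 := pow_le_pow_of_le_one hX0 hX1 (by norm_num)
  have hX43 : X ^ 4 ≤ X ^ 3 := pow_le_pow_of_le_one hX0 hX1 (by norm_num)
  have hba : 1 ≤ b - a := ht.one_le.trans hl
  have hab : a < b := by linarith
  have hab' : a < b' := by linarith
  have hbaR : b - a ≤ R := by linarith
  have hUa := hU.left_eq_zero hab.le hu
  have hUb := hU.right_eq_zero hab.le hu
  have hVa := hV.left_eq_zero hab'.le hv
  have hVb := hV.right_eq_zero hab'.le hv
  have hU'le : ∀ t ∈ Icc a b, |U' t| ≤ A := fun t htm =>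
    (h.abs_deriv_le hab hU hUa hUb htm).trans (by rw [hA]; gcongr)
  have hV'le : ∀ t ∈ Icc a b', |V' t| ≤ A := fun t htm =>
    (h.abs_deriv_le hab' hV hVa hVb htm).trans (by rw [hA]; gcongr)
  have hVsmall : ∀ t ∈ Icc b b', |V t| ≤ A * X ^ 2 := by
    intro t htm
    have h1 : |V b' - V t| ≤ A * |b' - t| := by
      rw [hV.sub_eq_integral, ← Real.norm_eq_abs]
      refine intervalIntegral.norm_integral_le_of_norm_le_const fun x hx => ?_
      rw [uIoc_of_le htm.2] at hx
      exact hV'le x ⟨by linarith [hx.1, htm.1], hx.2⟩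
    rw [hVb, zero_sub, abs_neg, abs_of_nonneg (sub_nonneg.2 htm.2)] at h1
    refine h1.trans (mul_le_mul_of_nonneg_left ?_ hA0.le)
    linarith [htm.1]
  have hV'near : ∀ t ∈ Icc b b', |V' t - V' b| ≤ 2 * M * X ^ 2 := by
    intro t htm
    refine (h.abs_deriv_sub_le hV ⟨hab.le, hbb'⟩ ⟨hab.le.trans htm.1, htm.2⟩).trans ?_
    rw [abs_of_nonneg (sub_nonneg.2 htm.1)]
    refine mul_le_mul_of_nonneg_left ?_ (by linarith)
    linarith [htm.2]
  -- the difference of the two solutions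
  set w : ℝ → ℝ := fun t => V t - U t with hw
  set W' : ℝ → ℝ := fun t => V' t - U' t with hW'
  have hwd : ∀ t, HasDerivAt w (W' t) t := fun t => (hV.hasDerivAt t).fun_sub (hU.hasDerivAt t)
  have hWd : ∀ t, HasDerivAt W' (F' t - F t) t := fun t =>
    (hV.hasDerivAt_deriv t).fun_sub (hU.hasDerivAt_deriv t)
  have hW'c : Continuous W' := hV.continuous_deriv.sub hU.continuous_deriv
  have hderiv : deriv w = W' := funext fun t => (hwd t).deriv
  have hws : SobolevOn w a b := .of_hasDerivAt hwd hW'c a b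
  have hwc : Continuous w := hV.continuous_fun.sub hU.continuous_fun
  have hwa : w a = 0 := by simp [hw, hUa, hVa]
  have hwb : w b = V b := by simp [hw, hUb]
  have hwbX : |w b| ≤ A * X ^ 2 := by rw [hwb]; exact hVsmall b ⟨le_rfl, hbb'⟩
  have hwb2 : w b ^ 2 ≤ A ^ 2 * X ^ 4 := by
    have := sq_le_sq' (abs_le.1 hwbX).1 (abs_le.1 hwbX).2
    calc w b ^ 2 ≤ (A * X ^ 2) ^ 2 := this
      _ = _ := by ring
  have hb_mem : b ∈ Icc a b := right_mem_Icc.2 hab.le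
  have hb_mem' : b ∈ Icc a b' := ⟨hab.le, hbb'⟩
  have hWb : |W' b| ≤ 2 * A := (abs_sub _ _).trans (by linarith [hU'le b hb_mem, hV'le b hb_mem'])
  set D := ∫ t in a..b, W' t ^ 2 with hD
  have hD0 : 0 ≤ D := intervalIntegral.integral_nonneg hab.le fun t _ => sq_nonneg _
  have hDle : ∀ B, |W' b| ≤ B → D ≤ 2 * (A * X ^ 2 * B) + 4 * K * (A ^ 2 * X ^ 4) * R := by
    intro B hB
    have h1 := ht.integral_deriv_sq_le hl le_rfl hbb' hu hU hv hV
    have h2 : w b * W' b ≤ A * X ^ 2 * B := by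
      refine (le_abs_self _).trans ?_
      rw [abs_mul]
      exact mul_le_mul hwbX hB (abs_nonneg _) (by positivity)
    have h3 : 4 * K * w b ^ 2 * (b - a) ≤ 4 * K * (A ^ 2 * X ^ 4) * R := by gcongr
    change D ≤ 2 * (w b * W' b) + 4 * K * w b ^ 2 * (b - a) at h1
    linarith
  have hD1 : D ≤ C₁ * X ^ 2 := by
    have h1 := hDle _ hWb
    have h2 : 4 * K * (A ^ 2 * X ^ 4) * R ≤ 4 * K * (A ^ 2 * X ^ 2) * R := by gcongr
    rw [hC₁]; linarith
  have hwsq : ∀ t ∈ Icc a b, w t ^ 2 ≤ R * D := by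
    intro t htm
    have h1 := hws.sq_sub_le_of_mem le_rfl htm.1 htm.2
    rw [hderiv, hwa, sub_zero] at h1
    exact h1.trans (mul_le_mul_of_nonneg_right (by linarith [htm.2]) hD0)
  have hwS : ∀ t ∈ Icc a b, |w t| ≤ S * X := by
    intro t htm
    refine abs_le_of_sq_le_sq ((hwsq t htm).trans ?_) (by positivity)
    rw [mul_pow, hS2]
    calc R * D ≤ R * (C₁ * X ^ 2) := by gcongr
      _ = _ := by ring
  -- The mean value theorem gives a point where W' is O(X²), since w vanishes at a; from there to b
  -- the derivative of W' is g(U) - g(V) = O(X).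
  have hWbX : |W' b| ≤ C₂ * X := by
    obtain ⟨ξ, hξ, hξe⟩ := exists_hasDerivAt_eq_slope w W' hab hwc.continuousOn fun t _ => hwd t
    have h1 : |W' ξ| ≤ A * X ^ 2 := by
      rw [hξe, hwa, sub_zero, abs_div, abs_of_pos (by linarith : 0 < b - a)]
      exact (div_le_self (abs_nonneg _) hba).trans hwbX
    have h2 : |W' b - W' ξ| ≤ K * (S * X) * |b - ξ| := by
      rw [← intervalIntegral.integral_eq_sub_of_hasDerivAt (fun t _ => hWd t)
        ((hV.continuous.sub hU.continuous).intervalIntegrable _ _), ← Real.norm_eq_abs]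
      refine intervalIntegral.norm_integral_le_of_norm_le_const fun x hx => ?_
      rw [uIoc_of_le hξ.2.le] at hx
      have hxm : x ∈ Icc a b := ⟨hξ.1.le.trans hx.1.le, hx.2⟩
      rw [hV.equation x ⟨hxm.1, hxm.2.trans hbb'⟩, hU.equation x hxm, Real.norm_eq_abs,
        show p x - g (V x) - (p x - g (U x)) = g (U x) - g (V x) by ring, abs_sub_comm]
      refine (h.lipschitz _ _).trans (mul_le_mul_of_nonneg_left (hwS x hxm) hK.le)
    have h3 : |b - ξ| ≤ R := by
      rw [abs_of_nonneg (by linarith [hξ.2])]; linarith [hξ.1]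
    have h4 : K * (S * X) * |b - ξ| ≤ K * (S * X) * R := by gcongr
    have h5 := abs_add_le (W' ξ) (W' b - W' ξ)
    rw [add_sub_cancel] at h5
    have h6 : A * X ^ 2 ≤ A * X := by gcongr
    rw [hC₂]; linarith
  have hD3 : D ≤ C₃ * X ^ 3 := by
    have h1 := hDle _ hWbX
    have h2 : 4 * K * (A ^ 2 * X ^ 4) * R ≤ 4 * K * (A ^ 2 * X ^ 3) * R := by gcongr
    rw [hC₃]; linarith
  -- expansion of the action on `[a, b]`
  have eU : action g p a b u = action g p a b U := action_congr hab.le hU.eqOn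
  have eV : action g p a b' v = action g p a b V + action g p b b' V := by
    rw [action_congr hab'.le hV.eqOn, action_add_adjacent h.reaction h.continuous hab.le hbb'
      (hV.sobolevOn a b')]
  have e1 := action_add h.reaction h.continuous hab.le (hU.sobolevOn a b) hws
  have e2 : (fun t => U t + w t) = V := by ext t; simp only [hw]; ring
  have e3 := hws.integral_deriv_mul_deriv hU.hasDerivAt_deriv hU.continuous
  have e4 : ∫ t in a..b, (p t - g (U t)) * w t = ∫ t in a..b, F t * w t := by
    refine intervalIntegral.integral_congr fun t htm => ?_
    rw [uIcc_of_le hab.le] at htm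
    simp only [hU.equation t htm]
  rw [e2, hU.deriv_eq, e4, e3, hwa, mul_zero, sub_zero, hderiv, ← hD] at e1
  set Q := ∫ t in a..b, (primitive g (U t + w t) - primitive g (U t) - g (U t) * w t) with hQ
  have hQ0 : 0 ≤ Q := intervalIntegral.integral_nonneg hab.le fun t _ => by
    simpa using h.reaction.primitive_remainder_nonneg (U t) (U t + w t)
  have hQ1 : Q ≤ K * R ^ 2 * D := by
    have h1 := intervalIntegral.norm_integral_le_of_norm_le_const (a := a) (b := b)
      (f := fun t => primitive g (U t + w t) - primitive g (U t) - g (U t) * w t)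
      (C := K * (R * D)) fun t htm => by
        rw [uIoc_of_le hab.le] at htm
        have h2 := h.reaction.primitive_remainder_nonneg (U t) (U t + w t)
        have h3 := h.reaction.primitive_remainder_le h.lipschitz (U t) (U t + w t)
        rw [add_sub_cancel_left] at h2 h3
        rw [Real.norm_of_nonneg h2]
        exact h3.trans (mul_le_mul_of_nonneg_left (hwsq t (Ioc_subset_Icc_self htm)) hK.le)
    rw [Real.norm_eq_abs, abs_of_pos (by linarith : 0 < b - a)] at h1
    calc Q ≤ _ := (le_abs_self _).trans h1
      _ ≤ K * (R * D) * R := by gcongr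
      _ = _ := by ring
  -- expansion of the action on `[b, b']`
  have e5 := action_eq h.reaction h.continuous hbb' (hV.sobolevOn b b')
  rw [hV.deriv_eq] at e5
  set P := ∫ t in b..b', V' t ^ 2 with hP
  set T := ∫ t in b..b', (-primitive g (V t) + p t * V t) with hT
  have hP1 : |P - V' b ^ 2 * X ^ 2| ≤ 2 * M * X ^ 2 * (2 * A) * X ^ 2 := by
    have h1 : P - V' b ^ 2 * X ^ 2 = ∫ t in b..b', (V' t ^ 2 - V' b ^ 2) := by
      have hi : IntervalIntegrable (fun t => V' t ^ 2) volume b b' :=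
        (hV.continuous_deriv.pow 2).intervalIntegrable _ _
      rw [intervalIntegral.integral_sub hi intervalIntegrable_const, intervalIntegral.integral_const, smul_eq_mul, ← hX2]
      ring
    have h2 := intervalIntegral.norm_integral_le_of_norm_le_const (a := b) (b := b')
      (f := fun t => V' t ^ 2 - V' b ^ 2) (C := 2 * M * X ^ 2 * (2 * A)) fun t htm => by
        rw [uIoc_of_le hbb'] at htm
        rw [Real.norm_eq_abs, show V' t ^ 2 - V' b ^ 2 = (V' t - V' b) * (V' t + V' b) by ring,
          abs_mul]
        refine mul_le_mul (hV'near t (Ioc_subset_Icc_self htm)) ?_ (abs_nonneg _) (by positivity)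
        refine (abs_add_le _ _).trans ?_
        linarith [hV'le t ⟨hab.le.trans htm.1.le, htm.2⟩, hV'le b hb_mem']
    rwa [Real.norm_eq_abs, abs_of_nonneg (sub_nonneg.2 hbb'), hX2, ← h1] at h2
  have hT1 : |T| ≤ 2 * M * (A * X ^ 2) * X ^ 2 := by
    have h2 := intervalIntegral.norm_integral_le_of_norm_le_const (a := b) (b := b')
      (f := fun t => -primitive g (V t) + p t * V t) (C := 2 * M * (A * X ^ 2)) fun t htm => by
        rw [uIoc_of_le hbb'] at htm
        rw [Real.norm_eq_abs]
        refine (h.abs_potential_le _ _).trans ?_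
        exact mul_le_mul_of_nonneg_left (hVsmall t (Ioc_subset_Icc_self htm)) (by linarith)
    rwa [Real.norm_eq_abs, abs_of_nonneg (sub_nonneg.2 hbb'), hX2] at h2
  have hVb1 : |V b + V' b * X ^ 2| ≤ 2 * M * X ^ 2 * X ^ 2 := by
    have h1 : -(V b + V' b * X ^ 2) = ∫ t in b..b', (V' t - V' b) := by
      rw [intervalIntegral.integral_sub (hV.continuous_deriv.intervalIntegrable _ _)
        intervalIntegrable_const, intervalIntegral.integral_const, smul_eq_mul, ← hX2,
        ← hV.sub_eq_integral, hVb]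
      ring
    have h2 := intervalIntegral.norm_integral_le_of_norm_le_const (a := b) (b := b')
      (f := fun t => V' t - V' b) (C := 2 * M * X ^ 2) fun t htm => by
        rw [uIoc_of_le hbb'] at htm
        exact hV'near t (Ioc_subset_Icc_self htm)
    rwa [Real.norm_eq_abs, abs_of_nonneg (sub_nonneg.2 hbb'), hX2, ← h1, abs_neg] at h2
  have hUV : |U' b * (V b + V' b * X ^ 2)| ≤ A * (2 * M * X ^ 2 * X ^ 2) := by
    rw [abs_mul]
    exact mul_le_mul (hU'le b hb_mem) hVb1 (abs_nonneg _) hA0.le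
  have hWb2 : W' b ^ 2 ≤ C₂ ^ 2 * X ^ 2 := by
    have := sq_le_sq' (abs_le.1 hWbX).1 (abs_le.1 hWbX).2
    rwa [mul_pow] at this
  constructor
  -- Completing the square: to leading order V(b) = -V'(b)X², so U'(b)V(b) + ½V'(b)²X² + ½U'(b)²X²
  -- reduces to ½W'(b)²X², of higher order.
  · have total : action g p a b' v - action g p a b u + 1 / 2 * U' b ^ 2 * (b' - b)
        = U' b * (V b + V' b * X ^ 2) + 1 / 2 * W' b ^ 2 * X ^ 2
          + 1 / 2 * (P - V' b ^ 2 * X ^ 2) + T + 1 / 2 * D - Q := by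
      rw [eU, eV, e1, e5, hwb, hX2]
      simp only [hW']
      ring
    rw [total, hX2]
    have hA4 : A * (2 * M * X ^ 2 * X ^ 2) ≤ A * (2 * M) * X ^ 3 := by
      calc A * (2 * M * X ^ 2 * X ^ 2) = A * (2 * M) * X ^ 4 := by ring
        _ ≤ _ := by gcongr
    have hW4 : 1 / 2 * W' b ^ 2 * X ^ 2 ≤ 1 / 2 * C₂ ^ 2 * X ^ 3 := by
      calc 1 / 2 * W' b ^ 2 * X ^ 2 ≤ 1 / 2 * (C₂ ^ 2 * X ^ 2) * X ^ 2 := by gcongr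
        _ = 1 / 2 * C₂ ^ 2 * X ^ 4 := by ring
        _ ≤ _ := by gcongr
    have hW0 : 0 ≤ 1 / 2 * W' b ^ 2 * X ^ 2 := by positivity
    have hP4 : 1 / 2 * (2 * M * X ^ 2 * (2 * A) * X ^ 2) ≤ 2 * M * A * X ^ 3 := by
      calc 1 / 2 * (2 * M * X ^ 2 * (2 * A) * X ^ 2) = 2 * M * A * X ^ 4 := by ring
        _ ≤ _ := by gcongr
    have hT4 : 2 * M * (A * X ^ 2) * X ^ 2 ≤ 2 * M * A * X ^ 3 := by
      calc 2 * M * (A * X ^ 2) * X ^ 2 = 2 * M * A * X ^ 4 := by ring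
        _ ≤ _ := by gcongr
    have hD4 : 1 / 2 * D + K * R ^ 2 * D ≤ (1 / 2 + K * R ^ 2) * C₃ * X ^ 3 := by
      calc 1 / 2 * D + K * R ^ 2 * D = (1 / 2 + K * R ^ 2) * D := by ring
        _ ≤ (1 / 2 + K * R ^ 2) * (C₃ * X ^ 3) := by gcongr
        _ = _ := by ring
    have hlast : 0 ≤ (2 * M + C₂) * X ^ 3 := by positivity
    have hX3 : X ^ 2 * X = X ^ 3 := by ring
    rw [hX3]
    have hKD : 0 ≤ K * R ^ 2 * D := by positivity
    obtain ⟨b1, b1'⟩ := abs_le.1 hUV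
    obtain ⟨b2, b2'⟩ := abs_le.1 hP1
    obtain ⟨b3, b3'⟩ := abs_le.1 hT1
    rw [abs_le]
    constructor <;> linarith
  · have h1 := hV'near b' ⟨hbb', le_rfl⟩
    have h2 : |V' b' - U' b| ≤ |V' b' - V' b| + |W' b| := by
      have := abs_add_le (V' b' - V' b) (W' b)
      rwa [show V' b' - V' b + W' b = V' b' - U' b by simp only [hW']; ring] at this
    have h3 : 2 * M * X ^ 2 ≤ 2 * M * X := by gcongr
    have h4 : 0 ≤ (A * (2 * M) + 1 / 2 * C₂ ^ 2 + 2 * M * A + 2 * M * A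
      + (1 / 2 + K * R ^ 2) * C₃) * X := by positivity
    linarith

/-- The derivative of the minimal energy with respect to the right end point. -/
theorem hasDerivWithinAt_minEnergy_right (h : ForcedReaction g p m M K) {κ l : ℝ}
    (ht : IsThreshold g p K κ l) {a b : ℝ} (hl : l ≤ b - a) {u U U' F : ℝ → ℝ}
    (hu : IsMinimizer g p 1 a b u) (hU : IsClassicalExtension g p u a b U U' F) :
    HasDerivWithinAt (fun x => minEnergy g p 1 a x) (-(1 / 2 * U' b ^ 2)) (Ici (a + l)) b := by
  have hl1 := ht.one_le
  obtain ⟨C, hC, H⟩ := h.exists_energy_expansion ht (R := b - a + 1) (by linarith)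
  have hM := h.bound_pos
  set A := 2 * M * (b - a + 1) with hA
  have hA0 : 0 ≤ A := by have : 0 ≤ b - a + 1 := by linarith
                         positivity
  refine hasDerivWithinAt_of_rpow_bound (C := C + A * C) fun x hx hxb => ?_
  have hx' : l ≤ x - a := by linarith [mem_Ici.1 hx]
  obtain ⟨v, hv⟩ := h.exists_isMinimizer (show a < x by linarith)
  obtain ⟨V, V', F', hV⟩ := hv.exists_extension h ht hx'
  rw [abs_le] at hxb
  rw [← hu.action_eq_minEnergy, ← hv.action_eq_minEnergy]
  rcases le_total b x with hbx | hxb'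
  · have h1 := (H hl hbx (by linarith) (by linarith) hu hU hv hV).1
    rw [abs_of_nonneg (sub_nonneg.2 hbx)]
    have h2 : 0 ≤ A * C * ((x - b) * √(x - b)) := by
      have := sub_nonneg.2 hbx
      positivity
    calc _ = |action g p a x v - action g p a b u + 1 / 2 * U' b ^ 2 * (x - b)| := by
          congr 1; ring
      _ ≤ _ := by linarith
  -- For x < b the expansion is centred at x; replacing the slope V'(x) by U'(b) uses the second
  -- estimate, with an error of the same order.
  · obtain ⟨h1, h2⟩ := H hx' hxb' (by linarith) (by linarith) hv hV hu hU
    rw [abs_sub_comm x b, abs_of_nonneg (sub_nonneg.2 hxb')]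
    have hbnd : |U' b + V' x| ≤ 2 * A := by
      have h3 := h.abs_deriv_le (by linarith) hU (hU.left_eq_zero (by linarith) hu)
        (hU.right_eq_zero (by linarith) hu) (right_mem_Icc.2 (by linarith))
      have h4 := h.abs_deriv_le (by linarith) hV (hV.left_eq_zero (by linarith) hv)
        (hV.right_eq_zero (by linarith) hv) (right_mem_Icc.2 (by linarith))
      refine (abs_add_le _ _).trans ?_
      have h5 : 2 * M * (b - a) ≤ A := by rw [hA]; gcongr; linarith
      have h6 : 2 * M * (x - a) ≤ A := by rw [hA]; gcongr; linarith
      linarith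
    have h3 : |1 / 2 * (U' b ^ 2 - V' x ^ 2) * (b - x)| ≤ A * C * ((b - x) * √(b - x)) := by
      rw [show 1 / 2 * (U' b ^ 2 - V' x ^ 2) * (b - x)
        = (U' b - V' x) * (U' b + V' x) * (1 / 2 * (b - x)) by ring, abs_mul, abs_mul,
        abs_of_nonneg (by linarith : 0 ≤ 1 / 2 * (b - x))]
      calc _ ≤ C * √(b - x) * (2 * A) * (1 / 2 * (b - x)) := by
            have : 0 ≤ 1 / 2 * (b - x) := by linarith
            gcongr
        _ = _ := by ring
    have h4 := abs_sub (1 / 2 * (U' b ^ 2 - V' x ^ 2) * (b - x))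
      (action g p a b u - action g p a x v + 1 / 2 * V' x ^ 2 * (b - x))
    calc _ = |action g p a b u - action g p a x v + 1 / 2 * V' x ^ 2 * (b - x)
          + 1 / 2 * (U' b ^ 2 - V' x ^ 2) * (b - x)| := by
          rw [← abs_neg]; congr 1; ring
      _ ≤ _ := (abs_add_le _ _).trans (by linarith)

end ForcedReaction

/-! ### Symmetries -/

section Symmetry

variable {g p u : ℝ → ℝ} {σ a b : ℝ}

theorem SobolevOn.comp_neg (hu : SobolevOn u a b) : SobolevOn (fun t => u (-t)) (-b) (-a) := by
  have hd : deriv (fun t => u (-t)) = fun t => -deriv u (-t) := funext fun t => deriv_comp_neg u t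
  have hi : IntervalIntegrable (fun t => -deriv u (-t)) volume (-b) (-a) :=
    ((IntervalIntegrable.iff_comp_neg (f := deriv u)).1 hu.intervalIntegrable_deriv).neg.symm
  refine ⟨?_, ?_⟩
  · have hc : AbsolutelyContinuousOnInterval (fun _ : ℝ => u b) (-b) (-a) :=
      (LipschitzWith.const (u b)).lipschitzOnWith.absolutelyContinuousOnInterval
    refine (hc.add (hi.absolutelyContinuousOnInterval_intervalIntegral
      (c := -b) left_mem_uIcc)).congr fun x hx => ?_
    have hx' : -x ∈ uIcc b a := by
      rw [mem_uIcc] at hx ⊢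
      rcases hx with h | h
      · exact Or.inr ⟨by linarith [h.2], by linarith [h.1]⟩
      · exact Or.inl ⟨by linarith [h.2], by linarith [h.1]⟩
    simp only [Pi.add_apply]
    rw [intervalIntegral.integral_neg, intervalIntegral.integral_comp_neg, neg_neg,
      hu.1.symm.eq_add_integral hx', intervalIntegral.integral_symm]
    ring
  · rw [hd]
    have := ((IntervalIntegrable.iff_comp_neg (f := fun t => deriv u t ^ 2)).1 hu.2).symm
    simpa using this

theorem signedH10_comp_neg (hab : a ≤ b) (hu : u ∈ signedH10 σ a b) :
    (fun t => u (-t)) ∈ signedH10 σ (-b) (-a) := by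
  obtain ⟨h1, h2, h3⟩ := (mem_H10_iff hab).1 hu.1
  refine ⟨(mem_H10_iff (neg_le_neg hab)).2 ⟨h1.comp_neg, by simpa, by simpa⟩, fun t ht => ?_⟩
  exact hu.2 (-t) ⟨by linarith [ht.2], by linarith [ht.1]⟩

theorem action_comp_neg (g p u : ℝ → ℝ) (a b : ℝ) :
    action g (fun t => p (-t)) (-b) (-a) (fun t => u (-t)) = action g p a b u := by
  have := intervalIntegral.integral_comp_neg (a := -b) (b := -a)
    (fun t => 1 / 2 * deriv u t ^ 2 - primitive g (u t) + p t * u t)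
  rw [neg_neg, neg_neg] at this
  unfold action
  rw [← this]
  congr 1
  ext t
  rw [deriv_comp_neg]
  ring

theorem image_action_comp_neg_subset (hab : a ≤ b) : action g p a b '' signedH10 σ a b ⊆
    action g (fun t => p (-t)) (-b) (-a) '' signedH10 σ (-b) (-a) := by
  rintro _ ⟨u, hu, rfl⟩
  exact ⟨_, signedH10_comp_neg hab hu, action_comp_neg g p u a b⟩

theorem minEnergy_comp_neg (hab : a ≤ b) :
    minEnergy g (fun t => p (-t)) σ (-b) (-a) = minEnergy g p σ a b := by
  unfold minEnergy
  congr 1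
  refine Subset.antisymm ?_ (image_action_comp_neg_subset hab)
  have := image_action_comp_neg_subset (g := g) (p := fun t => p (-t)) (σ := σ) (neg_le_neg hab)
  simpa using this

theorem primitive_neg_comp_neg (g : ℝ → ℝ) (s : ℝ) :
    primitive (fun s => -g (-s)) s = primitive g (-s) := by
  unfold primitive
  rw [intervalIntegral.integral_neg, intervalIntegral.integral_comp_neg, neg_zero,
    intervalIntegral.integral_symm, neg_neg]

theorem signedH10_neg (hab : a ≤ b) (hu : u ∈ signedH10 σ a b) :
    (fun t => -u t) ∈ signedH10 (-σ) a b := by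
  obtain ⟨h1, h2, h3⟩ := (mem_H10_iff hab).1 hu.1
  refine ⟨(mem_H10_iff hab).2 ⟨?_, by simpa, by simpa⟩, fun t ht => ?_⟩
  · simpa using h1.const_mul (-1)
  · have := hu.2 t ht
    rwa [neg_mul_neg]

theorem action_neg (g p u : ℝ → ℝ) (a b : ℝ) :
    action (fun s => -g (-s)) (fun t => -p t) a b (fun t => -u t) = action g p a b u := by
  unfold action
  congr 1
  ext t
  rw [primitive_neg_comp_neg, neg_neg, deriv.fun_neg]
  ring

theorem image_action_neg_subset (hab : a ≤ b) : action g p a b '' signedH10 σ a b ⊆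
    action (fun s => -g (-s)) (fun t => -p t) a b '' signedH10 (-σ) a b := by
  rintro _ ⟨u, hu, rfl⟩
  exact ⟨_, signedH10_neg hab hu, action_neg g p u a b⟩

theorem minEnergy_neg (hab : a ≤ b) :
    minEnergy (fun s => -g (-s)) (fun t => -p t) (-σ) a b = minEnergy g p σ a b := by
  unfold minEnergy
  congr 1
  refine Subset.antisymm ?_ (image_action_neg_subset hab)
  have := image_action_neg_subset (g := fun s => -g (-s)) (p := fun t => -p t) (σ := -σ) hab
  simpa using this

theorem IsMinimizer.neg (hab : a ≤ b) (hu : IsMinimizer g p σ a b u) :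
    IsMinimizer (fun s => -g (-s)) (fun t => -p t) (-σ) a b fun t => -u t := by
  refine ⟨signedH10_neg hab hu.1, fun v hv => ?_⟩
  change action _ _ a b _ ≤ action _ _ a b v
  rw [action_neg]
  have h1 := signedH10_neg hab hv
  rw [neg_neg] at h1
  have h2 := hu.le_action h1
  have h3 := action_neg g p (fun t => -v t) a b
  simp only [neg_neg] at h3
  rw [h3]
  exact h2

theorem IsMinimizer.comp_neg (hab : a ≤ b) (hu : IsMinimizer g p σ a b u) :
    IsMinimizer g (fun t => p (-t)) σ (-b) (-a) fun t => u (-t) := by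
  refine ⟨signedH10_comp_neg hab hu.1, fun v hv => ?_⟩
  change action _ _ _ _ _ ≤ action _ _ _ _ v
  rw [action_comp_neg]
  have h1 := signedH10_comp_neg (neg_le_neg hab) hv
  rw [neg_neg, neg_neg] at h1
  have h2 := hu.le_action h1
  have h3 := action_comp_neg g p (fun t => v (-t)) a b
  simp only [neg_neg] at h3
  rw [h3]
  exact h2

theorem IsClassicalExtension.comp_neg {U U' F : ℝ → ℝ}
    (hU : IsClassicalExtension g p u a b U U' F) :
    IsClassicalExtension g (fun t => p (-t)) (fun t => u (-t)) (-b) (-a)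
      (fun t => U (-t)) (fun t => -U' (-t)) (fun t => F (-t)) where
  eqOn := fun t ht => hU.eqOn ⟨by linarith [ht.2], by linarith [ht.1]⟩
  hasDerivAt := fun t => by
    have := (hU.hasDerivAt (-t)).scomp t (hasDerivAt_neg t)
    simpa [Function.comp_def] using this
  hasDerivAt_deriv := fun t => by
    have := ((hU.hasDerivAt_deriv (-t)).scomp t (hasDerivAt_neg t)).fun_neg
    simpa [Function.comp_def] using this
  continuous := hU.continuous.comp continuous_neg
  equation := fun t ht => hU.equation (-t) ⟨by linarith [ht.2], by linarith [ht.1]⟩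

theorem IsMinimizer.congr {v : ℝ → ℝ} (hab : a ≤ b) (hu : IsMinimizer g p σ a b u)
    (h : EqOn u v (Icc a b)) : IsMinimizer g p σ a b v := by
  obtain ⟨h1, h2, h3⟩ := (mem_H10_iff hab).1 hu.1.1
  refine ⟨⟨(mem_H10_iff hab).2 ⟨h1.congr hab h, ?_, ?_⟩, fun t ht => ?_⟩, fun w hw => ?_⟩
  · rw [← h (left_mem_Icc.2 hab), h2]
  · rw [← h (right_mem_Icc.2 hab), h3]
  · rw [← h ht]; exact hu.1.2 t ht
  · change action g p a b v ≤ action g p a b w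
    rw [← action_congr hab h]
    exact hu.le_action hw

end Symmetry

/-- The minimizer `U` of sign `σ` on `[a, b]`, with its equation, its slopes at the end points, and
the resulting derivatives of the minimal energy. -/
structure IsProfile (g p : ℝ → ℝ) (σ κ M l a b : ℝ) (U U' F : ℝ → ℝ) : Prop where
  isMinimizer : IsMinimizer g p σ a b U
  unique : ∀ v, IsMinimizer g p σ a b v → EqOn v U (Icc a b)
  extension : IsClassicalExtension g p U a b U U' F
  pos : ∀ t ∈ Ioo a b, 0 < σ * U t
  left_slope : κ * (b - a) ≤ σ * U' a
  right_slope : σ * U' b ≤ -(κ * (b - a))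
  left_slope_le : |U' a| ≤ 2 * M * (b - a)
  right_slope_le : |U' b| ≤ 2 * M * (b - a)
  deriv_right : HasDerivWithinAt (fun x => minEnergy g p σ a x) (-(1 / 2 * U' b ^ 2))
    (Ici (a + l)) b
  deriv_left : HasDerivWithinAt (fun x => minEnergy g p σ x b) (1 / 2 * U' a ^ 2)
    (Iic (b - l)) a

namespace IsProfile

variable {g p U U' F : ℝ → ℝ} {σ κ M l a b : ℝ}

theorem mono (hU : IsProfile g p σ κ M l a b U U' F) {κ' l' : ℝ} (hab : a ≤ b) (hκ : κ' ≤ κ)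
    (hl : l ≤ l') : IsProfile g p σ κ' M l' a b U U' F where
  isMinimizer := hU.isMinimizer
  unique := hU.unique
  extension := hU.extension
  pos := hU.pos
  left_slope := (mul_le_mul_of_nonneg_right hκ (sub_nonneg.2 hab)).trans hU.left_slope
  right_slope := hU.right_slope.trans
    (neg_le_neg (mul_le_mul_of_nonneg_right hκ (sub_nonneg.2 hab)))
  left_slope_le := hU.left_slope_le
  right_slope_le := hU.right_slope_le
  deriv_right := hU.deriv_right.mono (Ici_subset_Ici.2 (by linarith))
  deriv_left := hU.deriv_left.mono (Iic_subset_Iic.2 (by linarith))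

theorem neg (hU : IsProfile (fun s => -g (-s)) (fun t => -p t) σ κ M l a b U U' F)
    (hl : 0 ≤ l) (hlab : l ≤ b - a) (hab : a ≤ b) : IsProfile g p (-σ) κ M l a b
      (fun t => -U t) (fun t => -U' t) (fun t => -F t) where
  isMinimizer := by simpa using hU.isMinimizer.neg hab
  unique := fun v hv => by
    have h1 := hv.neg hab
    rw [neg_neg] at h1
    intro t ht
    have := hU.unique _ h1 ht
    simp only at this ⊢
    linarith
  extension :=
    { eqOn := fun t _ => rfl
      hasDerivAt := fun t => (hU.extension.hasDerivAt t).fun_neg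
      hasDerivAt_deriv := fun t => (hU.extension.hasDerivAt_deriv t).fun_neg
      continuous := hU.extension.continuous.neg
      equation := fun t ht => by
        have := hU.extension.equation t ht
        rw [this]; ring }
  pos := fun t ht => by
    have := hU.pos t ht
    linarith
  left_slope := by
    have := hU.left_slope
    linarith
  right_slope := by
    have := hU.right_slope
    linarith
  left_slope_le := by rw [abs_neg]; exact hU.left_slope_le
  right_slope_le := by rw [abs_neg]; exact hU.right_slope_le
  deriv_right := by
    rw [neg_sq]
    refine hU.deriv_right.congr (fun x hx => ?_) ?_
    · rw [← minEnergy_neg (by linarith [mem_Ici.1 hx]), neg_neg]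
    · rw [← minEnergy_neg (by linarith), neg_neg]
  deriv_left := by
    rw [neg_sq]
    refine hU.deriv_left.congr (fun x hx => ?_) ?_
    · rw [← minEnergy_neg (by linarith [mem_Iic.1 hx]), neg_neg]
    · rw [← minEnergy_neg (by linarith), neg_neg]

end IsProfile

/-! ### Profiles of both signs, and the energy gained by splitting a long interval. -/

namespace ForcedReaction

variable {g p : ℝ → ℝ} {m M K : ℝ}

/-- Time reversal turns the left end derivative into a right one. The reversed forcing has its own
threshold, of which only the length matters: the growth constant κ is that of the original problem.
-/
theorem exists_profile_one (h : ForcedReaction g p m M K) :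
    ∃ κ l, 0 < κ ∧ 1 ≤ l ∧ ∀ a b, l ≤ b - a →
      ∃ U U' F, IsProfile g p 1 κ M l a b U U' F := by
  obtain ⟨κ, l₁, h₁⟩ := h.exists_isThreshold
  obtain ⟨κ₂, l₂, h₂⟩ := h.comp_neg.exists_isThreshold
  have h₁' := h₁.mono (le_max_left l₁ l₂)
  have h₂' := h₂.mono (le_max_right l₁ l₂)
  set l := max l₁ l₂
  have hl1 := h₁'.one_le
  refine ⟨κ, l, h₁.kappa_pos, hl1, fun a b hab => ?_⟩
  have hlt : a < b := by linarith
  obtain ⟨u, hu⟩ := h.exists_isMinimizer hlt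
  obtain ⟨U, U', F, hU⟩ := hu.exists_extension h h₁' hab
  have hUm := hu.congr hlt.le hU.eqOn
  have hU' : IsClassicalExtension g p U a b U U' F :=
    ⟨fun _ _ => rfl, hU.hasDerivAt, hU.hasDerivAt_deriv, hU.continuous, hU.equation⟩
  have hUa := hUm.left
  have hUb := hUm.right
  obtain ⟨-, hs1, hs2⟩ := h₁'.growth hab hUm hU'
  refine ⟨U, U', F, hUm, fun v hv => h₁'.unique h hab hUm hv, hU', fun t ht => ?_, ?_, ?_, ?_, ?_,
    ?_, ?_⟩
  · rw [one_mul]; exact h₁'.pos hab hUm t ht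
  · rwa [one_mul]
  · rwa [one_mul]
  · exact h.abs_deriv_le hlt hU' hUa hUb (left_mem_Icc.2 hlt.le)
  · exact h.abs_deriv_le hlt hU' hUa hUb (right_mem_Icc.2 hlt.le)
  · exact h.hasDerivWithinAt_minEnergy_right h₁' hab hUm hU'
  · have h3 := h.comp_neg.hasDerivWithinAt_minEnergy_right h₂' (a := -b) (b := -a) (by linarith)
      (hUm.comp_neg hlt.le) hU'.comp_neg
    have h4 := h3.scomp (h := fun x => -x) (h' := -1) (s := Iic (b - l)) a
      (hasDerivAt_neg a).hasDerivWithinAt fun x hx => by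
        rw [mem_Ici]; linarith [mem_Iic.1 hx]
    have h5 : HasDerivWithinAt (fun x => minEnergy g (fun t => p (-t)) 1 (-b) (-x))
        (1 / 2 * U' a ^ 2) (Iic (b - l)) a := by
      convert! h4 using 1
      simp
    refine h5.congr (fun x hx => ?_) ?_
    · rw [minEnergy_comp_neg (by linarith [mem_Iic.1 hx])]
    · rw [minEnergy_comp_neg hlt.le]

theorem exists_profile (h : ForcedReaction g p m M K) :
    ∃ κ l, 0 < κ ∧ 1 ≤ l ∧ ∀ σ : ℝ, σ = 1 ∨ σ = -1 → ∀ a b, l ≤ b - a →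
      ∃ U U' F, IsProfile g p σ κ M l a b U U' F := by
  obtain ⟨κ₁, l₁, hκ₁, hl₁, H₁⟩ := h.exists_profile_one
  obtain ⟨κ₂, l₂, hκ₂, hl₂, H₂⟩ := h.neg_comp_neg.exists_profile_one
  refine ⟨min κ₁ κ₂, max l₁ l₂, lt_min hκ₁ hκ₂, hl₁.trans (le_max_left _ _), ?_⟩
  rintro σ (rfl | rfl) a b hab
  · have hl := (le_max_left l₁ l₂).trans hab
    obtain ⟨U, U', F, hU⟩ := H₁ a b hl
    exact ⟨U, U', F, hU.mono (by linarith) (min_le_left _ _) (le_max_left _ _)⟩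
  · have hl := (le_max_right l₁ l₂).trans hab
    obtain ⟨U, U', F, hU⟩ := H₂ a b hl
    exact ⟨_, _, _, (hU.neg (by linarith) hl (by linarith)).mono (by linarith) (min_le_right _ _)
      (le_max_right _ _)⟩

/-- The minimizers on [a, x] and [y, b], extended by zero between, form a function z that vanishes
at the midpoint. Add the tent on [a, b]: the kinetic cross term is a second difference of z and
vanishes, and superadditivity of G bounds the potential cross term, so the actions at most add up.
-/
theorem minEnergy_one_le_split (h : ForcedReaction g p m M K) {a b x y : ℝ} (hax : a < x)
    (hx : x ≤ (a + b) / 2) (hy : (a + b) / 2 ≤ y) (hyb : y < b) :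
    minEnergy g p 1 a b ≤ minEnergy g p 1 a x + minEnergy g p 1 y b
      + action g p a b (tent a b) := by
  obtain ⟨u, hu⟩ := h.exists_isMinimizer hax
  obtain ⟨v, hv⟩ := h.exists_isMinimizer hyb
  have hxy := hx.trans hy
  have hab : a < b := by linarith
  classical
  set z : ℝ → ℝ := fun t => if t ≤ x then u t else if t < y then 0 else v t with hz
  have e1 : EqOn u z (Icc a x) := fun t ht => by simp [hz, ht.2]
  have e2 : EqOn (fun _ => 0) z (Icc x y) := fun t ht => by
    rcases ht.1.eq_or_lt with rfl | h1
    · simp [hz, hu.right]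
    · rcases ht.2.eq_or_lt with rfl | h2
      · simp [hz, h1.not_ge, hv.left]
      · simp [hz, h1.not_ge, h2]
  have e3 : EqOn v z (Icc y b) := fun t ht => by
    rcases hxy.eq_or_lt with rfl | h1
    · rcases ht.1.eq_or_lt with rfl | h2
      · simp [hz, hu.right, hv.left]
      · simp [hz, h2.not_ge, h2.not_gt]
    · simp [hz, (h1.trans_le ht.1).not_ge, ht.1.not_gt]
  have s1 := (hu.sobolevOn hax.le).congr hax.le e1
  have s2 : SobolevOn z x y := SobolevOn.congr hxy
    (.of_hasDerivAt (fun t => hasDerivAt_const t (0 : ℝ)) continuous_const x y) e2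
  have s3 := (hv.sobolevOn hyb.le).congr hyb.le e3
  have s23 : SobolevOn z x b := .glue hxy hyb.le s2 s3
  have hzs : SobolevOn z a b := .glue hax.le (hxy.trans hyb.le) s1 s23
  have hza : z a = 0 := by rw [← e1 (left_mem_Icc.2 hax.le), hu.left]
  have hzb : z b = 0 := by rw [← e3 (right_mem_Icc.2 hyb.le), hv.right]
  have hzm : z ((a + b) / 2) = 0 := (e2 ⟨hx, hy⟩).symm
  have hz0 : ∀ t ∈ Icc a b, 0 ≤ z t := by
    intro t ht
    rcases le_total t x with h1 | h1
    · rw [← e1 ⟨ht.1, h1⟩]; exact hu.nonneg ⟨ht.1, h1⟩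
    · rcases le_total t y with h2 | h2
      · rw [← e2 ⟨h1, h2⟩]
      · rw [← e3 ⟨h2, ht.2⟩]; exact hv.nonneg ⟨h2, ht.2⟩
  have ha : action g p a b z = minEnergy g p 1 a x + minEnergy g p 1 y b := by
    rw [← action_add_adjacent h.reaction h.continuous hax.le (hxy.trans hyb.le) hzs,
      ← action_add_adjacent h.reaction h.continuous hxy hyb.le s23, ← action_congr hax.le e1,
      ← action_congr hxy e2, ← action_congr hyb.le e3, hu.action_eq_minEnergy,
      hv.action_eq_minEnergy, action_zero, zero_add]
  set w := tent a b with hw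
  have hws : SobolevOn w a b := tent_sobolevOn a b a b
  have hwc : Continuous w := tent_continuous a b
  have hmem : (fun t => z t + w t) ∈ signedH10 1 a b := by
    refine ⟨(mem_H10_iff hab.le).2 ⟨hzs.add hws, ?_, ?_⟩, fun t ht => ?_⟩
    · simp [hza, hw, tent_left]
    · simp [hzb, hw, tent_right]
    · rw [one_mul]; exact add_nonneg (hz0 t ht) (tent_nonneg _ _ _)
  have h1 : minEnergy g p 1 a b ≤ action g p a b fun t => z t + w t :=
    csInf_le ⟨_, h.bddBelow_action hab⟩ (mem_image_of_mem _ hmem)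
  rw [action_add h.reaction h.continuous hab.le hzs hws, ha,
    hzs.integral_deriv_mul_deriv_tent hab.le, hza, hzb, hzm] at h1
  rw [action_eq h.reaction h.continuous hab.le hws]
  have hzc := hzs.continuousOn hab.le
  have hG := h.reaction.continuous_primitive
  have hgc := h.reaction.continuous
  have hpc := h.continuous
  have i1 : IntervalIntegrable (fun t => (p t - g (z t)) * w t) volume a b := by
    apply ContinuousOn.intervalIntegrable; rw [uIcc_of_le hab.le]; fun_prop
  have i2 : IntervalIntegrable
      (fun t => primitive g (z t + w t) - primitive g (z t) - g (z t) * w t) volume a b := by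
    apply ContinuousOn.intervalIntegrable; rw [uIcc_of_le hab.le]; fun_prop
  have h2 : (∫ t in a..b, (p t - g (z t)) * w t)
      - ∫ t in a..b, (primitive g (z t + w t) - primitive g (z t) - g (z t) * w t)
      ≤ ∫ t in a..b, (-primitive g (w t) + p t * w t) := by
    rw [← intervalIntegral.integral_sub i1 i2]
    refine intervalIntegral.integral_mono_on hab.le (i1.sub i2)
      (potential_integrable h.reaction h.continuous hab.le hwc.continuousOn) fun t ht => ?_
    have := h.reaction.primitive_superadditive (hz0 t ht) (tent_nonneg a b t)
    rw [← hw] at this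
    linarith
  linarith

theorem exists_split_gain (h : ForcedReaction g p m M K) :
    ∃ c C : ℝ, 0 < c ∧ 0 ≤ C ∧ ∀ σ : ℝ, σ = 1 ∨ σ = -1 → ∀ {a b x y : ℝ}, a < x →
      x ≤ (a + b) / 2 → (a + b) / 2 ≤ y → y < b →
      minEnergy g p σ a b ≤ minEnergy g p σ a x + minEnergy g p σ y b
        + (C * (b - a) - c * (b - a) ^ 2) := by
  obtain ⟨c₁, C₁, hc₁, hC₁, H₁⟩ := h.exists_action_tent_le
  obtain ⟨c₂, C₂, hc₂, hC₂, H₂⟩ := h.neg_comp_neg.exists_action_tent_le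
  refine ⟨min c₁ c₂, max C₁ C₂, lt_min hc₁ hc₂, hC₁.trans (le_max_left _ _), ?_⟩
  rintro σ (rfl | rfl) a b x y hax hx hy hyb
  · have h1 := h.minEnergy_one_le_split hax hx hy hyb
    have h2 := H₁ a b (by linarith)
    have h3 : C₁ * (b - a) ≤ max C₁ C₂ * (b - a) :=
      mul_le_mul_of_nonneg_right (le_max_left _ _) (by linarith)
    have h4 : min c₁ c₂ * (b - a) ^ 2 ≤ c₁ * (b - a) ^ 2 :=
      mul_le_mul_of_nonneg_right (min_le_left _ _) (sq_nonneg _)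
    linarith
  · have h1 := h.neg_comp_neg.minEnergy_one_le_split hax hx hy hyb
    have h2 := H₂ a b (by linarith)
    have h3 : C₂ * (b - a) ≤ max C₁ C₂ * (b - a) :=
      mul_le_mul_of_nonneg_right (le_max_right _ _) (by linarith)
    have h4 : min c₁ c₂ * (b - a) ^ 2 ≤ c₂ * (b - a) ^ 2 :=
      mul_le_mul_of_nonneg_right (min_le_right _ _) (sq_nonneg _)
    rw [← minEnergy_neg (by linarith : a ≤ b), ← minEnergy_neg hax.le, ← minEnergy_neg hyb.le,
      neg_neg]
    linarith

end ForcedReaction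

/-! ### Gluing classical solutions -/

theorem hasDerivAt_ite_le {f f₁ d d₁ : ℝ → ℝ} {c : ℝ} (hf : ∀ t, HasDerivAt f (d t) t)
    (hf₁ : ∀ t, HasDerivAt f₁ (d₁ t) t) (h : f c = f₁ c) (hd : d c = d₁ c) (t : ℝ) :
    HasDerivAt (fun t => if t ≤ c then f t else f₁ t) (if t ≤ c then d t else d₁ t) t := by
  rcases lt_trichotomy t c with ht | rfl | ht
  · rw [if_pos ht.le]
    refine (hf t).congr_of_eventuallyEq ?_
    filter_upwards [Iio_mem_nhds ht] with s hs
    rw [if_pos (mem_Iio.1 hs).le]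
  · rw [if_pos le_rfl, ← hasDerivWithinAt_univ, ← Iic_union_Ici (a := t)]
    refine HasDerivWithinAt.union ?_ ?_
    · refine (hf t).hasDerivWithinAt.congr (fun s hs => if_pos hs) (if_pos le_rfl)
    · rw [hd]
      refine (hf₁ t).hasDerivWithinAt.congr (fun s hs => ?_) ?_
      · rcases (mem_Ici.1 hs).eq_or_lt with rfl | h1
        · simpa
        · rw [if_neg h1.not_ge]
      · simpa
  · rw [if_neg ht.not_ge]
    refine (hf₁ t).congr_of_eventuallyEq ?_
    filter_upwards [Ioi_mem_nhds ht] with s hs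
    rw [if_neg (not_le.2 hs)]

namespace IsClassicalExtension

variable {g p u U U' F V V' E : ℝ → ℝ} {a b c : ℝ}

/-- Matching slopes suffice: the equation gives both second derivatives the value p(b) - g(u(b)) at
the node. -/
theorem glue (hab : a ≤ b) (hbc : b ≤ c) (hU : IsClassicalExtension g p u a b U U' F)
    (hV : IsClassicalExtension g p u b c V V' E) (hb : U' b = V' b) :
    IsClassicalExtension g p u a c (fun t => if t ≤ b then U t else V t)
      (fun t => if t ≤ b then U' t else V' t) (fun t => if t ≤ b then F t else E t) where
  eqOn := fun t ht => by
    simp only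
    split_ifs with h
    · exact hU.eqOn ⟨ht.1, h⟩
    · exact hV.eqOn ⟨(not_le.1 h).le, ht.2⟩
  hasDerivAt := hasDerivAt_ite_le hU.hasDerivAt hV.hasDerivAt
    (by rw [← hU.eqOn (right_mem_Icc.2 hab), hV.eqOn (left_mem_Icc.2 hbc)]) hb
  hasDerivAt_deriv := hasDerivAt_ite_le hU.hasDerivAt_deriv hV.hasDerivAt_deriv hb
    (by rw [hU.equation b (right_mem_Icc.2 hab), hV.equation b (left_mem_Icc.2 hbc),
      ← hU.eqOn (right_mem_Icc.2 hab), hV.eqOn (left_mem_Icc.2 hbc)])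
  continuous := Continuous.if_le hU.continuous hV.continuous continuous_id continuous_const
    fun t ht => by
      rw [show t = b from ht, hU.equation b (right_mem_Icc.2 hab), hV.equation b (left_mem_Icc.2 hbc),
        ← hU.eqOn (right_mem_Icc.2 hab), hV.eqOn (left_mem_Icc.2 hbc)]
  equation := fun t ht => by
    split_ifs with h
    · exact hU.equation t ⟨ht.1, h⟩
    · exact hV.equation t ⟨(not_le.1 h).le, ht.2⟩

theorem isSolutionOn (hU : IsClassicalExtension g p u a b U U' F) : IsSolutionOn g p a b u := by
  have h2 : deriv U' = F := funext fun t => (hU.hasDerivAt_deriv t).deriv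
  have hc : ContDiff ℝ 2 U := by
    rw [show (2 : WithTop ℕ∞) = 1 + 1 by norm_num, contDiff_succ_iff_deriv, hU.deriv_eq,
      contDiff_one_iff_deriv, h2]
    exact ⟨fun t => (hU.hasDerivAt t).differentiableAt, by simp,
      fun t => (hU.hasDerivAt_deriv t).differentiableAt, hU.continuous⟩
  refine ⟨hc.contDiffOn.congr fun t ht => hU.eqOn (Ioo_subset_Icc_self ht), fun t ht => ?_⟩
  have he : u =ᶠ[𝓝 t] U := by
    filter_upwards [Ioo_mem_nhds ht.1 ht.2] with s hs using hU.eqOn (Ioo_subset_Icc_self hs)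
  rw [he.deriv.deriv_eq, hU.deriv_eq, h2, he.eq_of_nhds,
    hU.equation t (Ioo_subset_Icc_self ht)]
  ring

end IsClassicalExtension

/-! ### One-sided derivatives at a maximum -/

theorem HasDerivWithinAt.nonpos_of_isMaxOn_Icc_left {f : ℝ → ℝ} {d a b : ℝ} (hab : a < b)
    (hf : HasDerivWithinAt f d (Icc a b) a) (h : ∀ x ∈ Icc a b, f x ≤ f a) : d ≤ 0 := by
  have h1 : Tendsto (slope f a) (𝓝[>] a) (𝓝 d) := by
    have h2 := hf.mono Ioc_subset_Icc_self
    rw [hasDerivWithinAt_iff_tendsto_slope' (by simp)] at h2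
    rwa [nhdsWithin_Ioc_eq_nhdsGT hab] at h2
  refine le_of_tendsto h1 ?_
  filter_upwards [Ioc_mem_nhdsGT hab] with x hx
  rw [slope_def_field]
  exact div_nonpos_of_nonpos_of_nonneg (sub_nonpos.2 (h x ⟨hx.1.le, hx.2⟩)) (sub_nonneg.2 hx.1.le)

theorem HasDerivWithinAt.nonneg_of_isMaxOn_Icc_right {f : ℝ → ℝ} {d a b : ℝ} (hab : a < b)
    (hf : HasDerivWithinAt f d (Icc a b) b) (h : ∀ x ∈ Icc a b, f x ≤ f b) : 0 ≤ d := by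
  have h1 : Tendsto (slope f b) (𝓝[<] b) (𝓝 d) := by
    have h2 := hf.mono Ico_subset_Icc_self
    rw [hasDerivWithinAt_iff_tendsto_slope' (by simp)] at h2
    rwa [nhdsWithin_Ico_eq_nhdsLT hab] at h2
  refine ge_of_tendsto h1 ?_
  filter_upwards [Ico_mem_nhdsLT hab] with x hx
  rw [slope_def_field]
  exact div_nonneg_of_nonpos (sub_nonpos.2 (h x ⟨hx.1, hx.2.le⟩)) (sub_nonpos.2 hx.2.le)

/-! ### Maximizing paths -/

/-- The sign of the `n`-th interval of a path. -/
noncomputable def pathSign (n : ℕ) : ℝ := if Even n then 1 else -1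

theorem pathSign_eq (n : ℕ) : pathSign n = 1 ∨ pathSign n = -1 := by
  unfold pathSign; split_ifs <;> simp

theorem pathSign_succ (n : ℕ) : pathSign (n + 1) = -pathSign n := by
  unfold pathSign
  by_cases h : Even n <;> simp [Nat.even_add_one, h]

theorem pathSign_add_two (n : ℕ) : pathSign (n + 2) = pathSign n := by
  rw [pathSign_succ, pathSign_succ, neg_neg]

/-- The admissible partitions, indexed by the natural numbers. -/
structure IsPath (L A B : ℝ) (k : ℕ) (T : ℕ → ℝ) : Prop where
  left : T 0 = A
  right : T (k + 1) = B
  le_sub : ∀ n ≤ k, L ≤ T (n + 1) - T n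

/-- The energy of the `n`-th interval of a path. -/
noncomputable def stepEnergy (g p : ℝ → ℝ) (T : ℕ → ℝ) (n : ℕ) : ℝ :=
  minEnergy g p (pathSign n) (T n) (T (n + 1))

structure IsMaximizingPath (g p : ℝ → ℝ) (L A B : ℝ) (k : ℕ) (T : ℕ → ℝ) : Prop
    extends IsPath L A B k T where
  le : ∀ S, IsPath L A B k S → ∑ n ∈ Finset.range (k + 1), stepEnergy g p S n
    ≤ ∑ n ∈ Finset.range (k + 1), stepEnergy g p T n

/-- Moving one interior node alters only the two adjacent summands. -/
theorem IsMaximizingPath.local_le {g p : ℝ → ℝ} {L A B : ℝ} {k n : ℕ} {T : ℕ → ℝ}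
    (hT : IsMaximizingPath g p L A B k T) (hn : n + 1 ≤ k) {x : ℝ} (h1 : T n + L ≤ x)
    (h2 : x ≤ T (n + 2) - L) :
    minEnergy g p (pathSign n) (T n) x + minEnergy g p (pathSign (n + 1)) x (T (n + 2))
      ≤ stepEnergy g p T n + stepEnergy g p T (n + 1) := by
  set S := Function.update T (n + 1) x with hS
  have hSn : ∀ i, i ≠ n + 1 → S i = T i := fun i hi => by simp [hS, hi]
  have hSx : S (n + 1) = x := by simp [hS]
  have hpath : IsPath L A B k S := by
    refine ⟨?_, ?_, fun i hi => ?_⟩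
    · rw [hSn 0 (by omega), hT.left]
    · rw [hSn _ (by omega), hT.right]
    · rcases eq_or_ne i n with rfl | h3
      · rw [hSx, hSn i (by omega)]; linarith
      · rcases eq_or_ne i (n + 1) with rfl | h4
        · rw [hSx, hSn (n + 1 + 1) (by omega)]; linarith
        · rw [hSn _ (by omega), hSn _ h4]; exact hT.le_sub i hi
  have h3 := hT.le S hpath
  rw [← sub_nonneg, ← Finset.sum_sub_distrib, Finset.sum_eq_add n (n + 1) (by omega)] at h3
  · have e1 : stepEnergy g p S n = minEnergy g p (pathSign n) (T n) x := by
      rw [stepEnergy, hSx, hSn n (by omega)]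
    have e2 : stepEnergy g p S (n + 1) = minEnergy g p (pathSign (n + 1)) x (T (n + 2)) := by
      rw [stepEnergy, hSx, hSn (n + 1 + 1) (by omega)]
    rw [e1, e2] at h3
    linarith
  · intro c _ hc
    rw [stepEnergy, stepEnergy, hSn c hc.2, hSn (c + 1) (by omega), sub_self]
  · intro h; exact absurd (Finset.mem_range.2 (by omega)) h
  · intro h; exact absurd (Finset.mem_range.2 (by omega)) h

/-- Comparison of two sums that agree up to a shift by two in the middle. -/
theorem sum_range_sub_sum_range_of_shift {f f₁ : ℕ → ℝ} {a d e : ℕ} (h1 : ∀ i < a, f i = f₁ i)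
    (h2 : ∀ i < d, f (a + (i + 3)) = f₁ (a + (i + 1)))
    (h3 : ∀ i < e, f (a + (d + 4) + i) = f₁ (a + (d + 4) + i)) :
    ∑ i ∈ Finset.range (a + (d + 4) + e), f i - ∑ i ∈ Finset.range (a + (d + 4) + e), f₁ i
      = (f a + f (a + 1) + f (a + 2) + f (a + (d + 3)))
        - (f₁ a + f₁ (a + (d + 1)) + f₁ (a + (d + 2)) + f₁ (a + (d + 3))) := by
  have e1 : ∑ x ∈ Finset.range a, f x = ∑ x ∈ Finset.range a, f₁ x :=
    Finset.sum_congr rfl fun i hi => h1 i (Finset.mem_range.1 hi)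
  have e2 : ∑ i ∈ Finset.range d, f (a + (i + 3)) = ∑ i ∈ Finset.range d, f₁ (a + (i + 1)) :=
    Finset.sum_congr rfl fun i hi => h2 i (Finset.mem_range.1 hi)
  have e3 : ∑ x ∈ Finset.range e, f (a + (d + 4) + x)
      = ∑ x ∈ Finset.range e, f₁ (a + (d + 4) + x) :=
    Finset.sum_congr rfl fun i hi => h3 i (Finset.mem_range.1 hi)
  have m1 : ∑ x ∈ Finset.range (d + 4), f (a + x) = ∑ i ∈ Finset.range d, f (a + (i + 3))
      + f (a + 2) + f (a + 1) + f a + f (a + (d + 3)) := by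
    rw [Finset.sum_range_succ, Finset.sum_range_succ', Finset.sum_range_succ',
      Finset.sum_range_succ']
    simp [add_assoc]
  have m2 : ∑ x ∈ Finset.range (d + 4), f₁ (a + x) = ∑ i ∈ Finset.range d, f₁ (a + (i + 1))
      + f₁ a + f₁ (a + (d + 1)) + f₁ (a + (d + 2)) + f₁ (a + (d + 3)) := by
    rw [Finset.sum_range_succ, Finset.sum_range_succ, Finset.sum_range_succ,
      Finset.sum_range_succ']
    simp
  rw [Finset.sum_range_add _ (a + (d + 4)), Finset.sum_range_add _ (a + (d + 4)),
    Finset.sum_range_add _ a, Finset.sum_range_add _ a, m1, m2, e1, e2, e3]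
  ring

/-! ### Surgery on partitions: merge three steps, split another into three. -/

namespace IsMaximizingPath

variable {g p : ℝ → ℝ} {L A B x y : ℝ} {k : ℕ} {T : ℕ → ℝ}

/-- The competitor drops the nodes j + 1 and j + 2 and inserts x < y in the later step j + d + 3.
The number of steps is unchanged, and the steps in between are renumbered by two, so they keep their
signs and energies. -/
theorem merge_split_right_le (hT : IsMaximizingPath g p L A B k T) (hL : 0 < L) {j d e : ℕ}
    (hk : k + 1 = j + (d + 4) + e) (hx : L ≤ x - T (j + (d + 3))) (hxy : L ≤ y - x)
    (hy : L ≤ T (j + (d + 4)) - y) :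
    minEnergy g p (pathSign j) (T j) (T (j + 3))
        + minEnergy g p (pathSign (j + (d + 3))) (T (j + (d + 3))) x
        + minEnergy g p (pathSign (j + (d + 4))) x y
        + minEnergy g p (pathSign (j + (d + 3))) y (T (j + (d + 4)))
      ≤ stepEnergy g p T j + stepEnergy g p T (j + 1) + stepEnergy g p T (j + 2)
        + stepEnergy g p T (j + (d + 3)) := by
  set S : ℕ → ℝ := fun i => if i ≤ j then T i else if i ≤ j + (d + 1) then T (i + 2) else
    if i = j + (d + 2) then x else if i = j + (d + 3) then y else T i with hS
  have s1 : ∀ i ≤ j, S i = T i := fun i hi => if_pos hi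
  have s2 : ∀ i ≤ d, S (j + (i + 1)) = T (j + (i + 3)) := fun i hi => by
    simp only [hS]
    rw [if_neg (by omega), if_pos (by omega)]
    rfl
  have s3 : S (j + (d + 2)) = x := by
    simp only [hS]
    rw [if_neg (by omega), if_neg (by omega), if_pos trivial]
  have s4 : S (j + (d + 3)) = y := by
    simp only [hS]
    rw [if_neg (by omega), if_neg (by omega), if_neg (by omega), if_pos trivial]
  have s5 : ∀ i, S (j + (d + 4) + i) = T (j + (d + 4) + i) := fun i => by
    simp only [hS]
    rw [if_neg (by omega), if_neg (by omega), if_neg (by omega), if_neg (by omega)]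
  have hpath : IsPath L A B k S := by
    refine ⟨?_, ?_, fun i hi => ?_⟩
    · rw [s1 0 (by omega), hT.left]
    · rw [hk, s5, ← hk, hT.right]
    · rcases lt_trichotomy i j with h1 | rfl | h1
      · rw [s1 _ (by omega), s1 _ (by omega)]; exact hT.le_sub i hi
      · rw [s2 0 (by omega), s1 i le_rfl]
        have l1 := hT.le_sub i (by omega)
        have l2 := hT.le_sub (i + 1) (by omega)
        have l3 : L ≤ T (i + 3) - T (i + 1 + 1) := hT.le_sub (i + 2) (by omega)
        simp only [Nat.zero_add]
        linarith
      · rcases lt_or_ge i (j + (d + 1)) with h2 | h2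
        · obtain ⟨i, rfl⟩ : ∃ i', i = j + (i' + 1) := ⟨i - j - 1, by omega⟩
          rw [s2 i (by omega), show j + (i + 1) + 1 = j + (i + 1 + 1) from rfl,
            s2 (i + 1) (by omega)]
          exact hT.le_sub (j + (i + 3)) (by omega)
        · obtain ⟨i, rfl⟩ : ∃ i', i = j + (d + 1) + i' := ⟨i - (j + (d + 1)), by omega⟩
          match i with
          | 0 =>
            rw [show S (j + (d + 1) + 0 + 1) = x from s3,
              show S (j + (d + 1) + 0) = _ from s2 d le_rfl]
            exact hx
          | 1 =>
            rw [show S (j + (d + 1) + 1 + 1) = y from s4, show S (j + (d + 1) + 1) = x from s3]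
            exact hxy
          | 2 =>
            rw [show S (j + (d + 1) + 2 + 1) = _ from s5 0, show S (j + (d + 1) + 2) = y from s4]
            exact hy
          | i + 3 =>
            rw [show j + (d + 1) + (i + 3) = j + (d + 4) + i by omega, add_assoc, s5, s5]
            exact hT.le_sub (j + (d + 4) + i) (by omega)
  have h1 := hT.le S hpath
  rw [← sub_nonneg, hk, sum_range_sub_sum_range_of_shift] at h1
  · have e1 : stepEnergy g p S j = minEnergy g p (pathSign j) (T j) (T (j + 3)) := by
      rw [stepEnergy, s1 j le_rfl, show S (j + 1) = _ from s2 0 (by omega)]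
    have e2 : stepEnergy g p S (j + (d + 1))
        = minEnergy g p (pathSign (j + (d + 3))) (T (j + (d + 3))) x := by
      rw [stepEnergy, s2 d le_rfl, show S (j + (d + 1) + 1) = x from s3]
      exact congrArg (minEnergy g p · _ _) (pathSign_add_two _).symm
    have e3 : stepEnergy g p S (j + (d + 2)) = minEnergy g p (pathSign (j + (d + 4))) x y := by
      rw [stepEnergy, s3, show S (j + (d + 2) + 1) = y from s4]
      exact congrArg (minEnergy g p · _ _) (pathSign_add_two _).symm
    have e4 : stepEnergy g p S (j + (d + 3))
        = minEnergy g p (pathSign (j + (d + 3))) y (T (j + (d + 4))) := by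
      rw [stepEnergy, s4, show S (j + (d + 3) + 1) = _ from s5 0]
      rfl
    rw [e1, e2, e3, e4] at h1
    linarith
  · intro i hi
    rw [stepEnergy, stepEnergy, s1 i (by omega), s1 (i + 1) (by omega)]
  · intro i hi
    rw [stepEnergy, stepEnergy, s2 i hi.le, show S (j + (i + 1) + 1) = _ from s2 (i + 1) hi]
    exact congrArg (minEnergy g p · _ _) (pathSign_add_two _)
  · intro i hi
    rw [stepEnergy, stepEnergy, s5, show S (j + (d + 4) + i + 1) = _ from s5 (i + 1)]
    rfl

/-- The mirror case, where the split step n precedes the merged ones and the steps in between move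
up by two. -/
theorem merge_split_left_le (hT : IsMaximizingPath g p L A B k T) (hL : 0 < L) {n d e : ℕ}
    (hk : k + 1 = n + (d + 4) + e) (hx : L ≤ x - T n) (hxy : L ≤ y - x)
    (hy : L ≤ T (n + 1) - y) :
    minEnergy g p (pathSign (n + (d + 1))) (T (n + (d + 1))) (T (n + (d + 4)))
        + minEnergy g p (pathSign n) (T n) x + minEnergy g p (pathSign (n + 1)) x y
        + minEnergy g p (pathSign n) y (T (n + 1))
      ≤ stepEnergy g p T (n + (d + 1)) + stepEnergy g p T (n + (d + 2))
        + stepEnergy g p T (n + (d + 3)) + stepEnergy g p T n := by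
  set S : ℕ → ℝ := fun i => if i ≤ n then T i else if i = n + 1 then x else
    if i = n + 2 then y else if i ≤ n + (d + 3) then T (i - 2) else T i with hS
  have s1 : ∀ i ≤ n, S i = T i := fun i hi => if_pos hi
  have s2 : S (n + 1) = x := by
    simp only [hS]
    rw [if_neg (by omega), if_pos trivial]
  have s3 : S (n + 2) = y := by
    simp only [hS]
    rw [if_neg (by omega), if_neg (by omega), if_pos trivial]
  have s4 : ∀ i ≤ d, S (n + (i + 3)) = T (n + (i + 1)) := fun i hi => by
    simp only [hS]
    rw [if_neg (by omega), if_neg (by omega), if_neg (by omega), if_pos (by omega)]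
    rfl
  have s5 : ∀ i, S (n + (d + 4) + i) = T (n + (d + 4) + i) := fun i => by
    simp only [hS]
    rw [if_neg (by omega), if_neg (by omega), if_neg (by omega), if_neg (by omega)]
  have hpath : IsPath L A B k S := by
    refine ⟨?_, ?_, fun i hi => ?_⟩
    · rw [s1 0 (by omega), hT.left]
    · rw [hk, s5, ← hk, hT.right]
    · rcases lt_or_ge i n with h1 | h1
      · rw [s1 _ (by omega), s1 _ (by omega)]; exact hT.le_sub i hi
      · obtain ⟨i, rfl⟩ : ∃ i', i = n + i' := ⟨i - n, by omega⟩
        match i with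
        | 0 =>
          rw [show S (n + 0 + 1) = x from s2, show S (n + 0) = _ from s1 n le_rfl]
          exact hx
        | 1 =>
          rw [show S (n + 1 + 1) = y from s3, s2]
          exact hxy
        | 2 =>
          rw [show S (n + 2 + 1) = _ from s4 0 (by omega), s3]
          exact hy
        | i + 3 =>
          rcases lt_trichotomy i d with h2 | rfl | h2
          · rw [s4 i h2.le, show S (n + (i + 3) + 1) = _ from s4 (i + 1) h2]
            exact hT.le_sub (n + (i + 1)) (by omega)
          · rw [s4 i le_rfl, show S (n + (i + 3) + 1) = _ from s5 0]
            have l1 : L ≤ T (n + (i + 2)) - T (n + (i + 1)) := hT.le_sub (n + (i + 1)) (by omega)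
            have l2 : L ≤ T (n + (i + 3)) - T (n + (i + 2)) := hT.le_sub (n + (i + 2)) (by omega)
            have l3 : L ≤ T (n + (i + 4) + 0) - T (n + (i + 3)) := hT.le_sub (n + (i + 3)) (by omega)
            linarith
          · obtain ⟨i, rfl⟩ : ∃ i', i = d + (i' + 1) := ⟨i - d - 1, by omega⟩
            rw [show n + (d + (i + 1) + 3) = n + (d + 4) + i by omega, add_assoc, s5, s5]
            exact hT.le_sub (n + (d + 4) + i) (by omega)
  have h1 := hT.le S hpath
  rw [← sub_nonpos, hk, sum_range_sub_sum_range_of_shift] at h1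
  · have e1 : stepEnergy g p S n = minEnergy g p (pathSign n) (T n) x := by
      rw [stepEnergy, s1 n le_rfl, s2]
    have e2 : stepEnergy g p S (n + 1) = minEnergy g p (pathSign (n + 1)) x y := by
      rw [stepEnergy, s2, show S (n + 1 + 1) = y from s3]
    have e3 : stepEnergy g p S (n + 2) = minEnergy g p (pathSign n) y (T (n + 1)) := by
      rw [stepEnergy, s3, show S (n + 2 + 1) = _ from s4 0 (by omega), pathSign_add_two]
    have e4 : stepEnergy g p S (n + (d + 3))
        = minEnergy g p (pathSign (n + (d + 1))) (T (n + (d + 1))) (T (n + (d + 4))) := by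
      rw [stepEnergy, s4 d le_rfl, show S (n + (d + 3) + 1) = _ from s5 0]
      exact congrArg (minEnergy g p · _ _) (pathSign_add_two _)
    rw [e1, e2, e3, e4] at h1
    linarith
  · intro i hi
    rw [stepEnergy, stepEnergy, s1 i (by omega), s1 (i + 1) (by omega)]
  · intro i hi
    rw [stepEnergy, stepEnergy, s4 i hi.le, show S (n + (i + 3) + 1) = _ from s4 (i + 1) hi]
    exact congrArg (minEnergy g p · _ _) (pathSign_add_two _)
  · intro i hi
    rw [stepEnergy, stepEnergy, s5, show S (n + (d + 4) + i + 1) = _ from s5 (i + 1)]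
    rfl

end IsMaximizingPath

/-! ### Slope comparison at the nodes and comparability of neighbouring lengths. -/

section Slopes

variable {g p U U' F V V' E : ℝ → ℝ} {κ M l L A B : ℝ} {k n : ℕ} {T : ℕ → ℝ}

theorem IsMaximizingPath.hasDerivWithinAt_Icc
    (hlL : l ≤ L) (hU : IsProfile g p (pathSign n) κ M l (T n) (T (n + 1)) U U' F)
    (hV : IsProfile g p (pathSign (n + 1)) κ M l (T (n + 1)) (T (n + 2)) V V' E) :
    HasDerivWithinAt (fun x => minEnergy g p (pathSign n) (T n) x
      + minEnergy g p (pathSign (n + 1)) x (T (n + 2)))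
      (-(1 / 2 * U' (T (n + 1)) ^ 2) + 1 / 2 * V' (T (n + 1)) ^ 2)
      (Icc (T n + L) (T (n + 2) - L)) (T (n + 1)) :=
  (hU.deriv_right.mono fun x hx => by rw [mem_Ici]; linarith [hx.1]).fun_add
    (hV.deriv_left.mono fun x hx => by rw [mem_Iic]; linarith [hx.2])

/-- If the step after the node is longer than L, the node may move to the right, and the one-sided
derivative of the energy there is nonpositive. Equality of the slopes needs room on both sides. -/
theorem IsMaximizingPath.left_slope_sq_le (hT : IsMaximizingPath g p L A B k T) (hn : n + 1 ≤ k)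
    (hlL : l ≤ L) (hU : IsProfile g p (pathSign n) κ M l (T n) (T (n + 1)) U U' F)
    (hV : IsProfile g p (pathSign (n + 1)) κ M l (T (n + 1)) (T (n + 2)) V V' E)
    (hlt : L < T (n + 2) - T (n + 1)) : V' (T (n + 1)) ^ 2 ≤ U' (T (n + 1)) ^ 2 := by
  have h0 := hT.le_sub n (by omega)
  have h1 := (IsMaximizingPath.hasDerivWithinAt_Icc hlL hU hV).mono
    (Icc_subset_Icc_left (by linarith : T n + L ≤ T (n + 1)))
  have h2 := h1.nonpos_of_isMaxOn_Icc_left (by linarith) fun x hx =>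
    hT.local_le hn (by linarith [hx.1]) hx.2
  linarith

theorem IsMaximizingPath.right_slope_sq_le (hT : IsMaximizingPath g p L A B k T) (hn : n + 1 ≤ k)
    (hlL : l ≤ L) (hU : IsProfile g p (pathSign n) κ M l (T n) (T (n + 1)) U U' F)
    (hV : IsProfile g p (pathSign (n + 1)) κ M l (T (n + 1)) (T (n + 2)) V V' E)
    (hlt : L < T (n + 1) - T n) : U' (T (n + 1)) ^ 2 ≤ V' (T (n + 1)) ^ 2 := by
  have h0 : L ≤ T (n + 2) - T (n + 1) := hT.le_sub (n + 1) hn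
  have h1 := (IsMaximizingPath.hasDerivWithinAt_Icc hlL hU hV).mono
    (Icc_subset_Icc_right (by linarith : T (n + 1) ≤ T (n + 2) - L))
  have h2 := h1.nonneg_of_isMaxOn_Icc_right (by linarith) fun x hx =>
    hT.local_le hn hx.1 (by linarith [hx.2])
  linarith

theorem abs_pathSign_mul (n : ℕ) (x : ℝ) : |pathSign n * x| = |x| := by
  rcases pathSign_eq n with h | h <;> simp [h]

variable {q R : ℝ}

/-- If the next step exceeds L, then κ times its length is at most its slope at the node, which is
at most the slope of the current step, itself at most 2M times the current length. -/
theorem IsMaximizingPath.next_length_le (hT : IsMaximizingPath g p L A B k T) (hn : n + 1 ≤ k)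
    (hlL : l ≤ L) (hL : 0 ≤ L) (hM : 0 ≤ M) (hκ : 0 < κ) (hq : 1 ≤ q) (hqκ : 2 * M ≤ κ * q)
    (hU : IsProfile g p (pathSign n) κ M l (T n) (T (n + 1)) U U' F)
    (hV : IsProfile g p (pathSign (n + 1)) κ M l (T (n + 1)) (T (n + 2)) V V' E)
    (hLR : L ≤ R) (hR : T (n + 1) - T n ≤ R) : T (n + 2) - T (n + 1) ≤ q * R := by
  have hR0 : 0 ≤ R := hL.trans hLR
  rcases le_or_gt (T (n + 2) - T (n + 1)) L with h | h
  · nlinarith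
  · have h1 := sq_le_sq.1 (hT.left_slope_sq_le hn hlL hU hV h)
    have h2 := le_abs_self (pathSign (n + 1) * V' (T (n + 1)))
    rw [abs_pathSign_mul] at h2
    have h3 := hU.right_slope_le
    have h4 := hV.left_slope
    have h5 : κ * (T (n + 2) - T (n + 1)) ≤ κ * (q * R) := by nlinarith
    exact le_of_mul_le_mul_left h5 hκ

theorem IsMaximizingPath.prev_length_le (hT : IsMaximizingPath g p L A B k T) (hn : n + 1 ≤ k)
    (hlL : l ≤ L) (hL : 0 ≤ L) (hM : 0 ≤ M) (hκ : 0 < κ) (hq : 1 ≤ q) (hqκ : 2 * M ≤ κ * q)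
    (hU : IsProfile g p (pathSign n) κ M l (T n) (T (n + 1)) U U' F)
    (hV : IsProfile g p (pathSign (n + 1)) κ M l (T (n + 1)) (T (n + 2)) V V' E)
    (hLR : L ≤ R) (hR : T (n + 2) - T (n + 1) ≤ R) : T (n + 1) - T n ≤ q * R := by
  have hR0 : 0 ≤ R := hL.trans hLR
  rcases le_or_gt (T (n + 1) - T n) L with h | h
  · nlinarith
  · have h1 := sq_le_sq.1 (hT.right_slope_sq_le hn hlL hU hV h)
    have h2 := neg_le_abs (pathSign n * U' (T (n + 1)))
    rw [abs_pathSign_mul] at h2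
    have h3 := hV.left_slope_le
    have h4 := hU.right_slope
    have h5 : κ * (T (n + 1) - T n) ≤ κ * (q * R) := by nlinarith
    exact le_of_mul_le_mul_left h5 hκ

end Slopes

/-! ### The length constraint is not active on long intervals. -/

namespace ForcedReaction

variable {g p : ℝ → ℝ} {m M K : ℝ}

/-- The three merged steps have nonpositive energies and the merged one is at least -4M²R³; the new
middle piece is at least -4M²L³. Splitting a step of length ℓ gains cℓ² - Cℓ, so maximality bounds
ℓ. -/
theorem long_step_lt (h : ForcedReaction g p m M K) {c C : ℝ} (hc : 0 < c) (hC : 0 ≤ C)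
    (hgain : ∀ σ : ℝ, σ = 1 ∨ σ = -1 → ∀ {a b x y : ℝ}, a < x →
      x ≤ (a + b) / 2 → (a + b) / 2 ≤ y → y < b →
      minEnergy g p σ a b ≤ minEnergy g p σ a x + minEnergy g p σ y b
        + (C * (b - a) - c * (b - a) ^ 2))
    {L A B R : ℝ} {k : ℕ} {T : ℕ → ℝ} (hT : IsMaximizingPath g p L A B k T) (hL : 1 ≤ L)
    {j n : ℕ} (hj : j + 2 ≤ k) (hn : n ≤ k) (hjn : n < j ∨ j + 2 < n)
    (hR : T (j + 3) - T j ≤ R) :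
    T (n + 1) - T n < 3 * L + (C + 4 * M ^ 2 * (R ^ 3 + L ^ 3)) / c + 1 := by
  by_contra! hlong
  set D := 4 * M ^ 2 * (R ^ 3 + L ^ 3) with hD
  have hjpos : T j < T (j + 3) := by
    have l1 := hT.le_sub j (by omega)
    have l2 : L ≤ T (j + 2) - T (j + 1) := hT.le_sub (j + 1) (by omega)
    have l3 : L ≤ T (j + 3) - T (j + 2) := hT.le_sub (j + 2) (by omega)
    linarith
  have hR0 : 0 ≤ R := by linarith
  have hD0 : 0 ≤ D := by positivity
  have hCD : 0 ≤ (C + D) / c := by positivity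
  -- The new piece of opposite sign has the least admissible length L and is centred, as the
  -- splitting estimate requires the midpoint to lie between x and y.
  set x := (T n + T (n + 1)) / 2 - L / 2 with hx
  set y := (T n + T (n + 1)) / 2 + L / 2 with hy
  have hlt : ∀ i ≤ k, T i < T (i + 1) := fun i hi => by linarith [hT.le_sub i hi]
  have hneg : ∀ i ≤ k, stepEnergy g p T i ≤ 0 := fun i hi => h.minEnergy_nonpos (hlt i hi)
  have key : minEnergy g p (pathSign j) (T j) (T (j + 3)) + minEnergy g p (pathSign n) (T n) x
      + minEnergy g p (pathSign (n + 1)) x y + minEnergy g p (pathSign n) y (T (n + 1))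
      ≤ stepEnergy g p T n := by
    have n1 := hneg j (by omega)
    have n2 := hneg (j + 1) (by omega)
    have n3 := hneg (j + 2) (by omega)
    rcases hjn with h1 | h1
    · obtain ⟨d, rfl⟩ : ∃ d, j = n + (d + 1) := ⟨j - n - 1, by omega⟩
      obtain ⟨e, he⟩ : ∃ e, k + 1 = n + (d + 4) + e := ⟨k + 1 - (n + (d + 4)), by omega⟩
      have h2 := hT.merge_split_left_le (by linarith) he (x := x) (y := y) (by linarith)
        (by linarith) (by linarith)
      have h3 : stepEnergy g p T (n + (d + 2)) ≤ 0 := n2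
      have h4 : stepEnergy g p T (n + (d + 3)) ≤ 0 := n3
      have h5 : minEnergy g p (pathSign (n + (d + 1))) (T (n + (d + 1))) (T (n + (d + 1) + 3))
        = minEnergy g p (pathSign (n + (d + 1))) (T (n + (d + 1))) (T (n + (d + 4))) := rfl
      linarith
    · obtain ⟨d, rfl⟩ : ∃ d, n = j + (d + 3) := ⟨n - j - 3, by omega⟩
      obtain ⟨e, he⟩ : ∃ e, k + 1 = j + (d + 4) + e := ⟨k + 1 - (j + (d + 4)), by omega⟩
      have hT4 : T (j + (d + 4)) = T (j + (d + 3) + 1) := rfl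
      have h2 := hT.merge_split_right_le (by linarith) he (x := x) (y := y) (by linarith)
        (by linarith) (by linarith)
      rw [hT4] at h2
      have h5 : minEnergy g p (pathSign (j + (d + 3) + 1)) x y
        = minEnergy g p (pathSign (j + (d + 4))) x y := rfl
      linarith
  have k1 := h.le_minEnergy (σ := pathSign j) hjpos
  have k2 := h.le_minEnergy (σ := pathSign (n + 1)) (show x < y by linarith)
  have k3 := hgain (pathSign n) (pathSign_eq n) (show T n < x by linarith)
    (by linarith) (show (T n + T (n + 1)) / 2 ≤ y by linarith) (by linarith)
  rw [show y - x = L by rw [hx, hy]; ring] at k2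
  have k4 : (T (j + 3) - T j) ^ 3 ≤ R ^ 3 := pow_le_pow_left₀ (by linarith) hR 3
  have k5 : 4 * M ^ 2 * (T (j + 3) - T j) ^ 3 ≤ 4 * M ^ 2 * R ^ 3 :=
    mul_le_mul_of_nonneg_left k4 (by positivity)
  set ℓ := T (n + 1) - T n with hℓ
  have k6 : minEnergy g p (pathSign n) (T n) (T (n + 1)) = stepEnergy g p T n := rfl
  have k7 : c * ℓ ^ 2 ≤ C * ℓ + D := by rw [hD]; linarith
  have k8 : C + D + c ≤ c * ℓ := by
    have : c * ((C + D) / c + 1) ≤ c * ℓ := mul_le_mul_of_nonneg_left (by linarith) hc.le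
    rwa [mul_add, mul_div_cancel₀ _ hc.ne', mul_one] at this
  have k9 : 1 ≤ ℓ := by linarith
  nlinarith

/-- A step of length L keeps nearby steps bounded, giving three consecutive short steps to merge,
while a large mean length provides a long step to split. -/
theorem exists_lt_length (h : ForcedReaction g p m M K) {κ l : ℝ} (hκ : 0 < κ) (hl : 1 ≤ l)
    (hprof : ∀ σ : ℝ, σ = 1 ∨ σ = -1 → ∀ a b, l ≤ b - a →
      ∃ U U' F, IsProfile g p σ κ M l a b U U' F) {L : ℝ} (hlL : l ≤ L) :
    ∃ H : ℝ, ∀ (A B : ℝ) (k : ℕ), H * (k + 1) ≤ B - A → ∀ T : ℕ → ℝ,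
      IsMaximizingPath g p L A B k T → ∀ n ≤ k, L < T (n + 1) - T n := by
  obtain ⟨c, C, hc, hC, hgain⟩ := h.exists_split_gain
  have hL : 1 ≤ L := hl.trans hlL
  have hM := h.bound_pos
  obtain ⟨q, hq, hqκ⟩ : ∃ q : ℝ, 1 ≤ q ∧ 2 * M ≤ κ * q :=
    ⟨max 1 (2 * M / κ), le_max_left _ _, by
      have := mul_le_mul_of_nonneg_left (le_max_right 1 (2 * M / κ)) hκ.le
      rwa [mul_div_cancel₀ _ hκ.ne'] at this⟩
  -- Two factors q: a window of three steps containing the short one reaches at most two steps away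
  -- from it.
  set R := q * (q * L) with hR
  have hqL : L ≤ q * L := le_mul_of_one_le_left (by linarith) hq
  have hqR : q * L ≤ R := le_mul_of_one_le_left (by linarith) hq
  set H₀ := 3 * L + (C + 4 * M ^ 2 * ((3 * R) ^ 3 + L ^ 3)) / c + 1 with hH₀
  have hH₀' : 0 ≤ H₀ := by
    have : 0 ≤ R := by linarith
    positivity
  refine ⟨R + 1 + H₀, fun A B k hH T hT => ?_⟩
  by_contra! hshort
  obtain ⟨i, hi, hiL⟩ := hshort
  have hnext : ∀ n, n + 1 ≤ k → ∀ r, L ≤ r → T (n + 1) - T n ≤ r →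
      T (n + 2) - T (n + 1) ≤ q * r := fun n hn r hr hnr => by
    obtain ⟨U, U', F, hU⟩ := hprof (pathSign n) (pathSign_eq n) (T n) (T (n + 1))
      (hlL.trans (hT.le_sub n (by omega)))
    obtain ⟨V, V', E, hV⟩ := hprof (pathSign (n + 1)) (pathSign_eq _) (T (n + 1)) (T (n + 2))
      (hlL.trans (hT.le_sub (n + 1) hn))
    exact hT.next_length_le hn hlL (by linarith) hM.le hκ hq hqκ hU hV hr hnr
  have hprev : ∀ n, n + 1 ≤ k → ∀ r, L ≤ r → T (n + 2) - T (n + 1) ≤ r →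
      T (n + 1) - T n ≤ q * r := fun n hn r hr hnr => by
    obtain ⟨U, U', F, hU⟩ := hprof (pathSign n) (pathSign_eq n) (T n) (T (n + 1))
      (hlL.trans (hT.le_sub n (by omega)))
    obtain ⟨V, V', E, hV⟩ := hprof (pathSign (n + 1)) (pathSign_eq _) (T (n + 1)) (T (n + 2))
      (hlL.trans (hT.le_sub (n + 1) hn))
    exact hT.prev_length_le hn hlL (by linarith) hM.le hκ hq hqκ hU hV hr hnr
  have hnear : ∀ n ≤ k, n ≤ i + 2 → i ≤ n + 2 → T (n + 1) - T n ≤ R := by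
    intro n hn h1 h2
    obtain rfl | rfl | rfl | rfl | rfl :
      n = i + 2 ∨ n = i + 1 ∨ n = i ∨ i = n + 1 ∨ i = n + 2 := by omega
    · exact hnext (i + 1) (by omega) _ hqL (hnext i (by omega) L le_rfl hiL)
    · exact (hnext i (by omega) L le_rfl hiL).trans hqR
    · linarith
    · exact (hprev n (by omega) L le_rfl hiL).trans hqR
    · exact hprev n (by omega) _ hqL (hprev (n + 1) (by omega) L le_rfl hiL)
  -- Pigeonhole: the k + 1 lengths add up to B - A. Exceeding R puts this step at least three places
  -- from i, so k ≥ 3; exceeding H₀ contradicts `long_step_lt`.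
  obtain ⟨n, hn, hnH⟩ : ∃ n ∈ Finset.range (k + 1), R + 1 + H₀ ≤ T (n + 1) - T n := by
    refine Finset.exists_le_of_sum_le (by simp) ?_
    rw [Finset.sum_range_sub, hT.left, hT.right]
    rw [Finset.sum_const, Finset.card_range, nsmul_eq_mul, mul_comm]
    exact_mod_cast hH
  have hnk : n ≤ k := by rw [Finset.mem_range] at hn; omega
  have hfar : ¬ (n ≤ i + 2 ∧ i ≤ n + 2) := fun hc => by
    have := hnear n hnk hc.1 hc.2
    linarith
  have hwin : ∀ j, j ≤ i → i ≤ j + 2 → j + 2 ≤ k → False := fun j h1 h2 h3 => by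
    have l1 := hnear j (by omega) (by omega) (by omega)
    have l2 : T (j + 2) - T (j + 1) ≤ R := hnear (j + 1) (by omega) (by omega) (by omega)
    have l3 : T (j + 3) - T (j + 2) ≤ R := hnear (j + 2) (by omega) (by omega) (by omega)
    have := h.long_step_lt hc hC hgain hT hL h3 hnk (by omega) (R := 3 * R) (by linarith)
    linarith
  -- The window of three steps starts at i if it fits, and otherwise consists of the last three
  -- steps.
  rcases le_or_gt (i + 2) k with h1 | h1
  · exact hwin i le_rfl (by omega) h1
  · exact hwin (k - 2) (by omega) (by omega) (by omega)

end ForcedReaction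

/-! ### Juxtaposition of the profiles along a maximizing path. -/

section Juxtaposition

variable {g p u : ℝ → ℝ} {κ M l L A B : ℝ} {k : ℕ} {T : ℕ → ℝ} {U U' F : ℕ → ℝ → ℝ}

theorem IsMaximizingPartition.isMaximizingPath {t : Fin (k + 2) → ℝ} (hL : 0 ≤ L)
    (ht : IsMaximizingPartition g p L A B t) (hTt : ∀ i : Fin (k + 2), T i = t i) :
    IsMaximizingPath g p L A B k T := by
  have htotal : ∀ S : ℕ → ℝ, totalEnergy g p (fun i : Fin (k + 2) => S i)
      = ∑ n ∈ Finset.range (k + 1), stepEnergy g p S n := fun S =>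
    Fin.sum_univ_eq_sum_range (fun n => stepEnergy g p S n) (k + 1)
  have ht' : (fun i : Fin (k + 2) => T i) = t := funext hTt
  refine ⟨⟨?_, ?_, fun n hn => ?_⟩, fun S hS => ?_⟩
  · rw [← ht.1.1]; exact hTt 0
  · rw [← ht.1.2.1]; exact hTt (Fin.last (k + 1))
  · have h1 := (ht.1.2.2 ⟨n, by omega⟩).2
    rwa [← hTt, ← hTt] at h1
  · rw [← htotal, ← htotal, ht']
    refine ht.2 ⟨?_, ?_, fun i => ?_⟩
    · exact hS.left
    · exact hS.right
    · have : L ≤ S (i.succ : Fin (k + 2)) - S (i.castSucc : Fin (k + 2)) :=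
        hS.le_sub i (by omega)
      exact ⟨by linarith, this⟩

theorem IsPath.strictMono (hT : IsPath L A B k T) (hL : 0 < L) {i : ℕ} :
    ∀ {j : ℕ}, i < j → j ≤ k + 1 → T i < T j := by
  intro j hij
  induction j, hij using Nat.le_induction with
  | base => intro h; linarith [hT.le_sub i (by omega)]
  | succ j hj ih => intro h; linarith [ih (by omega), hT.le_sub j (by omega)]

theorem exists_mem_step (T : ℕ → ℝ) {s : ℝ} (n : ℕ) (hs : s ∈ Icc (T 0) (T (n + 1))) :
    ∃ i ≤ n, s ∈ Icc (T i) (T (i + 1)) := by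
  induction n with
  | zero => exact ⟨0, le_rfl, hs⟩
  | succ n ih =>
    rcases le_total s (T (n + 1)) with h | h
    · obtain ⟨i, hi, h1⟩ := ih ⟨hs.1, h⟩
      exact ⟨i, hi.trans (Nat.le_succ n), h1⟩
    · exact ⟨n + 1, le_rfl, h, hs.2⟩

theorem exists_juxtaposition (hT : IsPath L A B k T) (hL : 0 < L)
    (hU : ∀ n ≤ k, IsProfile g p (pathSign n) κ M l (T n) (T (n + 1)) (U n) (U' n) (F n)) :
    ∀ n ≤ k, ∃ v : ℝ → ℝ, ∀ i ≤ n, EqOn v (U i) (Icc (T i) (T (i + 1))) := by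
  intro n hn
  induction n with
  | zero => exact ⟨U 0, fun i hi => by rw [Nat.le_zero.1 hi]; exact fun _ _ => rfl⟩
  | succ n ih =>
    obtain ⟨v, hv⟩ := ih (by omega)
    refine ⟨fun s => if s ≤ T (n + 1) then v s else U (n + 1) s, fun i hi s hs => ?_⟩
    simp only
    rcases hi.lt_or_eq with h1 | rfl
    · have h2 : T (i + 1) ≤ T (n + 1) := by
        rcases (show i = n ∨ i + 1 < n + 1 by omega) with rfl | h3
        · exact le_rfl
        · exact (hT.strictMono hL h3 (by omega)).le
      rw [if_pos (hs.2.trans h2)]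
      exact hv i (by omega) hs
    · split_ifs with h2
      · obtain rfl : s = T (n + 1) := le_antisymm h2 hs.1
        have h3 := hT.strictMono hL (Nat.lt_succ_self n) (by omega)
        rw [hv n le_rfl (right_mem_Icc.2 h3.le), (hU n (by omega)).isMinimizer.right,
          (hU (n + 1) hn).isMinimizer.left]
      · rfl

/-- Both adjacent steps exceed L, so the squared slopes are equal. A profile of sign σ arrives at
the node with a slope of sign -σ, which is also the sign with which the next profile leaves; hence
the slopes coincide. -/
theorem IsMaximizingPath.slope_eq (hT : IsMaximizingPath g p L A B k T) (hL : 0 < L)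
    (hlL : l ≤ L) (hκ : 0 < κ) (hlt : ∀ n ≤ k, L < T (n + 1) - T n)
    (hU : ∀ n ≤ k, IsProfile g p (pathSign n) κ M l (T n) (T (n + 1)) (U n) (U' n) (F n))
    {n : ℕ} (hn : n + 1 ≤ k) : U' n (T (n + 1)) = U' (n + 1) (T (n + 1)) := by
  have h1 := hU n (by omega)
  have h2 := hU (n + 1) hn
  have hsq := le_antisymm (hT.right_slope_sq_le hn hlL h1 h2 (hlt n (by omega)))
    (hT.left_slope_sq_le hn hlL h1 h2 (hlt (n + 1) hn))
  have h3 := h1.right_slope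
  have h4 := h2.left_slope
  have h5 : 0 < κ * (T (n + 1) - T n) := mul_pos hκ (by linarith [hlt n (by omega)])
  have h6 : 0 < κ * (T (n + 1 + 1) - T (n + 1)) := mul_pos hκ (by linarith [hlt (n + 1) hn])
  rcases sq_eq_sq_iff_eq_or_eq_neg.1 hsq with h7 | h7
  · exact h7
  · rw [pathSign_succ] at h4
    rw [h7] at h3
    linarith

theorem IsMaximizingPath.exists_classicalExtension (hT : IsMaximizingPath g p L A B k T)
    (hL : 0 < L) (hlL : l ≤ L) (hκ : 0 < κ) (hlt : ∀ n ≤ k, L < T (n + 1) - T n)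
    (hU : ∀ n ≤ k, IsProfile g p (pathSign n) κ M l (T n) (T (n + 1)) (U n) (U' n) (F n))
    (hu : ∀ n ≤ k, EqOn u (U n) (Icc (T n) (T (n + 1)))) :
    ∀ n ≤ k, ∃ W W' E : ℝ → ℝ, IsClassicalExtension g p u (T 0) (T (n + 1)) W W' E ∧
      W' (T (n + 1)) = U' n (T (n + 1)) := by
  have hext : ∀ n ≤ k, IsClassicalExtension g p u (T n) (T (n + 1)) (U n) (U' n) (F n) :=
    fun n hn => { (hU n hn).extension with eqOn := hu n hn }
  intro n hn
  induction n with
  | zero => exact ⟨U 0, U' 0, F 0, hext 0 hn, rfl⟩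
  | succ n ih =>
    obtain ⟨W, W', E, hW, hs⟩ := ih (by omega)
    have h1 := hT.slope_eq hL hlL hκ hlt hU hn
    have h2 := hT.strictMono hL (Nat.succ_pos n) (by omega)
    have h3 := hT.strictMono hL (Nat.lt_succ_self (n + 1)) (by omega)
    refine ⟨_, _, _, hW.glue h2.le h3.le (hext (n + 1) hn) (hs.trans h1), ?_⟩
    exact if_neg h3.not_ge

theorem IsPath.zeros_eq (hT : IsPath L A B k T) (hL : 0 < L)
    (hU : ∀ n ≤ k, IsProfile g p (pathSign n) κ M l (T n) (T (n + 1)) (U n) (U' n) (F n))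
    (hu : ∀ n ≤ k, EqOn u (U n) (Icc (T n) (T (n + 1)))) :
    {s ∈ Ioo A B | u s = 0} = (fun n => T (n + 1)) '' (Finset.range k : Set ℕ) := by
  ext s
  constructor
  · rintro ⟨hs, hs0⟩
    rw [← hT.left, ← hT.right] at hs
    obtain ⟨n, hn, h1⟩ := exists_mem_step T k (Ioo_subset_Icc_self hs)
    rcases h1.1.eq_or_lt with rfl | h2
    · match n with
      | 0 => exact absurd hs.1 (lt_irrefl _)
      | n + 1 => exact ⟨n, by simpa using hn, rfl⟩
    · rcases h1.2.eq_or_lt with rfl | h3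
      · refine ⟨n, ?_, rfl⟩
        rcases hn.lt_or_eq with h4 | rfl
        · simpa using h4
        · exact absurd hs.2 (lt_irrefl _)
      · have h4 := (hU n hn).pos s ⟨h2, h3⟩
        rw [← hu n hn h1, hs0, mul_zero] at h4
        exact absurd h4 (lt_irrefl _)
  · rintro ⟨n, hn, rfl⟩
    have hn : n < k := by simpa using hn
    have h1 := hT.strictMono hL (Nat.lt_succ_self n) (by omega)
    refine ⟨⟨?_, ?_⟩, ?_⟩
    · rw [← hT.left]; exact hT.strictMono hL (Nat.succ_pos n) (by omega)
    · rw [← hT.right]; exact hT.strictMono hL (by omega) le_rfl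
    · exact (hu n hn.le (right_mem_Icc.2 h1.le)).trans (hU n hn.le).isMinimizer.right

theorem IsPath.encard_zeros (hT : IsPath L A B k T) (hL : 0 < L)
    (hU : ∀ n ≤ k, IsProfile g p (pathSign n) κ M l (T n) (T (n + 1)) (U n) (U' n) (F n))
    (hu : ∀ n ≤ k, EqOn u (U n) (Icc (T n) (T (n + 1)))) :
    {s ∈ Ioo A B | u s = 0}.encard = k := by
  rw [hT.zeros_eq hL hU hu, InjOn.encard_image, encard_coe_eq_coe_finsetCard, Finset.card_range]
  intro i hi j hj hij
  have hi : i < k := by simpa using hi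
  have hj : j < k := by simpa using hj
  rcases lt_trichotomy i j with h | h | h
  · exact absurd hij (hT.strictMono hL (Nat.succ_lt_succ h) (by omega)).ne
  · exact h
  · exact absurd hij (hT.strictMono hL (Nat.succ_lt_succ h) (by omega)).ne'

end Juxtaposition

/-! ### Assembly of the theorem. -/

theorem IsReaction.exists_forcedReaction {g p : ℝ → ℝ} {gMinus gPlus m : ℝ} (hg : IsReaction g)
    (hgMinus : Tendsto g atBot (𝓝 gMinus)) (hgPlus : Tendsto g atTop (𝓝 gPlus))
    (hp : Continuous p) (hp_bdd : ∃ M : ℝ, ∀ t, |p t| ≤ M) (hm : HasAsymptoticAverage p m)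
    (hm_lower : gMinus < m) (hm_upper : m < gPlus) : ∃ M K, ForcedReaction g p m M K := by
  obtain ⟨M₁, hM₁⟩ := hg.bounded
  obtain ⟨M₂, hM₂⟩ := hp_bdd
  obtain ⟨K, hK⟩ := hg.exists_lipschitz
  obtain ⟨r, hr⟩ := ((hgPlus.eventually (lt_mem_nhds hm_upper)).and (eventually_gt_atTop 0)).exists
  obtain ⟨s, hs⟩ := ((hgMinus.eventually (gt_mem_nhds hm_lower)).and (eventually_lt_atBot 0)).exists
  refine ⟨max 1 (max M₁ M₂), max 1 K, hg, hp, le_max_left _ _, fun x => ?_, fun t => ?_,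
    le_max_left _ _, fun x y => ?_, hm, ⟨r, hr.2, hr.1⟩, ⟨s, hs.2, hs.1⟩⟩
  · exact (hM₁ x).trans ((le_max_left _ _).trans (le_max_right _ _))
  · exact (hM₂ t).trans ((le_max_right _ _).trans (le_max_right _ _))
  · exact (hK x y).trans (mul_le_mul_of_nonneg_right (le_max_right _ _) (abs_nonneg _))

theorem proposition7 (g p : ℝ → ℝ) (gMinus gPlus m : ℝ) (hg : IsReaction g)
    (hgMinus : Tendsto g atBot (𝓝 gMinus)) (hgPlus : Tendsto g atTop (𝓝 gPlus))
    (hp : Continuous p) (hp_bdd : ∃ M : ℝ, ∀ t, |p t| ≤ M) (hm : HasAsymptoticAverage p m)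
    (hm_lower : gMinus < m) (hm_upper : m < gPlus) :
    ∃ L₀ : ℝ, 0 < L₀ ∧
      -- on every interval of length at least `L₀` the minimizer of each sign exists,
      -- has strict sign and is unique
      (∀ a b : ℝ, L₀ ≤ b - a → ∀ σ : ℝ, σ = 1 ∨ σ = -1 →
        ∃ u : ℝ → ℝ, IsMinimizer g p σ a b u ∧ (∀ t ∈ Ioo a b, 0 < σ * u t) ∧
          ∀ v : ℝ → ℝ, IsMinimizer g p σ a b v → EqOn v u (Icc a b)) ∧
      ∀ L : ℝ, L₀ ≤ L → ∃ H : ℝ, ∀ (A B : ℝ) (k : ℕ), H * (k + 1) ≤ B - A →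
        ∀ t : Fin (k + 2) → ℝ, IsMaximizingPartition g p L A B t →
          (∃ u : ℝ → ℝ, IsGluing g p t u) ∧
          ∀ u : ℝ → ℝ, IsGluing g p t u →
            IsSolutionOn g p A B u ∧ {s ∈ Ioo A B | u s = 0}.encard = k := by
  obtain ⟨M, K, h⟩ := hg.exists_forcedReaction hgMinus hgPlus hp hp_bdd hm hm_lower hm_upper
  obtain ⟨κ, l, hκ, hl, hprof⟩ := h.exists_profile
  refine ⟨l, by linarith, fun a b hab σ hσ => ?_, fun L hlL => ?_⟩
  · obtain ⟨U, U', F, hU⟩ := hprof σ hσ a b hab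
    exact ⟨U, hU.isMinimizer, hU.pos, hU.unique⟩
  · obtain ⟨H, hH⟩ := h.exists_lt_length hκ hl hprof hlL
    refine ⟨H, fun A B k hHk t ht => ?_⟩
    have hL : 0 < L := by linarith
    obtain ⟨T, hTt⟩ : ∃ T : ℕ → ℝ, ∀ i : Fin (k + 2), T i = t i :=
      ⟨fun n => if hn : n < k + 2 then t ⟨n, hn⟩ else 0, fun i => by simp⟩
    have hT := ht.isMaximizingPath hL.le hTt
    have hlt := hH A B k hHk T hT
    have hU : ∀ n, ∃ U U' F, n ≤ k →
        IsProfile g p (pathSign n) κ M l (T n) (T (n + 1)) U U' F := fun n => by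
      by_cases hn : n ≤ k
      · obtain ⟨U, U', F, hU⟩ := hprof (pathSign n) (pathSign_eq n) (T n) (T (n + 1))
          (hlL.trans (hT.le_sub n hn))
        exact ⟨U, U', F, fun _ => hU⟩
      · exact ⟨0, 0, 0, fun hc => absurd hc hn⟩
    choose U U' F hU using hU
    have hleft : ∀ i : Fin (k + 1), t i.castSucc = T i := fun i => (hTt i.castSucc).symm
    have hright : ∀ i : Fin (k + 1), t i.succ = T (i + 1) := fun i => (hTt i.succ).symm
    refine ⟨?_, fun u hu => ?_⟩
    · obtain ⟨u, hu⟩ := exists_juxtaposition hT.toIsPath hL hU k le_rfl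
      refine ⟨u, fun i => ⟨U i, ?_, ?_⟩⟩
      · rw [hleft, hright]
        exact (hU i (by omega)).isMinimizer
      · rw [hleft, hright]
        exact hu i (by omega)
    -- Uniqueness of the minimizers identifies an arbitrary gluing with the chosen profiles.
    · have hu' : ∀ n ≤ k, EqOn u (U n) (Icc (T n) (T (n + 1))) := fun n hn => by
        obtain ⟨w, hw, huw⟩ := hu ⟨n, by omega⟩
        rw [hleft, hright] at hw huw
        exact huw.trans ((hU n hn).unique w hw)
      refine ⟨?_, hT.encard_zeros hL hU hu'⟩
      obtain ⟨W, W', E, hW, -⟩ := hT.exists_classicalExtension hL hlL hκ hlt hU hu' k le_rfl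
      rw [hT.left, hT.right] at hW
      exact hW.isSolutionOn
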